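/- Let $d$ be a natural number. A \emph{weight} on $\mathbf R^{2d}$ is a positive function $\omega\in L^\infty_{loc}(\mathbf R^{2d})$ with $1/\omega\in L^\infty_{loc}(\mathbf R^{2d})$. It is \emph{moderate}, $\omega\in\mathscr P_E(\mathbf R^{2d})$, if there are a weight $v$ and a constant $C\ge 1$ with $\omega(X+Y)\le C\,\omega(X)v(Y)$ for all $X,Y\in\mathbf R^{2d}$; it is \emph{polynomially moderate}, $\omega\in\mathscr P(\mathbf R^{2d})$, if there are $C,r>0$ with $\omega(X+Y)\le C\,\omega(X)(1+|Y|)^r$ for all $X,Y$. Let $\Sigma_1(\mathbf R^d)$ be the Gelfand--Shilov space of all $f\in C^\infty(\mathbf R^d)$ such that $\sup_{\alpha,\beta}\|x^\alpha D^\beta f\|_{L^\infty}/(h^{|\alpha+\beta|}\alpha!\beta!)<\infty$ for every $h>0$, with the Fréchet topology given by these seminorms, and let $\Sigma_1'(\mathbf R^d)$ be its dual. Fix $\phi\in\Sigma_1(\mathbf R^d)\setminus\{0\}$ and, for $f\in\Sigma_1'(\mathbf R^d)$, let $$V_\phi f(x,\xi)=(2\pi)^{-d/2}\,(f,\phi(\cdot-x)e^{i\langle\cdot,\xi\rangle})_{L^2},\qquad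 x,\xi\in\mathbf R^d,$$ be its short-time Fourier transform, where $(\cdot,\cdot)_{L^2}$ is the extension of the $L^2$ inner product to $\Sigma_1'\times\Sigma_1$. For $p,q\in(0,\infty]$ and $\omega\in\mathscr P_E(\mathbf R^{2d})$, let $M^{p,q}_{(\omega)}(\mathbf R^d)$ be the space of all $f\in\Sigma_1'(\mathbf R^d)$ for which $$\|f\|_{M^{p,q}_{(\omega)}}=\Big\|\,\xi\mapsto\|V_\phi f(\cdot,\xi)\,\omega(\cdot,\xi)\|_{L^p(\mathbf R^d)}\Big\|_{L^q(\mathbf R^d)}$$ is finite, let $M^{\flat,q}_{(\omega)}(\mathbf R^d)=\bigcap_{p\in(0,\infty]}M^{p,q}_{(\omega)}(\mathbf R^d)$, and let $M^{\sharp,q}_{(\omega)}(\mathbf R^d)$ be the space of all $f\in M^{\infty,q}_{(\omega)}(\mathbf R^d)$ such that $$\lim_{R\to\infty}\Big\|\,\xi\mapsto\sup_{|x|\ge R}|V_\phi f(x,\xi)\,\omega(x,\xi)|\,\Big\|_{L^q(\mathbf R^d)}=0$$ (with the essential supremum), topologized by the quasi-norm $\|\cdot\|_{M^{\infty,q}_{(\omega)}}$.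 Functions $g$ are identified with the distributions $\psi\mapsto\int g\psi\,dx$, and $\mathscr E'(\mathbf R^d)$ denotes the distributions with compact support. Let $q\in(0,\infty)$ and $\omega\in\mathscr P_E(\mathbf R^{2d})$. Then: (1) $M^{\flat,q}_{(\omega)}(\mathbf R^d)$ and $\Sigma_1(\mathbf R^d)$ are (contained and) dense in $M^{\sharp,q}_{(\omega)}(\mathbf R^d)$; (2) if in addition $\omega\in\mathscr P(\mathbf R^{2d})$, then $M^{\flat,q}_{(\omega)}(\mathbf R^d)\cap\mathscr E'(\mathbf R^d)$ and $C_0^\infty(\mathbf R^d)$ are (contained and) dense in $M^{\sharp,q}_{(\omega)}(\mathbf R^d)$. -/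

import Mathlib

open MeasureTheory Filter Topology
open scoped ENNReal SchwartzMap

noncomputable section

/-- The Euclidean space `ℝ^d`. -/
abbrev Eucl (d : ℕ) : Type := EuclideanSpace ℝ (Fin d)

/-! ### Weights -/

section Weights

variable {X : Type*} [NormedAddCommGroup X] [MeasureSpace X]

/-- A weight: a positive function `ω ∈ L^∞_loc` such that `1/ω ∈ L^∞_loc`. -/
def IsWeight (ω : X → ℝ) : Prop :=
  (∀ x, 0 < ω x) ∧ ∀ K : Set X, IsCompact K →
    MemLp ω ⊤ (volume.restrict K) ∧ MemLp (fun x => (ω x)⁻¹) ⊤ (volume.restrict K)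

/-- The class `𝒫_E` of moderate weights. -/
def IsModerateWeight (ω : X → ℝ) : Prop :=
  IsWeight ω ∧ ∃ v : X → ℝ, IsWeight v ∧
    ∃ C : ℝ, 1 ≤ C ∧ ∀ x y, ω (x + y) ≤ C * ω x * v y

/-- The class `𝒫` of polynomially moderate weights. (On `ℝ^d × ℝ^d` the norm of Mathlib is
`max |x| |ξ|`; replacing it by the equivalent Euclidean norm only changes the constant `C`.) -/
def IsPolynomiallyModerateWeight (ω : X → ℝ) : Prop :=
  IsWeight ω ∧ ∃ C r : ℝ, 0 < C ∧ 0 < r ∧ ∀ x y, ω (x + y) ≤ C * ω x * (1 + ‖y‖) ^ r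

end Weights

/-! ### The Gelfand–Shilov space `Σ_1` and its dual -/

/-- The smooth functions `f` on `ℝ^d` such that, for every `h > 0`,
`sup_{k,n,x} |x|^k |D^n f(x)| / (h^{k+n} k! n!) < ∞`, where `D^n f(x)` is the `n`-th Fréchet
derivative. Since `α! β! ≤ |α|! |β|! ≤ d^{|α+β|} α! β!`, and `h` is arbitrary, this is the usual
condition `sup_{α,β} ‖x^α D^β f‖_∞ / (h^{|α+β|} α! β!) < ∞` for all `h > 0`. -/
def gelfandShilovSubmodule (d : ℕ) : Submodule ℂ (Eucl d → ℂ) where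
  carrier := {f | ContDiff ℝ (⊤ : ℕ∞) f ∧ ∀ h : ℝ, 0 < h → ∃ C : ℝ, ∀ (k n : ℕ) (x : Eucl d),
    ‖x‖ ^ k * ‖iteratedFDeriv ℝ n f x‖ ≤ C * (h ^ (k + n) * k.factorial * n.factorial)}
  zero_mem' := by
    refine ⟨contDiff_const, fun h hh => ⟨0, fun k n x => ?_⟩⟩
    have : iteratedFDeriv ℝ n (0 : Eucl d → ℂ) x = 0 := by
      have := iteratedFDeriv_fun_zero (𝕜 := ℝ) (E := Eucl d) (F := ℂ) (n := n)
      exact congrFun this x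
    simp [this]
  add_mem' := by
    rintro f g ⟨hf, hf'⟩ ⟨hg, hg'⟩
    refine ⟨hf.add hg, fun h hh => ?_⟩
    obtain ⟨C, hC⟩ := hf' h hh
    obtain ⟨C', hC'⟩ := hg' h hh
    refine ⟨C + C', fun k n x => ?_⟩
    have hn : (n : WithTop ℕ∞) ≤ ((⊤ : ℕ∞) : WithTop ℕ∞) := by exact_mod_cast le_top
    rw [iteratedFDeriv_add_apply (hf.of_le hn).contDiffAt (hg.of_le hn).contDiffAt]
    calc _ ≤ ‖x‖ ^ k * (‖iteratedFDeriv ℝ n f x‖ + ‖iteratedFDeriv ℝ n g x‖) := by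
          gcongr; exact norm_add_le _ _
      _ ≤ _ := by rw [mul_add, add_mul]; exact add_le_add (hC k n x) (hC' k n x)
  smul_mem' := by
    rintro c f ⟨hf, hf'⟩
    refine ⟨contDiff_const.smul hf, fun h hh => ?_⟩
    obtain ⟨C, hC⟩ := hf' h hh
    refine ⟨‖c‖ * C, fun k n x => ?_⟩
    have hn : (n : WithTop ℕ∞) ≤ ((⊤ : ℕ∞) : WithTop ℕ∞) := by exact_mod_cast le_top
    rw [iteratedFDeriv_const_smul_apply (hf.of_le hn).contDiffAt, norm_smul, mul_left_comm,
      mul_assoc]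
    exact mul_le_mul_of_nonneg_left (hC k n x) (norm_nonneg c)

/-- The Gelfand–Shilov space `Σ_1(ℝ^d)` (a type of its own, so that it carries its own topology). -/
def GelfandShilov (d : ℕ) : Type := gelfandShilovSubmodule d

namespace GelfandShilov

variable {d : ℕ}

instance : AddCommGroup (GelfandShilov d) := inferInstanceAs (AddCommGroup (gelfandShilovSubmodule d))

instance : Module ℂ (GelfandShilov d) := inferInstanceAs (Module ℂ (gelfandShilovSubmodule d))

instance : FunLike (GelfandShilov d) (Eucl d) ℂ where
  coe f := f.1
  coe_injective _ _ h := Subtype.ext h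

theorem add_apply (f g : GelfandShilov d) (x : Eucl d) : (f + g) x = f x + g x := rfl

theorem smul_apply (c : ℂ) (f : GelfandShilov d) (x : Eucl d) : (c • f) x = c * f x := rfl

theorem contDiff (f : GelfandShilov d) : ContDiff ℝ (⊤ : ℕ∞) f := f.2.1

theorem bound (f : GelfandShilov d) (h : ℝ) (hh : 0 < h) :
    ∃ C : ℝ, ∀ (k n : ℕ) (x : Eucl d),
      ‖x‖ ^ k * ‖iteratedFDeriv ℝ n f x‖ ≤ C * (h ^ (k + n) * k.factorial * n.factorial) :=
  f.2.2 h hh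

/-- The quotients whose supremum over all `(k, n, x)` is the seminorm with parameter `h`. -/
def quotient (h : ℝ) (f : GelfandShilov d) (z : ℕ × ℕ × Eucl d) : ℝ :=
  ‖z.2.2‖ ^ z.1 * ‖iteratedFDeriv ℝ z.2.1 f z.2.2‖ /
    (h ^ (z.1 + z.2.1) * z.1.factorial * z.2.1.factorial)

theorem bddAbove_quotient (h : {h : ℝ // 0 < h}) (f : GelfandShilov d) :
    BddAbove (Set.range (quotient h.1 f)) := by
  obtain ⟨C, hC⟩ := f.bound h.1 h.2
  refine ⟨C, ?_⟩
  rintro _ ⟨z, rfl⟩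
  have := h.2
  exact (div_le_iff₀ (by positivity)).2 (hC _ _ _)

/-- The seminorm `‖f‖_[h] = sup_{k,n,x} |x|^k |D^n f(x)| / (h^{k+n} k! n!)` on `Σ_1`. -/
def gsSeminorm (d : ℕ) (h : {h : ℝ // 0 < h}) : Seminorm ℂ (GelfandShilov d) :=
  Seminorm.ofSMulLE (fun f => ⨆ z, quotient h.1 f z)
    (by
      have : ∀ z, quotient h.1 (0 : GelfandShilov d) z = 0 := by
        intro z
        have h0 : iteratedFDeriv ℝ z.2.1 (0 : Eucl d → ℂ) z.2.2 = 0 :=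
          congrFun (iteratedFDeriv_fun_zero (𝕜 := ℝ) (E := Eucl d) (F := ℂ)) _
        have h1 : ⇑(0 : GelfandShilov d) = (0 : Eucl d → ℂ) := rfl
        simp [quotient, h1, h0]
      simp [this])
    (by
      intro f g
      refine ciSup_le fun z => le_trans ?_
        (add_le_add (le_ciSup (bddAbove_quotient h f) z) (le_ciSup (bddAbove_quotient h g) z))
      have hn : (z.2.1 : WithTop ℕ∞) ≤ ((⊤ : ℕ∞) : WithTop ℕ∞) := by exact_mod_cast le_top
      have h1 : ⇑(f + g) = ⇑f + ⇑g := rfl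
      have := h.2
      rw [quotient, quotient, quotient, ← add_div, ← mul_add, h1,
        iteratedFDeriv_add_apply (f.contDiff.of_le hn).contDiffAt (g.contDiff.of_le hn).contDiffAt]
      gcongr
      exact norm_add_le _ _)
    (by
      intro c f
      refine ciSup_le fun z => le_trans (le_of_eq ?_)
        (mul_le_mul_of_nonneg_left (le_ciSup (bddAbove_quotient h f) z) (norm_nonneg c))
      have hn : (z.2.1 : WithTop ℕ∞) ≤ ((⊤ : ℕ∞) : WithTop ℕ∞) := by exact_mod_cast le_top
      have h1 : ⇑(c • f) = c • ⇑f := rfl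
      rw [quotient, quotient, h1,
        iteratedFDeriv_const_smul_apply (f.contDiff.of_le hn).contDiffAt, norm_smul]
      ring)

instance : Nonempty {h : ℝ // 0 < h} := ⟨⟨1, one_pos⟩⟩

/-- The topology of `Σ_1`, defined by the seminorms `‖·‖_[h]`, `h > 0`. -/
instance : TopologicalSpace (GelfandShilov d) :=
  SeminormFamily.moduleFilterBasis (gsSeminorm d) |>.topology

theorem withSeminorms : WithSeminorms (gsSeminorm d) := ⟨rfl⟩

/-- Elements of `Σ_1` are Schwartz functions. -/
def toSchwartz (f : GelfandShilov d) : 𝓢(Eucl d, ℂ) where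
  toFun := f
  smooth' := f.contDiff
  decay' k n := by
    obtain ⟨C, hC⟩ := f.bound 1 one_pos
    exact ⟨_, fun x => hC k n x⟩

theorem integrable (f : GelfandShilov d) : Integrable (f : Eucl d → ℂ) :=
  f.toSchwartz.integrable

end GelfandShilov

/-- The space `Σ_1'(ℝ^d)` of Gelfand–Shilov distributions: the topological dual of `Σ_1(ℝ^d)`. -/
abbrev GelfandShilovDual (d : ℕ) : Type := GelfandShilov d →L[ℂ] ℂ

namespace GelfandShilovDual

variable {d : ℕ}

theorem integrable_mul {g : Eucl d → ℂ} (hg : Integrable g) (ψ : GelfandShilov d) :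
    Integrable (fun y => g y * ψ y) := by
  obtain ⟨C, hC⟩ := ψ.bound 1 one_pos
  refine hg.mul_bdd (c := C) ψ.contDiff.continuous.aestronglyMeasurable (.of_forall fun y => ?_)
  simpa using hC 0 0 y

/-- The distribution `ψ ↦ ∫ g ψ` given by an integrable function `g`. -/
def ofIntegrable (g : Eucl d → ℂ) (hg : Integrable g) : GelfandShilovDual d where
  toFun ψ := ∫ y, g y * ψ y
  map_add' ψ χ := by
    simp only [GelfandShilov.add_apply, mul_add]
    exact integral_add (integrable_mul hg ψ) (integrable_mul hg χ)
  map_smul' c ψ := by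
    simp only [GelfandShilov.smul_apply, mul_left_comm _ c, RingHom.id_apply, smul_eq_mul]
    exact integral_const_mul _ _
  cont := by
    let L : GelfandShilov d →ₗ[ℂ] ℂ :=
      { toFun := fun ψ => ∫ y, g y * ψ y
        map_add' := fun ψ χ => by
          simp only [GelfandShilov.add_apply, mul_add]
          exact integral_add (integrable_mul hg ψ) (integrable_mul hg χ)
        map_smul' := fun c ψ => by
          simp only [GelfandShilov.smul_apply, mul_left_comm _ c, RingHom.id_apply, smul_eq_mul]
          exact integral_const_mul _ _ }
    change Continuous L
    refine GelfandShilov.withSeminorms.continuous_normedSpace_rng ℂ L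
      ⟨{⟨1, one_pos⟩}, ⟨∫ y, ‖g y‖, integral_nonneg fun _ => norm_nonneg _⟩, fun ψ => ?_⟩
    have hb : ∀ y, ‖ψ y‖ ≤ GelfandShilov.gsSeminorm d ⟨1, one_pos⟩ ψ := by
      intro y
      have := le_ciSup (GelfandShilov.bddAbove_quotient ⟨1, one_pos⟩ ψ) (0, 0, y)
      have h2 : GelfandShilov.quotient 1 ψ (0, 0, y) = ‖ψ y‖ := by simp [GelfandShilov.quotient]
      exact h2 ▸ this
    have : ‖∫ y, g y * ψ y‖ ≤ (∫ y, ‖g y‖) * GelfandShilov.gsSeminorm d ⟨1, one_pos⟩ ψ := by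
      rw [← integral_mul_const]
      refine norm_integral_le_of_norm_le (hg.norm.mul_const _) (.of_forall fun y => ?_)
      rw [norm_mul]
      exact mul_le_mul_of_nonneg_left (hb y) (norm_nonneg _)
    rw [Finset.sup_singleton]
    exact this

end GelfandShilovDual

/-! ### The short-time Fourier transform -/

theorem contDiff_character {d : ℕ} (ξ : Eucl d) : ContDiff ℝ (⊤ : ℕ∞)
    (fun y : Eucl d => Complex.exp (-(Complex.I * (inner ℝ y ξ : ℝ)))) := by
  have h : ContDiff ℝ (⊤ : ℕ∞) (fun y : Eucl d => ((inner ℝ y ξ : ℝ) : ℂ)) :=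
    Complex.ofRealCLM.contDiff.comp (contDiff_id.inner ℝ contDiff_const)
  exact ((contDiff_const.mul h).neg).cexp

theorem norm_iteratedFDeriv_character_le {d : ℕ} (ξ : Eucl d) (n : ℕ) (y : Eucl d) :
    ‖iteratedFDeriv ℝ n
      (fun y : Eucl d => Complex.exp (-(Complex.I * (inner ℝ y ξ : ℝ)))) y‖ ≤ ‖ξ‖ ^ n := by
  let e : ℝ → ℂ := fun t => Complex.exp (-Complex.I * t)
  have hd : ∀ m : ℕ, iteratedDeriv m e = fun t => (-Complex.I) ^ m * e t := by
    intro m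
    induction m with
    | zero => simp
    | succ m ih =>
      rw [iteratedDeriv_succ, ih]
      funext t
      have h1 : HasDerivAt e (e t * (-Complex.I * 1)) t :=
        ((Complex.ofRealCLM.hasDerivAt (x := t)).const_mul (-Complex.I)).cexp
      rw [(h1.const_mul ((-Complex.I) ^ m)).deriv]
      ring
  have he : ContDiff ℝ n e :=
    (contDiff_const.mul Complex.ofRealCLM.contDiff).cexp
  have hcomp : (fun y : Eucl d => Complex.exp (-(Complex.I * (inner ℝ y ξ : ℝ)))) =
      e ∘ (innerSL ℝ ξ) := by
    funext y
    simp [e, real_inner_comm]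
  rw [hcomp, (innerSL ℝ ξ).iteratedFDeriv_comp_right he y le_rfl]
  refine (ContinuousMultilinearMap.norm_compContinuousLinearMap_le _ _).trans ?_
  have h1 : ‖e (innerSL ℝ ξ y)‖ = 1 := by
    have : e (innerSL ℝ ξ y) = Complex.exp ((-(innerSL ℝ ξ y) : ℝ) * Complex.I) := by
      simp only [e]; push_cast; ring_nf
    rw [this, Complex.norm_exp_ofReal_mul_I]
  rw [norm_iteratedFDeriv_eq_norm_iteratedDeriv, hd]
  rw [norm_mul, h1]
  simp

theorem GelfandShilov.shift_bound {d : ℕ} (φ : GelfandShilov d) (x : Eucl d) (h : ℝ) (hh : 0 < h) :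
    ∃ C : ℝ, 0 ≤ C ∧ ∀ (k n : ℕ) (y : Eucl d),
      ‖y‖ ^ k * ‖iteratedFDeriv ℝ n (fun y => starRingEnd ℂ (φ (y - x))) y‖ ≤
        C * (h ^ (k + n) * k.factorial * n.factorial) := by
  obtain ⟨C, hC⟩ := φ.bound (h / 2) (by positivity)
  have hC0 : 0 ≤ C := by
    have := hC 0 0 0
    simp only [pow_zero, one_mul, add_zero, Nat.factorial_zero, Nat.cast_one, mul_one] at this
    exact (norm_nonneg _).trans this
  refine ⟨C * (1 + Real.exp (‖x‖ / (h / 2))), by positivity, fun k n y => ?_⟩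
  have h1 : ‖iteratedFDeriv ℝ n (fun y => starRingEnd ℂ (φ (y - x))) y‖ =
      ‖iteratedFDeriv ℝ n φ (y - x)‖ := by
    have := Complex.conjLIE.norm_iteratedFDeriv_comp_left (fun y => φ (y - x)) y (i := n)
    rw [← iteratedFDeriv_comp_sub]
    exact this
  rw [h1]
  set D := ‖iteratedFDeriv ℝ n φ (y - x)‖
  have hk : ‖y‖ ^ k ≤ 2 ^ k * (‖y - x‖ ^ k + ‖x‖ ^ k) := by
    calc ‖y‖ ^ k ≤ (‖y - x‖ + ‖x‖) ^ k := by
          gcongr; simpa using norm_add_le (y - x) x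
      _ ≤ 2 ^ (k - 1) * (‖y - x‖ ^ k + ‖x‖ ^ k) := add_pow_le (norm_nonneg _) (norm_nonneg _) k
      _ ≤ _ := by gcongr <;> simp
  have hx : ‖x‖ ^ k ≤ Real.exp (‖x‖ / (h / 2)) * ((h / 2) ^ k * k.factorial) := by
    have := Real.pow_div_factorial_le_exp (‖x‖ / (h / 2)) (by positivity) k
    rw [div_pow, div_div, div_le_iff₀ (by positivity)] at this
    exact this
  have hD : D ≤ C * ((h / 2) ^ n * n.factorial) := by
    have := hC 0 n (y - x)
    simpa using this
  have e1 : (2 : ℝ) ^ k * (h / 2) ^ (k + n) ≤ h ^ (k + n) := by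
    rw [div_pow, pow_add 2, ← mul_div_assoc, div_le_iff₀ (by positivity), mul_comm]
    refine mul_le_mul_of_nonneg_left ?_ (by positivity)
    exact mul_le_mul_of_nonneg_left (one_le_pow₀ one_le_two) (by positivity) |>.trans' (by simp)
  calc ‖y‖ ^ k * D ≤ 2 ^ k * (‖y - x‖ ^ k + ‖x‖ ^ k) * D := by gcongr
    _ = 2 ^ k * (‖y - x‖ ^ k * D + ‖x‖ ^ k * D) := by ring
    _ ≤ 2 ^ k * (C * ((h / 2) ^ (k + n) * k.factorial * n.factorial) +
          Real.exp (‖x‖ / (h / 2)) * ((h / 2) ^ k * k.factorial) *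
            (C * ((h / 2) ^ n * n.factorial))) := by
        refine mul_le_mul_of_nonneg_left (add_le_add (hC k n (y - x)) ?_) (by positivity)
        gcongr
    _ = C * (1 + Real.exp (‖x‖ / (h / 2))) *
          ((2 ^ k * (h / 2) ^ (k + n)) * k.factorial * n.factorial) := by ring
    _ ≤ _ := by gcongr

/-- For `φ ∈ Σ_1` and `x, ξ ∈ ℝ^d`, the function
`y ↦ conj (φ(y - x) e^{i⟨y, ξ⟩}) = conj (φ(y - x)) e^{-i⟨y, ξ⟩}`, which again is in `Σ_1`. -/
def conjTimeFreqShift {d : ℕ} (φ : GelfandShilov d) (x ξ : Eucl d) : GelfandShilov d :=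
  ⟨fun y => starRingEnd ℂ (φ (y - x)) * Complex.exp (-(Complex.I * (inner ℝ y ξ : ℝ))), by
    have hu : ContDiff ℝ (⊤ : ℕ∞) (fun y => starRingEnd ℂ (φ (y - x))) :=
      Complex.conjCLE.contDiff.comp (φ.contDiff.comp (contDiff_id.sub contDiff_const))
    refine ⟨hu.mul (contDiff_character ξ), fun h hh => ?_⟩
    obtain ⟨C, hC0, hC⟩ := φ.shift_bound x h hh
    refine ⟨C * Real.exp (‖ξ‖ / h), fun k n y => ?_⟩
    have hn : (n : WithTop ℕ∞) ≤ ((⊤ : ℕ∞) : WithTop ℕ∞) := by exact_mod_cast le_top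
    have hexp := Real.sum_le_exp_of_nonneg (x := ‖ξ‖ / h) (by positivity) (n + 1)
    have hmul := norm_iteratedFDeriv_mul_le (contDiff_character ξ) hu y hn
    simp only [mul_comm (starRingEnd ℂ _)]
    calc _ ≤ ‖y‖ ^ k * ∑ i ∈ Finset.range (n + 1), (n.choose i : ℝ) * ‖ξ‖ ^ i *
          ‖iteratedFDeriv ℝ (n - i) (fun y => starRingEnd ℂ (φ (y - x))) y‖ := by
          refine mul_le_mul_of_nonneg_left (hmul.trans ?_) (by positivity)
          gcongr
          exact norm_iteratedFDeriv_character_le ξ _ y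
      _ ≤ ∑ i ∈ Finset.range (n + 1), C * (h ^ (k + n) * k.factorial * n.factorial) *
            ((‖ξ‖ / h) ^ i / i.factorial) := by
          rw [Finset.mul_sum]
          refine Finset.sum_le_sum fun i hi => ?_
          have hi' : i ≤ n := Nat.lt_succ_iff.1 (Finset.mem_range.1 hi)
          have hc : (n.choose i : ℝ) * i.factorial * (n - i).factorial = n.factorial := by
            exact_mod_cast Nat.choose_mul_factorial_mul_factorial hi'
          have hp : h ^ (k + n) = h ^ (k + (n - i)) * h ^ i := by
            rw [← pow_add]; congr 1; omega
          calc _ = (n.choose i : ℝ) * ‖ξ‖ ^ i * (‖y‖ ^ k *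
                ‖iteratedFDeriv ℝ (n - i) (fun y => starRingEnd ℂ (φ (y - x))) y‖) := by ring
            _ ≤ (n.choose i : ℝ) * ‖ξ‖ ^ i *
                (C * (h ^ (k + (n - i)) * k.factorial * (n - i).factorial)) := by
                exact mul_le_mul_of_nonneg_left (hC k (n - i) y) (by positivity)
            _ = _ := by
                rw [← hc, hp, div_pow]
                field_simp
      _ = C * (h ^ (k + n) * k.factorial * n.factorial) *
            ∑ i ∈ Finset.range (n + 1), (‖ξ‖ / h) ^ i / i.factorial := by rw [Finset.mul_sum]
      _ ≤ C * (h ^ (k + n) * k.factorial * n.factorial) * Real.exp (‖ξ‖ / h) := by gcongr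
      _ = _ := by ring⟩

/-- The short-time Fourier transform
`V_φ f(x, ξ) = (2π)^{-d/2} (f, φ(· - x) e^{i⟨·, ξ⟩})_{L²}` of `f ∈ Σ_1'` with window `φ ∈ Σ_1`,
where `(f, ψ)_{L²} = f(conj ψ)`. -/
def stft {d : ℕ} (φ : GelfandShilov d) (f : GelfandShilovDual d) (z : Eucl d × Eucl d) : ℂ :=
  (((2 * Real.pi) ^ (-(d : ℝ) / 2) : ℝ) : ℂ) * f (conjTimeFreqShift φ z.1 z.2)

/-! ### Modulation spaces -/

section Modulation

variable {d : ℕ}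

/-- For `F : ℝ^d × ℝ^d → ℂ` and a set `S ⊆ ℝ^d`, the mixed norm
`‖ ξ ↦ ‖F(·, ξ) ω(·, ξ)‖_{L^p(S)} ‖_{L^q(ℝ^d)}`; for `S = ℝ^d` it is the norm of `L^{p,q}_{(ω)}`. -/
def mixedNormOn (S : Set (Eucl d)) (p q : ℝ≥0∞) (ω : Eucl d × Eucl d → ℝ)
    (F : Eucl d × Eucl d → ℂ) : ℝ≥0∞ :=
  eLpNorm (fun ξ => eLpNorm (fun x => F (x, ξ) * (ω (x, ξ) : ℂ)) p (volume.restrict S)) q volume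

/-- The quasi-norm of `M^{p,q}_{(ω)}`, computed with the window `φ`. -/
def modNorm (φ : GelfandShilov d) (p q : ℝ≥0∞) (ω : Eucl d × Eucl d → ℝ)
    (f : GelfandShilovDual d) : ℝ≥0∞ :=
  mixedNormOn Set.univ p q ω (stft φ f)

/-- The modulation space `M^{p,q}_{(ω)}(ℝ^d)`. -/
def modSpace (φ : GelfandShilov d) (p q : ℝ≥0∞) (ω : Eucl d × Eucl d → ℝ) :
    Set (GelfandShilovDual d) :=
  {f | modNorm φ p q ω f < ⊤}

/-- The space `M^{♯,q}_{(ω)}(ℝ^d)` of all `f ∈ M^{∞,q}_{(ω)}(ℝ^d)` such that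
`‖ ξ ↦ sup_{|x| ≥ R} |V_φ f(x, ξ) ω(x, ξ)| ‖_{L^q} → 0` as `R → ∞`; the supremum is the essential one,
i.e. the `L^∞` norm on `{|x| ≥ R}`, as in the norm of `L^{∞,q}_{(ω)}`. -/
def modSharp (φ : GelfandShilov d) (q : ℝ≥0∞) (ω : Eucl d × Eucl d → ℝ) :
    Set (GelfandShilovDual d) :=
  {f | f ∈ modSpace φ ⊤ q ω ∧
    Tendsto (fun R : ℝ => mixedNormOn {x | R ≤ ‖x‖} ⊤ q ω (stft φ f)) atTop (𝓝 0)}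

/-- The space `M^{♭,q}_{(ω)}(ℝ^d) = ⋂_{0 < p ≤ ∞} M^{p,q}_{(ω)}(ℝ^d)`. -/
def modFlat (φ : GelfandShilov d) (q : ℝ≥0∞) (ω : Eucl d × Eucl d → ℝ) :
    Set (GelfandShilovDual d) :=
  ⋂ (p : ℝ≥0∞) (_ : 0 < p), modSpace φ p q ω

/-- `A` is a dense subset of `M^{♯,q}_{(ω)}(ℝ^d)`, whose topology is that of the quasi-norm of
`M^{∞,q}_{(ω)}(ℝ^d)`. -/
def IsDenseInModSharp (φ : GelfandShilov d) (q : ℝ≥0∞) (ω : Eucl d × Eucl d → ℝ)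
    (A : Set (GelfandShilovDual d)) : Prop :=
  A ⊆ modSharp φ q ω ∧
    ∀ f ∈ modSharp φ q ω, ∀ ε : ℝ≥0∞, 0 < ε → ∃ g ∈ A, modNorm φ ⊤ q ω (f - g) < ε

variable (d)

/-- `Σ_1(ℝ^d)` as a subset of `Σ_1'(ℝ^d)`. -/
def gelfandShilovFunctions : Set (GelfandShilovDual d) :=
  {f | ∃ g : GelfandShilov d, f = GelfandShilovDual.ofIntegrable g g.integrable}

/-- `C_0^∞(ℝ^d)` as a subset of `Σ_1'(ℝ^d)`. -/
def smoothCompactlySupported : Set (GelfandShilovDual d) :=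
  {f | ∃ (g : Eucl d → ℂ) (hg : ContDiff ℝ (⊤ : ℕ∞) g) (hc : HasCompactSupport g),
    f = GelfandShilovDual.ofIntegrable g (hg.continuous.integrable_of_hasCompactSupport hc)}

/-- `ℰ'(ℝ^d)` as a subset of `Σ_1'(ℝ^d)`: the restrictions to `Σ_1(ℝ^d)` of the (automatically
tempered) distributions with compact support. -/
def compactlySupportedDistributions : Set (GelfandShilovDual d) :=
  {f | ∃ u : 𝓢'(Eucl d, ℂ), IsCompact (Distribution.dsupport u) ∧
    ∀ ψ : GelfandShilov d, f ψ = u ψ.toSchwartz}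

end Modulation

end

noncomputable section

/-! ### Exponential bounds on all derivatives -/

section ExpBound

/-! Everything rests on the reproducing formula (`GelfandShilovDual.reproducing`): with `κ = (2π)^d
‖φ‖²`, the number `κ f(χ)` is the integral over phase space of `f` tested on time-frequency shifts
of the window, with coefficients depending on `χ`. When `χ` is the shift at `Y`, the coefficient at
`X` is `O(e^{-r|X-Y|})` for every `r`, because functions in `Σ_1` and their Fourier transforms decay
faster than any exponential. A moderate weight is equivalent to a continuous one with at most
exponential variation (`IsModerateWeight.exists_isExpModerate`), so moving it through the kernel
costs only part of the rate. Hence `W = |V_φ f| ω` is dominated by its convolution with `A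
e^{-r|·|}`. Cutting the reproducing integral to a ball of radius `R` gives a `g ∈ Σ_1` for which
`|V_φ(f - g)| ω` is dominated by the same integral over the complement of the ball
(`IsExpModerate.exists_approx`).

For `q < 1` convolution with an exponential is not bounded on `L^q`. The substitute is a sub-mean
value property: `W^q` is dominated by an exponential convolution of `W^q`
(`IsExpModerate.exists_subMean`), by Hölder for `q > 1` and by a maximal function argument for `q ≤
1`. It bounds the `q`-th power of the complement integral by an exponential average of `W^q` over
far points, plus a factor exponentially small in `R` times the full average
(`rpow_lintegral_compl_ball_le`). After a supremum in `x` and an integration in `ξ`, the error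
consists of a tail in `x`, which vanishes by the definition of `M^{♯,q}`, a tail in `ξ`, which
vanishes because `q < ∞`, and the exponentially small term. This gives density of `Σ_1`.

The sub-mean value property also yields `M^{♭,q} ⊆ M^{♯,q}`: membership in `M^{q,q}` makes `W^q`
integrable on phase space, and local averages of it control the suprema in `x`. Since `Σ_1 ⊆
M^{♭,q}`, density of `M^{♭,q}` is inherited. For polynomially moderate weights finitely many
Schwartz seminorms control each norm, so an element of `Σ_1` can be replaced by a dilated cutoff of
itself (`exists_compactSupport_approx`). -/

theorem pow_le_mul_exp {t h : ℝ} (ht : 0 ≤ t) (hh : 0 < h) (k : ℕ) :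
    t ^ k ≤ h ^ k * k.factorial * Real.exp (t / h) := by
  have := Real.pow_div_factorial_le_exp (t / h) (by positivity) k
  rw [div_pow, div_div, div_le_iff₀ (by positivity)] at this
  linarith

/-- Divide the `k`-th bound by `(2h)^k k!` and sum: the left side becomes an exponential series, and
the spare `2^{-k}` leaves a geometric series with sum `2`. -/
theorem le_exp_of_forall_pow_mul_le {t h a C : ℝ} (hh : 0 < h)
    (H : ∀ k : ℕ, t ^ k * a ≤ C * (h ^ k * k.factorial)) :
    a ≤ 2 * C * Real.exp (-t / (2 * h)) := by
  have h1 : HasSum (fun k : ℕ => (t / (2 * h)) ^ k / k.factorial * a)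
      (Real.exp (t / (2 * h)) * a) := by
    rw [Real.exp_eq_exp_ℝ]
    exact (NormedSpace.expSeries_div_hasSum_exp (t / (2 * h))).mul_right a
  have h2 : HasSum (fun k : ℕ => C * (1 / 2 : ℝ) ^ k) (C * 2) :=
    hasSum_geometric_two.mul_left C
  have h3 := hasSum_le (fun k => ?_) h1 h2
  · rw [neg_div, Real.exp_neg, ← div_eq_mul_inv, le_div_iff₀ (Real.exp_pos _)]
    linarith
  · have hk := H k
    have : (t / (2 * h)) ^ k / k.factorial * a =
        (t ^ k * a) / (h ^ k * k.factorial) * (1 / 2) ^ k := by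
      rw [div_pow, mul_pow, one_div, inv_pow]
      field_simp
    rw [this]
    gcongr
    rwa [div_le_iff₀ (by positivity)]

variable {d : ℕ}

/-- `u` and its derivatives are bounded by `C h^n n! e^{-|y|/h}`. -/
def ExpBound (h C : ℝ) (u : Eucl d → ℂ) : Prop :=
  ∀ (n : ℕ) (y : Eucl d),
    ‖iteratedFDeriv ℝ n u y‖ ≤ C * (h ^ n * n.factorial) * Real.exp (-‖y‖ / h)

theorem ExpBound.nonneg {h C : ℝ} {u : Eucl d → ℂ} (H : ExpBound h C u) : 0 ≤ C := by
  have := (norm_nonneg _).trans (H 0 0)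
  simpa using this

theorem ExpBound.norm_le {h C : ℝ} {u : Eucl d → ℂ} (H : ExpBound h C u) (y : Eucl d) :
    ‖u y‖ ≤ C * Real.exp (-‖y‖ / h) := by
  simpa using H 0 y

theorem ExpBound.mono {h h' C C' : ℝ} {u : Eucl d → ℂ} (H : ExpBound h C u) (hh : 0 < h)
    (hh' : h ≤ h') (hC : C ≤ C') : ExpBound h' C' u := fun n y => by
  have hC' : 0 ≤ C' := H.nonneg.trans hC
  have h0 : 0 < h' := hh.trans_le hh'
  have he : Real.exp (-‖y‖ / h) ≤ Real.exp (-‖y‖ / h') := by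
    rw [Real.exp_le_exp, neg_div, neg_div, neg_le_neg_iff]
    gcongr
  refine (H n y).trans ?_
  gcongr

theorem ExpBound.pow_mul_le {h C : ℝ} (hh : 0 < h) {u : Eucl d → ℂ} (H : ExpBound h C u)
    (k n : ℕ) (y : Eucl d) :
    ‖y‖ ^ k * ‖iteratedFDeriv ℝ n u y‖ ≤ C * (h ^ (k + n) * k.factorial * n.factorial) := by
  have hC := H.nonneg
  calc _ ≤ (h ^ k * k.factorial * Real.exp (‖y‖ / h)) *
        (C * (h ^ n * n.factorial) * Real.exp (-‖y‖ / h)) := by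
        gcongr
        · exact pow_le_mul_exp (norm_nonneg _) hh k
        · exact H n y
    _ = C * (h ^ (k + n) * k.factorial * n.factorial) *
        (Real.exp (‖y‖ / h) * Real.exp (-‖y‖ / h)) := by ring
    _ = _ := by rw [← Real.exp_add, neg_div, add_neg_cancel, Real.exp_zero, mul_one]

/-- All polynomial moments together give an exponential one at the cost of doubling `h`, which is
harmless since `h` is arbitrary. With `ExpBound.pow_mul_le`, exponential bounds and the defining
seminorms of `Σ_1` are interchangeable. -/
theorem GelfandShilov.exists_expBound (f : GelfandShilov d) {h : ℝ} (hh : 0 < h) :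
    ∃ C, ExpBound h C f := by
  obtain ⟨C, hC⟩ := f.bound (h / 2) (by positivity)
  refine ⟨2 * C, fun n y => ?_⟩
  have hC0 : 0 ≤ C := by
    have := (norm_nonneg _).trans (show ‖f 0‖ ≤ C by simpa using hC 0 0 0)
    exact this
  have := le_exp_of_forall_pow_mul_le (t := ‖y‖) (h := h / 2)
    (a := ‖iteratedFDeriv ℝ n f y‖) (C := C * ((h / 2) ^ n * n.factorial)) (by positivity)
    (fun k => (hC k n y).trans_eq (by ring))
  refine this.trans ?_
  rw [mul_div_cancel₀ h two_ne_zero, ← mul_assoc]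
  gcongr
  linarith

/-- A smooth function with exponential bounds for all `h` is in `Σ_1`. -/
def GelfandShilov.ofExpBound (u : Eucl d → ℂ) (hu : ContDiff ℝ (⊤ : ℕ∞) u)
    (H : ∀ h : ℝ, 0 < h → ∃ C, ExpBound h C u) : GelfandShilov d :=
  ⟨u, hu, fun h hh => (H h hh).imp fun _ hC => hC.pow_mul_le hh⟩

theorem GelfandShilov.coe_ofExpBound (u : Eucl d → ℂ) (hu : ContDiff ℝ (⊤ : ℕ∞) u)
    (H : ∀ h : ℝ, 0 < h → ∃ C, ExpBound h C u) : ⇑(ofExpBound u hu H) = u := rfl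

theorem GelfandShilov.gsSeminorm_le {h : ℝ} (hh : 0 < h) {C : ℝ} {f : GelfandShilov d}
    (H : ExpBound h C f) : gsSeminorm d ⟨h, hh⟩ f ≤ C := by
  refine ciSup_le fun z => ?_
  exact (div_le_iff₀ (by positivity)).2 (H.pow_mul_le hh _ _ _)

theorem ExpBound.comp_sub {h C : ℝ} (hh : 0 < h) {u : Eucl d → ℂ} (H : ExpBound h C u)
    (x : Eucl d) : ExpBound h (C * Real.exp (‖x‖ / h)) (fun y => u (y - x)) := fun n y => by
  have hC := H.nonneg
  rw [iteratedFDeriv_comp_sub]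
  refine (H n (y - x)).trans ?_
  have : Real.exp (-‖y - x‖ / h) ≤ Real.exp (‖x‖ / h) * Real.exp (-‖y‖ / h) := by
    rw [← Real.exp_add, Real.exp_le_exp, ← add_div]
    gcongr
    linarith [norm_sub_norm_le y x]
  calc _ ≤ C * (h ^ n * n.factorial) * (Real.exp (‖x‖ / h) * Real.exp (-‖y‖ / h)) := by gcongr
    _ = _ := by ring

theorem ExpBound.conj {h C : ℝ} {u : Eucl d → ℂ} (H : ExpBound h C u) :
    ExpBound h C (fun y => starRingEnd ℂ (u y)) := fun n y => by
  have := Complex.conjLIE.norm_iteratedFDeriv_comp_left u y (i := n)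
  exact (this.trans_le (H n y))

/-- In the Leibniz sum the binomial coefficient and `(n - i)!` combine to `n!/i!`, so a partial sum
of the series of `exp (a / h)` remains. -/
theorem sum_choose_mul_le {h a A C : ℝ} (hh : 0 < h) (ha : 0 ≤ a) (hAC : 0 ≤ A * C) (n : ℕ) :
    ∑ i ∈ Finset.range (n + 1), (n.choose i : ℝ) * (A * a ^ i) *
      (C * (h ^ (n - i) * (n - i).factorial)) ≤
      A * C * Real.exp (a / h) * (h ^ n * n.factorial) := by
  have hexp := Real.sum_le_exp_of_nonneg (x := a / h) (by positivity) (n + 1)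
  calc _ = ∑ i ∈ Finset.range (n + 1), A * C * (h ^ n * n.factorial) *
            ((a / h) ^ i / i.factorial) := by
          refine Finset.sum_congr rfl fun i hi => ?_
          have hi' : i ≤ n := Nat.lt_succ_iff.1 (Finset.mem_range.1 hi)
          have hc : (n.choose i : ℝ) * i.factorial * (n - i).factorial = n.factorial := by
            exact_mod_cast Nat.choose_mul_factorial_mul_factorial hi'
          have hp : h ^ n = h ^ (n - i) * h ^ i := by
            rw [← pow_add]; congr 1; omega
          rw [← hc, hp, div_pow]
          field_simp
      _ = A * C * (h ^ n * n.factorial) *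
            ∑ i ∈ Finset.range (n + 1), (a / h) ^ i / i.factorial := by rw [Finset.mul_sum]
      _ ≤ A * C * (h ^ n * n.factorial) * Real.exp (a / h) := by gcongr
      _ = _ := by ring

/-- The multiplier may grow, using up half of the exponential decay of `u`; this is why `h` doubles.
The growth is needed for the multiplier `e^{-i⟨y,ζ⟩} - 1`, which is small in `ζ` only locally
uniformly in `y`. -/
theorem ExpBound.mul_left {h C A a : ℝ} (hh : 0 < h) {u m : Eucl d → ℂ}
    (hu : ContDiff ℝ (⊤ : ℕ∞) u) (hm : ContDiff ℝ (⊤ : ℕ∞) m) (H : ExpBound h C u)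
    (hA : 0 ≤ A) (ha : 0 ≤ a)
    (Hm : ∀ i y, ‖iteratedFDeriv ℝ i m y‖ ≤ A * a ^ i * Real.exp (‖y‖ / (2 * h))) :
    ExpBound (2 * h) (A * C * Real.exp (a / h)) (fun y => m y * u y) := fun n y => by
  have hC := H.nonneg
  have hn : (n : WithTop ℕ∞) ≤ ((⊤ : ℕ∞) : WithTop ℕ∞) := by exact_mod_cast le_top
  refine (norm_iteratedFDeriv_mul_le hm hu y hn).trans ?_
  have he : Real.exp (‖y‖ / (2 * h)) * Real.exp (-‖y‖ / h) = Real.exp (-‖y‖ / (2 * h)) := by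
    rw [← Real.exp_add]; congr 1; field_simp; ring
  calc _ ≤ ∑ i ∈ Finset.range (n + 1), (n.choose i : ℝ) *
          (A * a ^ i * Real.exp (‖y‖ / (2 * h))) *
          (C * (h ^ (n - i) * (n - i).factorial) * Real.exp (-‖y‖ / h)) := by
        gcongr with i hi
        · exact Hm i y
        · exact H _ y
    _ = (∑ i ∈ Finset.range (n + 1), (n.choose i : ℝ) * (A * a ^ i) *
          (C * (h ^ (n - i) * (n - i).factorial))) * Real.exp (-‖y‖ / (2 * h)) := by
        rw [← he, Finset.sum_mul]
        exact Finset.sum_congr rfl fun i _ => by ring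
    _ ≤ A * C * Real.exp (a / h) * (h ^ n * n.factorial) * Real.exp (-‖y‖ / (2 * h)) := by
        gcongr
        exact sum_choose_mul_le hh ha (by positivity) n
    _ ≤ _ := by
        gcongr
        linarith

theorem contDiff_conj_sub {u : Eucl d → ℂ} (hu : ContDiff ℝ (⊤ : ℕ∞) u) (x : Eucl d) :
    ContDiff ℝ (⊤ : ℕ∞) (fun y => starRingEnd ℂ (u (y - x))) :=
  Complex.conjCLE.contDiff.comp (hu.comp (contDiff_id.sub contDiff_const))

theorem conjTimeFreqShift_apply (φ : GelfandShilov d) (x ξ y : Eucl d) :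
    conjTimeFreqShift φ x ξ y =
      starRingEnd ℂ (φ (y - x)) * Complex.exp (-(Complex.I * (inner ℝ y ξ : ℝ))) := rfl

theorem norm_character (ξ y : Eucl d) :
    ‖Complex.exp (-(Complex.I * (inner ℝ y ξ : ℝ)))‖ = 1 := by
  rw [show -(Complex.I * (inner ℝ y ξ : ℝ)) = ((-inner ℝ y ξ : ℝ) : ℂ) * Complex.I by
    push_cast; ring, Complex.norm_exp_ofReal_mul_I]

theorem ExpBound.character_mul {h C : ℝ} (hh : 0 < h) {u : Eucl d → ℂ}
    (hu : ContDiff ℝ (⊤ : ℕ∞) u) (H : ExpBound h C u) (ξ : Eucl d) :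
    ExpBound (2 * h) (C * Real.exp (‖ξ‖ / h))
      (fun y => Complex.exp (-(Complex.I * (inner ℝ y ξ : ℝ))) * u y) := by
  have := H.mul_left hh hu (contDiff_character ξ) zero_le_one (norm_nonneg ξ) fun i y => ?_
  · simpa using this
  · rw [one_mul]
    refine (norm_iteratedFDeriv_character_le ξ i y).trans ?_
    exact le_mul_of_one_le_right (by positivity) (Real.one_le_exp (by positivity))

theorem ExpBound.conjTimeFreqShift {h C : ℝ} (hh : 0 < h) {φ : GelfandShilov d}
    (H : ExpBound h C φ) (x ξ : Eucl d) :
    ExpBound (2 * h) (C * Real.exp (‖x‖ / h) * Real.exp (‖ξ‖ / h)) (conjTimeFreqShift φ x ξ) := by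
  have := (H.comp_sub hh x).conj.character_mul hh (contDiff_conj_sub φ.contDiff x) ξ
  convert this using 2 with y
  exact mul_comm _ _

/-- At order zero the function is at most `‖y‖‖ζ‖`, and the exponential absorbs `‖y‖`. Each higher
derivative carries at least one factor `‖ζ‖`, and `‖ζ‖ ≤ 1` disposes of the others. -/
theorem norm_iteratedFDeriv_character_sub_one_le {h : ℝ} (hh : 0 < h) {ζ : Eucl d} (hζ : ‖ζ‖ ≤ 1)
    (i : ℕ) (y : Eucl d) :
    ‖iteratedFDeriv ℝ i
      (fun y : Eucl d => Complex.exp (-(Complex.I * (inner ℝ y ζ : ℝ))) - 1) y‖ ≤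
      ‖ζ‖ * (1 + 2 * h) * 1 ^ i * Real.exp (‖y‖ / (2 * h)) := by
  have h1 : 1 ≤ Real.exp (‖y‖ / (2 * h)) := Real.one_le_exp (by positivity)
  rw [one_pow, mul_one]
  rcases i with _ | i
  · rw [norm_iteratedFDeriv_zero]
    have : ‖Complex.exp (-(Complex.I * (inner ℝ y ζ : ℝ))) - 1‖ ≤ ‖y‖ * ‖ζ‖ := by
      rw [show -(Complex.I * (inner ℝ y ζ : ℝ)) = Complex.I * ((-inner ℝ y ζ : ℝ) : ℂ) by
        push_cast; ring]
      refine (Real.norm_exp_I_mul_ofReal_sub_one_le).trans ?_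
      rw [norm_neg]
      exact norm_inner_le_norm y ζ
    refine this.trans ?_
    have h2 := pow_le_mul_exp (norm_nonneg y) (h := 2 * h) (by positivity) 1
    simp only [pow_one, Nat.factorial_one, Nat.cast_one, mul_one] at h2
    calc ‖y‖ * ‖ζ‖ ≤ (2 * h * Real.exp (‖y‖ / (2 * h))) * ‖ζ‖ := by gcongr
      _ = ‖ζ‖ * (2 * h) * Real.exp (‖y‖ / (2 * h)) := by ring
      _ ≤ _ := by gcongr; linarith
  · have hs : iteratedFDeriv ℝ (i + 1)
        (fun y : Eucl d => Complex.exp (-(Complex.I * (inner ℝ y ζ : ℝ))) - 1) y =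
        iteratedFDeriv ℝ (i + 1)
        (fun y : Eucl d => Complex.exp (-(Complex.I * (inner ℝ y ζ : ℝ)))) y := by
      have hc : ContDiffAt ℝ ((i + 1 : ℕ) : WithTop ℕ∞) (fun _ : Eucl d => (1 : ℂ)) y :=
        contDiff_const.contDiffAt
      have hcd : ContDiffAt ℝ ((i + 1 : ℕ) : WithTop ℕ∞)
          (fun y : Eucl d => Complex.exp (-(Complex.I * (inner ℝ y ζ : ℝ)))) y :=
        ((contDiff_character ζ).of_le (by exact_mod_cast le_top)).contDiffAt
      have := iteratedFDeriv_sub_apply hcd hc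
      rw [show (fun y : Eucl d => Complex.exp (-(Complex.I * (inner ℝ y ζ : ℝ))) - 1) =
        (fun y : Eucl d => Complex.exp (-(Complex.I * (inner ℝ y ζ : ℝ)))) -
          (fun _ : Eucl d => (1 : ℂ)) from rfl, this,
        iteratedFDeriv_const_of_ne (by omega)]
      simp
    rw [hs]
    refine (norm_iteratedFDeriv_character_le ζ (i + 1) y).trans ?_
    calc ‖ζ‖ ^ (i + 1) ≤ ‖ζ‖ ^ 1 := pow_le_pow_of_le_one (norm_nonneg _) hζ (by omega)
      _ = ‖ζ‖ * 1 * 1 := by ring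
      _ ≤ _ := by gcongr; linarith

/-- Mean value inequality for the `n`-th derivative on the unit ball around `y`. The extra
derivative costs a factor `n + 1 ≤ 2^n`, absorbed by doubling `h`. -/
theorem ExpBound.sub_comp_sub {h C : ℝ} (hh : 0 < h) {u : Eucl d → ℂ}
    (hu : ContDiff ℝ (⊤ : ℕ∞) u) (H : ExpBound h C u) {x : Eucl d} (hx : ‖x‖ ≤ 1) :
    ExpBound (2 * h) (C * h * Real.exp (1 / h) * ‖x‖) (fun y => u (y - x) - u y) := fun n y => by
  have hC := H.nonneg
  have hn : (n : WithTop ℕ∞) ≤ ((⊤ : ℕ∞) : WithTop ℕ∞) := by exact_mod_cast le_top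
  have h1 : ContDiff ℝ n (fun y => u (y - x)) :=
    (hu.comp (contDiff_id.sub contDiff_const)).of_le hn
  have hs : iteratedFDeriv ℝ n (fun y => u (y - x) - u y) y =
      iteratedFDeriv ℝ n u (y - x) - iteratedFDeriv ℝ n u y := by
    rw [← iteratedFDeriv_comp_sub]
    exact iteratedFDeriv_sub_apply h1.contDiffAt (hu.of_le hn).contDiffAt
  rw [hs]
  set B := C * (h ^ (n + 1) * (n + 1).factorial) * (Real.exp (1 / h) * Real.exp (-‖y‖ / h)) with hB
  have hd : ∀ z ∈ Metric.closedBall y 1, ‖fderiv ℝ (iteratedFDeriv ℝ n u) z‖ ≤ B := by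
    intro z hz
    rw [norm_fderiv_iteratedFDeriv]
    refine (H (n + 1) z).trans ?_
    rw [hB, ← Real.exp_add, ← add_div]
    gcongr
    have h3 : ‖y‖ ≤ ‖z‖ + ‖z - y‖ := by
      have := norm_sub_norm_le y z
      rw [norm_sub_rev] at this
      linarith
    rw [mem_closedBall_iff_norm] at hz
    linarith
  have hmv := (convex_closedBall y (1 : ℝ)).norm_image_sub_le_of_norm_fderiv_le
    (f := iteratedFDeriv ℝ n u) (𝕜 := ℝ) (x := y) (y := y - x) (C := B)
    (fun z _ => (hu.differentiable_iteratedFDeriv (by exact_mod_cast ENat.natCast_lt_top n)) z) hd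
    (by simp) (by simpa using hx)
  refine hmv.trans ?_
  have e1 : y - x - y = -x := by abel
  rw [e1, norm_neg, hB]
  have e2 : ((n + 1).factorial : ℝ) ≤ 2 ^ n * n.factorial := by
    rw [Nat.factorial_succ]
    push_cast
    gcongr
    exact_mod_cast Nat.lt_two_pow_self
  have e3 : Real.exp (-‖y‖ / h) ≤ Real.exp (-‖y‖ / (2 * h)) := by
    rw [Real.exp_le_exp, neg_div, neg_div, neg_le_neg_iff]
    gcongr
    linarith
  calc _ ≤ C * (h ^ (n + 1) * (2 ^ n * n.factorial)) *
        (Real.exp (1 / h) * Real.exp (-‖y‖ / (2 * h))) * ‖x‖ := by gcongr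
    _ = _ := by ring

end ExpBound

/-! ### Continuity of time-frequency shifts -/

section Jet

variable {d : ℕ}

theorem ExpBound.add {h C C' : ℝ} {u v : Eucl d → ℂ} (hu : ContDiff ℝ (⊤ : ℕ∞) u)
    (hv : ContDiff ℝ (⊤ : ℕ∞) v) (H : ExpBound h C u) (H' : ExpBound h C' v) :
    ExpBound h (C + C') (fun y => u y + v y) := fun n y => by
  have hn : (n : WithTop ℕ∞) ≤ ((⊤ : ℕ∞) : WithTop ℕ∞) := by exact_mod_cast le_top
  have : iteratedFDeriv ℝ n (fun y => u y + v y) y = _ :=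
    iteratedFDeriv_add_apply (hu.of_le hn).contDiffAt (hv.of_le hn).contDiffAt
  rw [this]
  refine (norm_add_le _ _).trans ((add_le_add (H n y) (H' n y)).trans_eq (by ring))

theorem GelfandShilov.coe_sub (f g : GelfandShilov d) : ⇑(f - g) = fun y => f y - g y := rfl

theorem conjTimeFreqShift_sub_eq (φ : GelfandShilov d) (x ξ a ζ y : Eucl d) :
    (conjTimeFreqShift φ (x + a) (ξ + ζ) - conjTimeFreqShift φ x ξ) y =
      Complex.exp (-(Complex.I * (inner ℝ y ξ : ℝ))) *
        ((Complex.exp (-(Complex.I * (inner ℝ y ζ : ℝ))) - 1) *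
            starRingEnd ℂ (φ ((y - a) - x)) +
          (starRingEnd ℂ (φ ((y - a) - x)) - starRingEnd ℂ (φ (y - x)))) := by
  rw [GelfandShilov.coe_sub]
  simp only [conjTimeFreqShift_apply]
  have h1 : y - (x + a) = y - a - x := by abel
  have h2 : Complex.exp (-(Complex.I * (inner ℝ y (ξ + ζ) : ℝ))) =
      Complex.exp (-(Complex.I * (inner ℝ y ξ : ℝ))) *
        Complex.exp (-(Complex.I * (inner ℝ y ζ : ℝ))) := by
    rw [← Complex.exp_add, inner_add_right]
    push_cast
    ring_nf
  rw [h1, h2]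
  ring

/-- Time-frequency shifts depend on the phase space point locally Lipschitz continuously in every
exponential norm: the increment is a change of modulation plus a change of translation. -/
theorem expBound_conjTimeFreqShift_sub (φ : GelfandShilov d) (x ξ : Eucl d) {h : ℝ} (hh : 0 < h) :
    ∃ K, 0 ≤ K ∧ ∀ a ζ : Eucl d, ‖a‖ ≤ 1 → ‖ζ‖ ≤ 1 →
      ExpBound h (K * (‖a‖ + ‖ζ‖))
        (conjTimeFreqShift φ (x + a) (ξ + ζ) - conjTimeFreqShift φ x ξ) := by
  -- The rate doubles twice, once for the two increments and once for multiplication by the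
  -- character.
  obtain ⟨k, rfl⟩ : ∃ k, h = 2 * (2 * k) := ⟨h / 4, by ring⟩
  have hk : 0 < k := by linarith
  obtain ⟨C, hC⟩ := φ.exists_expBound hk
  set u : Eucl d → ℂ := fun y => starRingEnd ℂ (φ (y - x)) with hu
  have hus : ContDiff ℝ (⊤ : ℕ∞) u := contDiff_conj_sub φ.contDiff x
  obtain ⟨C1, hC1⟩ : ∃ C1, ExpBound k C1 u := ⟨_, (hC.comp_sub hk x).conj⟩
  have hC0 := hC1.nonneg
  refine ⟨((1 + 2 * k) * (C1 * Real.exp (1 / k)) * Real.exp (1 / k) +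
    C1 * k * Real.exp (1 / k)) * Real.exp (‖ξ‖ / (2 * k)), by positivity, fun a ζ ha hζ => ?_⟩
  have hua : ContDiff ℝ (⊤ : ℕ∞) (fun y => u (y - a)) := hus.comp (contDiff_id.sub contDiff_const)
  have hch : ContDiff ℝ (⊤ : ℕ∞)
      (fun y : Eucl d => Complex.exp (-(Complex.I * (inner ℝ y ζ : ℝ))) - 1) :=
    (contDiff_character ζ).sub contDiff_const
  have h1 : ExpBound k (C1 * Real.exp (1 / k)) (fun y => u (y - a)) :=
    (hC1.comp_sub hk a).mono hk le_rfl (by gcongr)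
  have h2 := h1.mul_left hk hua hch (by positivity) zero_le_one
    (norm_iteratedFDeriv_character_sub_one_le hk hζ)
  have h3 := h2.add (hch.mul hua) (hua.sub hus) (hC1.sub_comp_sub hk hus ha)
  have h4 := h3.character_mul (by positivity) ((hch.mul hua).add (hua.sub hus)) ξ
  have h5 : (⇑(conjTimeFreqShift φ (x + a) (ξ + ζ) - conjTimeFreqShift φ x ξ) : Eucl d → ℂ) = _ :=
    funext fun y => conjTimeFreqShift_sub_eq φ x ξ a ζ y
  rw [h5]
  refine h4.mono (by positivity) le_rfl ?_
  have e : ∀ A B : ℝ, 0 ≤ A → 0 ≤ B → ‖ζ‖ * A + B * ‖a‖ ≤ (A + B) * (‖a‖ + ‖ζ‖) := by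
    intro A B hA hB
    nlinarith [mul_nonneg hA (norm_nonneg a), mul_nonneg hB (norm_nonneg ζ)]
  have := e ((1 + 2 * k) * (C1 * Real.exp (1 / k)) * Real.exp (1 / k))
    (C1 * k * Real.exp (1 / k)) (by positivity) (by positivity)
  calc _ = (‖ζ‖ * ((1 + 2 * k) * (C1 * Real.exp (1 / k)) * Real.exp (1 / k)) +
      C1 * k * Real.exp (1 / k) * ‖a‖) * Real.exp (‖ξ‖ / (2 * k)) := by ring
    _ ≤ _ * Real.exp (‖ξ‖ / (2 * k)) := mul_le_mul_of_nonneg_right this (by positivity)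
    _ = _ := by ring

/-! ### The jet embedding into a Banach space -/

/-- The Banach space of bounded families of multilinear maps, indexed by order and point. -/
abbrev JetSpace (d : ℕ) : Type :=
  lp (fun z : ℕ × Eucl d => ContinuousMultilinearMap ℝ (fun _ : Fin z.1 => Eucl d) ℂ) ⊤

/-- The weighted jets of a function of `Σ_1`. -/
def jet (h : ℝ) (hh : 0 < h) : GelfandShilov d →ₗ[ℂ] JetSpace d where
  toFun f := ⟨fun z => (Real.exp (‖z.2‖ / h) / (h ^ z.1 * z.1.factorial)) •
      iteratedFDeriv ℝ z.1 f z.2, by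
    obtain ⟨C, hC⟩ := f.exists_expBound hh
    refine memℓp_infty ⟨C, ?_⟩
    rintro _ ⟨z, rfl⟩
    dsimp only
    rw [norm_smul, Real.norm_of_nonneg (by positivity), div_mul_eq_mul_div,
      div_le_iff₀ (by positivity)]
    calc _ ≤ Real.exp (‖z.2‖ / h) * (C * (h ^ z.1 * z.1.factorial) * Real.exp (-‖z.2‖ / h)) := by
          gcongr; exact hC _ _
      _ = C * (h ^ z.1 * z.1.factorial) * (Real.exp (‖z.2‖ / h) * Real.exp (-‖z.2‖ / h)) := by ring
      _ = _ := by rw [← Real.exp_add, neg_div, add_neg_cancel, Real.exp_zero, mul_one]⟩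
  map_add' f g := by
    ext1
    funext z
    have hn : (z.1 : WithTop ℕ∞) ≤ ((⊤ : ℕ∞) : WithTop ℕ∞) := by exact_mod_cast le_top
    have : iteratedFDeriv ℝ z.1 (f + g) z.2 = _ :=
      iteratedFDeriv_add_apply (f.contDiff.of_le hn).contDiffAt (g.contDiff.of_le hn).contDiffAt
    change _ • iteratedFDeriv ℝ z.1 (f + g) z.2 = _
    rw [this, smul_add]
    rfl
  map_smul' c f := by
    ext1
    funext z
    have hn : (z.1 : WithTop ℕ∞) ≤ ((⊤ : ℕ∞) : WithTop ℕ∞) := by exact_mod_cast le_top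
    have : iteratedFDeriv ℝ z.1 (c • f) z.2 = _ :=
      iteratedFDeriv_const_smul_apply (f.contDiff.of_le hn).contDiffAt
    change _ • iteratedFDeriv ℝ z.1 (c • f) z.2 = _
    rw [this, smul_comm]
    rfl

theorem jet_apply {h : ℝ} (hh : 0 < h) (f : GelfandShilov d) (z : ℕ × Eucl d) :
    jet h hh f z = (Real.exp (‖z.2‖ / h) / (h ^ z.1 * z.1.factorial)) •
      iteratedFDeriv ℝ z.1 f z.2 := rfl

theorem norm_jet_le {h C : ℝ} (hh : 0 < h) {f : GelfandShilov d} (H : ExpBound h C f) :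
    ‖jet h hh f‖ ≤ C := by
  refine lp.norm_le_of_forall_le H.nonneg fun z => ?_
  rw [jet_apply, norm_smul, Real.norm_of_nonneg (by positivity), div_mul_eq_mul_div,
    div_le_iff₀ (by positivity)]
  calc _ ≤ Real.exp (‖z.2‖ / h) * (C * (h ^ z.1 * z.1.factorial) * Real.exp (-‖z.2‖ / h)) := by
        gcongr; exact H _ _
    _ = C * (h ^ z.1 * z.1.factorial) * (Real.exp (‖z.2‖ / h) * Real.exp (-‖z.2‖ / h)) := by ring
    _ = _ := by rw [← Real.exp_add, neg_div, add_neg_cancel, Real.exp_zero, mul_one]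

/-- Together with `norm_jet_le`, this makes the jet norm the least constant in `ExpBound`. -/
theorem expBound_norm_jet {h : ℝ} (hh : 0 < h) (f : GelfandShilov d) :
    ExpBound h ‖jet h hh f‖ f := fun n y => by
  have := lp.norm_apply_le_norm ENNReal.top_ne_zero (jet h hh f) (n, y)
  rw [jet_apply, norm_smul, Real.norm_of_nonneg (by positivity), div_mul_eq_mul_div,
    div_le_iff₀ (by positivity)] at this
  dsimp only at this
  rw [neg_div, Real.exp_neg, ← div_eq_mul_inv, le_div_iff₀ (Real.exp_pos _)]
  linarith

theorem jet_injective {h : ℝ} (hh : 0 < h) : Function.Injective (jet (d := d) h hh) := by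
  refine (injective_iff_map_eq_zero _).2 fun f hf => ?_
  have := expBound_norm_jet hh f
  rw [hf, norm_zero] at this
  refine DFunLike.ext _ _ fun y => ?_
  have := this.norm_le y
  rw [zero_mul] at this
  exact norm_le_zero_iff.1 this

/-- Norm continuity into a Banach space is what allows superpositions of shifts to be treated as
Bochner integrals. -/
theorem continuous_jet_conjTimeFreqShift (φ : GelfandShilov d) {h : ℝ} (hh : 0 < h) :
    Continuous fun X : Eucl d × Eucl d => jet h hh (conjTimeFreqShift φ X.1 X.2) := by
  refine continuous_iff_continuousAt.2 fun X => ?_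
  obtain ⟨K, hK0, hK⟩ := expBound_conjTimeFreqShift_sub φ X.1 X.2 hh
  rw [ContinuousAt, tendsto_iff_norm_sub_tendsto_zero]
  have hlim : Tendsto (fun Y : Eucl d × Eucl d => K * (‖Y.1 - X.1‖ + ‖Y.2 - X.2‖)) (𝓝 X) (𝓝 0) := by
    have : Continuous fun Y : Eucl d × Eucl d => K * (‖Y.1 - X.1‖ + ‖Y.2 - X.2‖) := by fun_prop
    simpa using this.tendsto X
  refine squeeze_zero' (.of_forall fun _ => norm_nonneg _) ?_ hlim
  filter_upwards [Metric.closedBall_mem_nhds X one_pos] with Y hY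
  have hY' : ‖Y - X‖ ≤ 1 := by rwa [mem_closedBall_iff_norm] at hY
  have := hK (Y.1 - X.1) (Y.2 - X.2) ((norm_fst_le (Y - X)).trans hY')
    ((norm_snd_le (Y - X)).trans hY')
  rw [add_sub_cancel, add_sub_cancel] at this
  rw [← map_sub]
  exact norm_jet_le hh this

theorem continuous_iteratedFDeriv_conjTimeFreqShift (φ : GelfandShilov d) (n : ℕ) (y : Eucl d) :
    Continuous fun X : Eucl d × Eucl d => iteratedFDeriv ℝ n (conjTimeFreqShift φ X.1 X.2) y := by
  have h1 := (lp.evalCLM ℂ (fun z : ℕ × Eucl d =>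
    ContinuousMultilinearMap ℝ (fun _ : Fin z.1 => Eucl d) ℂ) ⊤ (n, y)).continuous.comp
      (continuous_jet_conjTimeFreqShift φ one_pos)
  have h2 := h1.const_smul (Real.exp (‖y‖ / 1) / (1 ^ n * n.factorial))⁻¹
  refine h2.congr fun X => ?_
  have h3 : Real.exp (‖y‖ / 1) / (1 ^ n * n.factorial) ≠ 0 := by positivity
  change (Real.exp (‖y‖ / 1) / (1 ^ n * n.factorial))⁻¹ •
    ((Real.exp (‖y‖ / 1) / (1 ^ n * n.factorial)) •
      iteratedFDeriv ℝ n (conjTimeFreqShift φ X.1 X.2) y) = _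
  rw [inv_smul_smul₀ h3]

theorem continuous_conjTimeFreqShift_apply (φ : GelfandShilov d) (y : Eucl d) :
    Continuous fun X : Eucl d × Eucl d => conjTimeFreqShift φ X.1 X.2 y := by
  have hφ := φ.contDiff.continuous
  simp only [conjTimeFreqShift_apply]
  fun_prop

/-! ### Elements of the dual as functionals on jets -/

theorem GelfandShilovDual.exists_jet_bound (f : GelfandShilovDual d) :
    ∃ (h : ℝ) (hh : 0 < h) (C : ℝ), 0 ≤ C ∧ ∀ χ, ‖f χ‖ ≤ C * ‖jet h hh χ‖ := by
  obtain ⟨s, C, -, hC⟩ := Seminorm.bound_of_continuous GelfandShilov.withSeminorms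
    ((normSeminorm ℂ ℂ).comp f.toLinearMap) (continuous_norm.comp f.continuous)
  -- The seminorms increase as `h` decreases, so a positive lower bound of the finitely many
  -- parameters controls them all.
  obtain ⟨⟨h, hh⟩, hs⟩ := s.bddBelow
  refine ⟨h, hh, C, C.2, fun χ => (hC χ).trans ?_⟩
  rw [_root_.smul_apply, NNReal.smul_def, smul_eq_mul]
  gcongr
  refine Seminorm.finset_sup_apply_le (norm_nonneg _) fun i hi => ?_
  exact GelfandShilov.gsSeminorm_le i.2 ((expBound_norm_jet hh χ).mono hh (hs hi) le_rfl)

/-- An element of `Σ_1'` factors through the jets. -/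
theorem GelfandShilovDual.exists_extension (f : GelfandShilovDual d) :
    ∃ (h : ℝ) (hh : 0 < h) (L : JetSpace d →L[ℂ] ℂ), ∀ χ, L (jet h hh χ) = f χ := by
  obtain ⟨h, hh, C, -, hC⟩ := f.exists_jet_bound
  -- Since jets determine the function, `f` is a bounded functional on the range of `jet`;
  -- Hahn–Banach extends it to the whole Banach space.
  let e := LinearEquiv.ofInjective (jet (d := d) h hh) (jet_injective hh)
  have he : ∀ x, (jet h hh (e.symm x)) = (x : JetSpace d) := fun x =>
    congrArg Subtype.val (e.apply_symm_apply x)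
  let l : StrongDual ℂ (LinearMap.range (jet (d := d) h hh)) :=
    (f.toLinearMap ∘ₗ e.symm.toLinearMap).mkContinuous C fun x => by
      refine (hC (e.symm x)).trans ?_
      rw [he x]
      rfl
  obtain ⟨L, hL, -⟩ := exists_extension_norm_eq _ l
  refine ⟨h, hh, L, fun χ => ?_⟩
  rw [hL ⟨jet h hh χ, χ, rfl⟩]
  change f (e.symm (e χ)) = f χ
  rw [e.symm_apply_apply]

theorem norm_jet_conjTimeFreqShift_le (φ : GelfandShilov d) {h : ℝ} (hh : 0 < h) :
    ∃ C, 0 ≤ C ∧ ∀ X : Eucl d × Eucl d,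
      ‖jet h hh (conjTimeFreqShift φ X.1 X.2)‖ ≤ C * Real.exp (4 / h * ‖X‖) := by
  -- Translation and modulation each contribute `e^{‖X‖/k}`, and `2 / k = 4 / h`.
  obtain ⟨k, rfl⟩ : ∃ k, h = 2 * k := ⟨h / 2, by ring⟩
  have hk : 0 < k := by linarith
  obtain ⟨C, hC⟩ := φ.exists_expBound hk
  have h0 := hC.nonneg
  refine ⟨C, h0, fun X => (norm_jet_le hh (hC.conjTimeFreqShift hk X.1 X.2)).trans ?_⟩
  rw [mul_assoc, ← Real.exp_add]
  gcongr
  have h1 : ‖X.1‖ / k ≤ ‖X‖ / k := by gcongr; exact norm_fst_le X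
  have h2 : ‖X.2‖ / k ≤ ‖X‖ / k := by gcongr; exact norm_snd_le X
  calc _ ≤ ‖X‖ / k + ‖X‖ / k := add_le_add h1 h2
    _ = _ := by field_simp; ring

theorem GelfandShilovDual.continuous_conjTimeFreqShift (f : GelfandShilovDual d)
    (φ : GelfandShilov d) :
    Continuous fun X : Eucl d × Eucl d => f (conjTimeFreqShift φ X.1 X.2) := by
  obtain ⟨h, hh, L, hL⟩ := f.exists_extension
  simpa only [Function.comp_def, hL] using
    L.continuous.comp (continuous_jet_conjTimeFreqShift φ hh)

theorem GelfandShilovDual.exists_growth (f : GelfandShilovDual d) (φ : GelfandShilov d) :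
    ∃ C r : ℝ, 0 ≤ C ∧ 0 ≤ r ∧ ∀ X : Eucl d × Eucl d,
      ‖f (conjTimeFreqShift φ X.1 X.2)‖ ≤ C * Real.exp (r * ‖X‖) := by
  obtain ⟨h, hh, C, hC0, hC⟩ := f.exists_jet_bound
  obtain ⟨C', hC'0, hC'⟩ := norm_jet_conjTimeFreqShift_le φ hh
  refine ⟨C * C', 4 / h, by positivity, by positivity, fun X => (hC _).trans ?_⟩
  rw [mul_assoc]
  gcongr
  exact hC' X

end Jet

/-! ### Superpositions of time-frequency shifts -/

section Synthesis

-- Differentiation under the integral sign at every order; the dominating function for each order is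
-- uniform in the point `y`.
set_option maxSynthPendingDepth 3 in
theorem hasFTaylorSeriesUpTo_integral {α E F : Type*} [MeasurableSpace α] {μ : Measure α}
    [NormedAddCommGroup E] [NormedSpace ℝ E] [NormedAddCommGroup F] [NormedSpace ℝ F]
    [CompleteSpace F] {G : α → E → F} (hG : ∀ a, ContDiff ℝ (⊤ : ℕ∞) (G a))
    (hmeas : ∀ n y, AEStronglyMeasurable (fun a => iteratedFDeriv ℝ n (G a) y) μ)
    (hbound : ∀ n, ∃ B : α → ℝ, Integrable B μ ∧ ∀ a y, ‖iteratedFDeriv ℝ n (G a) y‖ ≤ B a) :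
    HasFTaylorSeriesUpTo ((⊤ : ℕ∞) : WithTop ℕ∞) (fun y => ∫ a, G a y ∂μ)
      (fun y n => ∫ a, iteratedFDeriv ℝ n (G a) y ∂μ) := by
  have hint : ∀ n y, Integrable (fun a => iteratedFDeriv ℝ n (G a) y) μ := fun n y => by
    obtain ⟨B, hB, hB'⟩ := hbound n
    exact hB.mono' (hmeas n y) (.of_forall fun a => hB' a y)
  have hder : ∀ (n : ℕ) (y : E), HasFDerivAt (fun y => ∫ a, iteratedFDeriv ℝ n (G a) y ∂μ)
      (∫ a, iteratedFDeriv ℝ (n + 1) (G a) y ∂μ).curryLeft y := by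
    intro n y
    obtain ⟨B, hB, hB'⟩ := hbound (n + 1)
    have hcl : ∀ a z, fderiv ℝ (iteratedFDeriv ℝ n (G a)) z =
        (iteratedFDeriv ℝ (n + 1) (G a) z).curryLeft := fun a z => by
      rw [iteratedFDeriv_succ_eq_comp_left]
      exact ((continuousMultilinearCurryLeftEquiv ℝ (fun _ : Fin (n + 1) => E) F).apply_symm_apply
        _).symm
    have hm : AEStronglyMeasurable (fun a => fderiv ℝ (iteratedFDeriv ℝ n (G a)) y) μ := by
      simp only [hcl]
      exact (continuousMultilinearCurryLeftEquiv ℝ (fun _ : Fin (n + 1) => E)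
        F).continuous.comp_aestronglyMeasurable (hmeas (n + 1) y)
    have hB'' : ∀ a z, ‖fderiv ℝ (iteratedFDeriv ℝ n (G a)) z‖ ≤ B a := fun a z => by
      rw [norm_fderiv_iteratedFDeriv]
      exact hB' a z
    have h1 := hasFDerivAt_integral_of_dominated_of_fderiv_le (μ := μ) (𝕜 := ℝ)
      (F := fun y a => iteratedFDeriv ℝ n (G a) y)
      (F' := fun y a => fderiv ℝ (iteratedFDeriv ℝ n (G a)) y) (bound := B) (x₀ := y)
      Filter.univ_mem (.of_forall fun z => hmeas n z) (hint n y) hm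
      (.of_forall fun a z _ => hB'' a z) hB
      (.of_forall fun a z _ => ((hG a).differentiable_iteratedFDeriv
          (by exact_mod_cast ENat.natCast_lt_top n) z).hasFDerivAt)
    have hc : Integrable (fun a => fderiv ℝ (iteratedFDeriv ℝ n (G a)) y) μ :=
      hB.mono' hm (.of_forall fun a => hB'' a y)
    have h2 : ∫ a, fderiv ℝ (iteratedFDeriv ℝ n (G a)) y ∂μ =
        (∫ a, iteratedFDeriv ℝ (n + 1) (G a) y ∂μ).curryLeft := by
      ext v w
      rw [ContinuousLinearMap.integral_apply hc,
        ContinuousMultilinearMap.integral_apply (hc.apply_continuousLinearMap v),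
        ContinuousMultilinearMap.curryLeft_apply,
        ContinuousMultilinearMap.integral_apply (hint (n + 1) y)]
      simp [hcl]
    rwa [h2] at h1
  refine ⟨fun y => ?_, fun n _ y => hder n y, fun n _ =>
    continuous_iff_continuousAt.2 fun y => (hder n y).continuousAt⟩
  have := (ContinuousMultilinearMap.apply ℝ (fun _ : Fin 0 => E) F 0).integral_comp_comm (hint 0 y)
  rw [ContinuousMultilinearMap.curry0]
  exact this.symm.trans (by simp)

variable {d : ℕ}

/-- The superposition of time-frequency shifts with coefficients having all exponential moments
is in `Σ_1`, and elements of `Σ_1'` commute with it. -/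
theorem exists_synthesis (φ : GelfandShilov d) {b : Eucl d × Eucl d → ℂ}
    (hb : AEStronglyMeasurable b volume)
    (hbi : ∀ r : ℝ, Integrable fun X => Real.exp (r * ‖X‖) * ‖b X‖) :
    ∃ g : GelfandShilov d, (∀ y, g y = ∫ X, b X * conjTimeFreqShift φ X.1 X.2 y) ∧
      ∀ f : GelfandShilovDual d, f g = ∫ X, b X * f (conjTimeFreqShift φ X.1 X.2) := by
  set G : Eucl d × Eucl d → Eucl d → ℂ := fun X y => b X * conjTimeFreqShift φ X.1 X.2 y with hGdef
  have hG : ∀ X, ContDiff ℝ (⊤ : ℕ∞) (G X) := fun X =>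
    contDiff_const.mul (conjTimeFreqShift φ X.1 X.2).contDiff
  have hGi : ∀ n X y, iteratedFDeriv ℝ n (G X) y =
      b X • iteratedFDeriv ℝ n (conjTimeFreqShift φ X.1 X.2) y := fun n X y =>
    iteratedFDeriv_const_smul_apply (a := b X)
      ((conjTimeFreqShift φ X.1 X.2).contDiff.of_le (by exact_mod_cast le_top)).contDiffAt
  -- The jet norm of the shift at `X` grows at most exponentially in `‖X‖`, so the exponential
  -- moments of `b` supply one dominating function for all orders and points.
  have hbd : ∀ h : ℝ, 0 < h → ∃ B : Eucl d × Eucl d → ℝ, Integrable B ∧ ∀ n X y,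
      ‖iteratedFDeriv ℝ n (G X) y‖ ≤ B X * ((h ^ n * n.factorial) * Real.exp (-‖y‖ / h)) := by
    intro h hh
    obtain ⟨C, hC0, hC⟩ := norm_jet_conjTimeFreqShift_le φ hh
    refine ⟨fun X => C * (Real.exp (4 / h * ‖X‖) * ‖b X‖), (hbi _).const_mul C, fun n X y => ?_⟩
    rw [hGi, norm_smul]
    have := (expBound_norm_jet hh (conjTimeFreqShift φ X.1 X.2)).mono hh le_rfl (hC X) n y
    calc _ ≤ ‖b X‖ * (C * Real.exp (4 / h * ‖X‖) * (h ^ n * n.factorial) *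
          Real.exp (-‖y‖ / h)) := by gcongr
      _ = _ := by ring
  have hmeas : ∀ n y, AEStronglyMeasurable (fun X => iteratedFDeriv ℝ n (G X) y) volume := by
    intro n y
    simp only [hGi]
    exact hb.smul (continuous_iteratedFDeriv_conjTimeFreqShift φ n y).aestronglyMeasurable
  have hT := hasFTaylorSeriesUpTo_integral hG hmeas fun n => by
    obtain ⟨B, hB, hB'⟩ := hbd 1 one_pos
    refine ⟨fun X => B X * (n.factorial : ℝ), hB.mul_const _, fun X y => (hB' n X y).trans ?_⟩
    have hBX : 0 ≤ B X := by simpa using (norm_nonneg _).trans (hB' 0 X 0)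
    rw [one_pow, one_mul]
    refine mul_le_mul_of_nonneg_left ?_ hBX
    refine mul_le_of_le_one_right (by positivity) (Real.exp_le_one_iff.2 ?_)
    simp
  have hcd := hT.contDiff
  have hD : ∀ n y, iteratedFDeriv ℝ n (fun y => ∫ X, G X y) y = ∫ X, iteratedFDeriv ℝ n (G X) y :=
    fun n y => (hT.eq_iteratedFDeriv (by exact_mod_cast le_top) y).symm
  have hE : ∀ h : ℝ, 0 < h → ∃ C, ExpBound h C (fun y => ∫ X, G X y) := by
    intro h hh
    obtain ⟨B, hB, hB'⟩ := hbd h hh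
    refine ⟨∫ X, B X, fun n y => ?_⟩
    rw [hD, mul_assoc, ← integral_mul_const]
    exact norm_integral_le_of_norm_le (hB.mul_const _) (.of_forall fun X => hB' n X y)
  refine ⟨.ofExpBound _ hcd hE, fun y => rfl, fun f => ?_⟩
  -- To move `f` inside the integral, pass to jets: there the superposition is a Bochner integral,
  -- which commutes with the bounded functional `L`.
  obtain ⟨h, hh, L, hL⟩ := f.exists_extension
  have hint : Integrable fun X => b X • jet h hh (conjTimeFreqShift φ X.1 X.2) := by
    obtain ⟨C, hC0, hC⟩ := norm_jet_conjTimeFreqShift_le φ hh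
    refine ((hbi (4 / h)).const_mul C).mono'
      (hb.smul (continuous_jet_conjTimeFreqShift φ hh).aestronglyMeasurable)
      (.of_forall fun X => ?_)
    rw [norm_smul]
    calc _ ≤ ‖b X‖ * (C * Real.exp (4 / h * ‖X‖)) := by gcongr; exact hC X
      _ = _ := by ring
  have hJ : jet h hh (.ofExpBound _ hcd hE) =
      ∫ X, b X • jet h hh (conjTimeFreqShift φ X.1 X.2) := by
    ext1
    funext z
    have h1 := (lp.evalCLM ℂ (fun z : ℕ × Eucl d =>
      ContinuousMultilinearMap ℝ (fun _ : Fin z.1 => Eucl d) ℂ) ⊤ z).integral_comp_comm hint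
    refine Eq.trans ?_ h1
    rw [jet_apply, GelfandShilov.coe_ofExpBound, hD, ← integral_smul]
    refine integral_congr_ae (.of_forall fun X => ?_)
    dsimp only
    rw [hGi, smul_comm]
    rfl
  rw [← hL, hJ, ← L.integral_comp_comm hint]
  simp only [map_smul, hL, smul_eq_mul]

end Synthesis

/-! ### Decay of Fourier integrals -/

section Decay

open scoped FourierTransform RealInnerProductSpace

theorem integrable_exp_neg_mul_norm {E : Type*} [NormedAddCommGroup E] [NormedSpace ℝ E]
    [FiniteDimensional ℝ E] [MeasurableSpace E] [BorelSpace E] (μ : Measure E)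
    [μ.IsAddHaarMeasure] {r : ℝ} (hr : 0 < r) :
    Integrable (fun y : E => Real.exp (-(r * ‖y‖))) μ := by
  set N : ℕ := Module.finrank ℝ E + 1
  have h1 := integrable_one_add_norm (μ := μ) (E := E) (r := N) (by simp [N])
  refine (h1.const_mul (r⁻¹ ^ N * N.factorial * Real.exp r)).mono'
    (by fun_prop) (.of_forall fun y => ?_)
  have hy : 0 < 1 + ‖y‖ := by positivity
  rw [Real.norm_of_nonneg (by positivity), Real.rpow_neg hy.le, Real.rpow_natCast,
    ← div_eq_mul_inv, le_div_iff₀ (by positivity)]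
  have h2 := pow_le_mul_exp hy.le (h := r⁻¹) (by positivity) N
  calc _ ≤ Real.exp (-(r * ‖y‖)) *
        (r⁻¹ ^ N * N.factorial * Real.exp ((1 + ‖y‖) / r⁻¹)) := by gcongr
    _ = r⁻¹ ^ N * N.factorial *
        (Real.exp (-(r * ‖y‖)) * Real.exp ((1 + ‖y‖) / r⁻¹)) := by ring
    _ = _ := by
      rw [← Real.exp_add]
      congr 2
      rw [div_inv_eq_mul]
      ring

variable {d : ℕ}

theorem ExpBound.integrable_iteratedFDeriv {h C : ℝ} (hh : 0 < h) {u : Eucl d → ℂ}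
    (hu : ContDiff ℝ (⊤ : ℕ∞) u) (H : ExpBound h C u) (n : ℕ) :
    Integrable (iteratedFDeriv ℝ n u) := by
  have h1 := (integrable_exp_neg_mul_norm (E := Eucl d) volume (r := h⁻¹) (by positivity)).const_mul
    (C * (h ^ n * n.factorial))
  refine h1.mono' (hu.continuous_iteratedFDeriv
    (by exact_mod_cast le_top)).aestronglyMeasurable (.of_forall fun y => (H n y).trans_eq ?_)
  congr 2
  field_simp

theorem ExpBound.integrable {h C : ℝ} (hh : 0 < h) {u : Eucl d → ℂ}
    (hu : Continuous u) (H : ExpBound h C u) : Integrable u := by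
  have h1 := (integrable_exp_neg_mul_norm (E := Eucl d) volume (r := h⁻¹) (by positivity)).const_mul C
  refine h1.mono' hu.aestronglyMeasurable (.of_forall fun y => (H.norm_le y).trans_eq ?_)
  congr 2
  field_simp

/-- The Fourier integral `∫ w(y) e^{-i⟨y, ξ⟩} dy`. -/
def fourierAt (w : Eucl d → ℂ) (ξ : Eucl d) : ℂ :=
  ∫ y, w y * Complex.exp (-(Complex.I * (inner ℝ y ξ : ℝ)))

theorem fourierAt_eq (w : Eucl d → ℂ) (ξ : Eucl d) :
    fourierAt w ξ = 𝓕 w ((2 * Real.pi)⁻¹ • ξ) := by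
  rw [Real.fourier_eq', fourierAt]
  refine integral_congr_ae (.of_forall fun y => ?_)
  dsimp only
  rw [smul_eq_mul, mul_comm]
  congr 2
  rw [inner_smul_right]
  have : (Real.pi : ℂ) ≠ 0 := by exact_mod_cast Real.pi_ne_zero
  push_cast
  field_simp

/-- The Fourier transform of `D^n w` is multilinear-map valued. Evaluated at `(v, …, v)` with `v = ξ
/ 2π`, it has size `(2π)^n ‖v‖^{2n}` times the transform of `w`; one factor `‖v‖^n` cancels. -/
theorem pow_mul_norm_fourierAt_le {w : Eucl d → ℂ} (hw : ContDiff ℝ (⊤ : ℕ∞) w)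
    (hi : ∀ n : ℕ, Integrable (iteratedFDeriv ℝ n w)) (n : ℕ) (ξ : Eucl d) :
    ‖ξ‖ ^ n * ‖fourierAt w ξ‖ ≤ ∫ y, ‖iteratedFDeriv ℝ n w y‖ := by
  have hint0 : 0 ≤ ∫ y, ‖iteratedFDeriv ℝ n w y‖ := integral_nonneg fun _ => norm_nonneg _
  rcases eq_or_ne n 0 with rfl | hn
  · rw [pow_zero, one_mul]
    simp only [norm_iteratedFDeriv_zero]
    refine (norm_integral_le_integral_norm _).trans_eq ?_
    refine integral_congr_ae (.of_forall fun y => ?_)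
    dsimp only
    rw [norm_mul, norm_character, mul_one]
  rcases eq_or_ne ξ 0 with rfl | hξ
  · rwa [norm_zero, zero_pow hn, zero_mul]
  set v := (2 * Real.pi)⁻¹ • ξ with hv
  have hξv : ‖ξ‖ = 2 * Real.pi * ‖v‖ := by
    rw [hv, norm_smul, norm_inv, Real.norm_of_nonneg (by positivity)]
    field_simp
  have hv0 : 0 < ‖v‖ := by
    rw [norm_pos_iff, hv]
    exact smul_ne_zero (by positivity) hξ
  have h1 := congrFun (Real.fourier_iteratedFDeriv (N := ⊤) hw (fun m _ => hi m)
    (n := n) (by exact_mod_cast le_top)) v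
  have h2 : ‖𝓕 (iteratedFDeriv ℝ n w) v‖ ≤ ∫ y, ‖iteratedFDeriv ℝ n w y‖ := by
    rw [Real.fourier_eq]
    refine (norm_integral_le_integral_norm _).trans_eq ?_
    simp
  have h3 := ((𝓕 (iteratedFDeriv ℝ n w) v).le_opNorm (fun _ => v)).trans
    (mul_le_mul_of_nonneg_right h2 (by positivity))
  rw [h1, VectorFourier.fourierPowSMulRight_apply] at h3
  simp only [Finset.prod_const, Finset.card_univ, Fintype.card_fin, norm_smul, norm_pow] at h3
  have e1 : ‖(-innerSL ℝ : Eucl d →L[ℝ] Eucl d →L[ℝ] ℝ) v v‖ = ‖v‖ ^ 2 := by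
    change ‖-(inner ℝ v v : ℝ)‖ = _
    rw [norm_neg, real_inner_self_eq_norm_sq, Real.norm_of_nonneg (by positivity)]
  have e2 : ‖(-(2 * (Real.pi : ℂ) * Complex.I))‖ = 2 * Real.pi := by
    simp [abs_of_pos Real.pi_pos]
  rw [e1, e2, ← fourierAt_eq] at h3
  have h4 : (‖ξ‖ ^ n * ‖fourierAt w ξ‖) * ‖v‖ ^ n ≤
      (∫ y, ‖iteratedFDeriv ℝ n w y‖) * ‖v‖ ^ n := by
    refine le_trans (le_of_eq ?_) h3
    rw [hξv]
    ring
  exact le_of_mul_le_mul_right h4 (by positivity)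

/-- The bounds `h^n n!` on all derivatives become moment bounds on the transform, hence exponential
decay by `le_exp_of_forall_pow_mul_le`. The constant depends only on `h` and `d`. -/
theorem ExpBound.norm_fourierAt_le {h : ℝ} (hh : 0 < h) : ∃ K, 0 ≤ K ∧
    ∀ (C : ℝ) (w : Eucl d → ℂ), ContDiff ℝ (⊤ : ℕ∞) w → ExpBound h C w → ∀ ξ,
      ‖fourierAt w ξ‖ ≤ K * C * Real.exp (-‖ξ‖ / (2 * h)) := by
  have hI := integrable_exp_neg_mul_norm (E := Eucl d) volume (r := h⁻¹) (by positivity)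
  refine ⟨2 * ∫ y : Eucl d, Real.exp (-(h⁻¹ * ‖y‖)),
    mul_nonneg zero_le_two (integral_nonneg fun _ => by positivity), fun C w hw H ξ => ?_⟩
  have := le_exp_of_forall_pow_mul_le (t := ‖ξ‖) (a := ‖fourierAt w ξ‖) hh
    (C := C * ∫ y : Eucl d, Real.exp (-(h⁻¹ * ‖y‖))) fun n => by
      refine (pow_mul_norm_fourierAt_le hw (H.integrable_iteratedFDeriv hh hw) n ξ).trans ?_
      have : ∫ y, ‖iteratedFDeriv ℝ n w y‖ ≤
          ∫ y : Eucl d, C * (h ^ n * n.factorial) * Real.exp (-(h⁻¹ * ‖y‖)) := by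
        refine integral_mono (H.integrable_iteratedFDeriv hh hw n).norm (hI.const_mul _)
          fun y => (H n y).trans_eq ?_
        congr 2
        field_simp
      rw [integral_const_mul] at this
      linarith
  linarith

/-- The inequality `‖x‖ ≤ ‖y‖ + ‖y - x‖` trades half of the decay for decay in `x`; the `n + 1`
Leibniz terms are absorbed by `2^n`. -/
theorem ExpBound.mul_comp_sub {h C C' : ℝ} (hh : 0 < h) {u v : Eucl d → ℂ}
    (hu : ContDiff ℝ (⊤ : ℕ∞) u) (hv : ContDiff ℝ (⊤ : ℕ∞) v) (H : ExpBound h C u)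
    (H' : ExpBound h C' v) (x : Eucl d) :
    ExpBound (2 * h) (C * C' * Real.exp (-‖x‖ / (2 * h))) (fun y => u y * v (y - x)) := fun n y => by
  have hC := H.nonneg
  have hC' := H'.nonneg
  have hn : (n : WithTop ℕ∞) ≤ ((⊤ : ℕ∞) : WithTop ℕ∞) := by exact_mod_cast le_top
  refine (norm_iteratedFDeriv_mul_le hu
    (hv.comp (contDiff_id.sub contDiff_const) : ContDiff ℝ (⊤ : ℕ∞) (fun y => v (y - x))) y
    hn).trans ?_
  have he : Real.exp (-‖y‖ / h) * Real.exp (-‖y - x‖ / h) ≤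
      Real.exp (-‖x‖ / (2 * h)) * Real.exp (-‖y‖ / (2 * h)) := by
    rw [← Real.exp_add, ← Real.exp_add, Real.exp_le_exp, ← add_div, ← add_div,
      div_le_div_iff₀ hh (by positivity)]
    have h1 : ‖x‖ ≤ ‖y‖ + ‖y - x‖ := by
      have := norm_sub_norm_le x y
      rw [norm_sub_rev] at this
      linarith
    nlinarith [norm_nonneg (y - x), norm_nonneg y]
  have hterm : ∀ i ∈ Finset.range (n + 1), (n.choose i : ℝ) * ‖iteratedFDeriv ℝ i u y‖ *
      ‖iteratedFDeriv ℝ (n - i) (fun y => v (y - x)) y‖ ≤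
      C * C' * (h ^ n * n.factorial) *
        (Real.exp (-‖x‖ / (2 * h)) * Real.exp (-‖y‖ / (2 * h))) := by
    intro i hi
    have hi' : i ≤ n := Nat.lt_succ_iff.1 (Finset.mem_range.1 hi)
    have hc : (n.choose i : ℝ) * i.factorial * (n - i).factorial = n.factorial := by
      exact_mod_cast Nat.choose_mul_factorial_mul_factorial hi'
    have hp : h ^ n = h ^ (n - i) * h ^ i := by
      rw [← pow_add]; congr 1; omega
    rw [iteratedFDeriv_comp_sub]
    calc _ ≤ (n.choose i : ℝ) * (C * (h ^ i * i.factorial) * Real.exp (-‖y‖ / h)) *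
          (C' * (h ^ (n - i) * (n - i).factorial) * Real.exp (-‖y - x‖ / h)) := by
          gcongr
          · exact H i y
          · exact H' (n - i) (y - x)
      _ = C * C' * (h ^ n * n.factorial) *
          (Real.exp (-‖y‖ / h) * Real.exp (-‖y - x‖ / h)) := by
          rw [← hc, hp]; ring
      _ ≤ _ := by gcongr
  refine (Finset.sum_le_sum hterm).trans ?_
  rw [Finset.sum_const, Finset.card_range, nsmul_eq_mul]
  have h2 : ((n + 1 : ℕ) : ℝ) ≤ 2 ^ n := by exact_mod_cast Nat.lt_two_pow_self
  calc _ ≤ (2 : ℝ) ^ n * (C * C' * (h ^ n * n.factorial) *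
        (Real.exp (-‖x‖ / (2 * h)) * Real.exp (-‖y‖ / (2 * h)))) := by gcongr
    _ = _ := by rw [mul_pow]; ring

theorem GelfandShilov.norm_fourierAt_mul_le (u v : GelfandShilov d) {r : ℝ} (hr : 0 < r) :
    ∃ C, 0 ≤ C ∧ ∀ x ξ : Eucl d, ‖fourierAt (fun y => u y * v (y - x)) ξ‖ ≤
      C * Real.exp (-(r * (‖x‖ + ‖ξ‖))) := by
  -- The product has parameter `2h`, and its Fourier integral then decays like `e^{-‖ξ‖/(4h)}`;
  -- hence `h = 1 / (4r)`.
  obtain ⟨h, hh, hhr⟩ : ∃ h : ℝ, 0 < h ∧ r = 1 / (4 * h) :=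
    ⟨1 / (4 * r), by positivity, by field_simp⟩
  obtain ⟨C, hC⟩ := u.exists_expBound hh
  obtain ⟨C', hC'⟩ := v.exists_expBound hh
  obtain ⟨K, hK0, hK⟩ := ExpBound.norm_fourierAt_le (d := d) (h := 2 * h) (by positivity)
  have h0 := hC.nonneg
  have h0' := hC'.nonneg
  refine ⟨K * (C * C'), by positivity, fun x ξ => ?_⟩
  refine (hK _ _ (u.contDiff.mul (v.contDiff.comp (contDiff_id.sub contDiff_const)))
    (hC.mul_comp_sub hh u.contDiff v.contDiff hC' x) ξ).trans ?_
  rw [← mul_assoc K, mul_assoc (K * (C * C')), ← Real.exp_add]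
  gcongr
  rw [hhr]
  have : -‖x‖ / (2 * h) ≤ -‖x‖ / (4 * h) := by
    rw [neg_div, neg_div, neg_le_neg_iff]
    gcongr
    linarith
  calc _ ≤ -‖x‖ / (4 * h) + -‖ξ‖ / (2 * (2 * h)) := by gcongr
    _ = _ := by ring

/-- Up to scaling, `fourierAt w (-ξ)` is the inverse transform of `w`, and the integral is the
forward transform of it. The factor `(2π)^d` is the Jacobian of rescaling the frequency. -/
theorem fourierAt_inversion {h C : ℝ} (hh : 0 < h) {w : Eucl d → ℂ}
    (hw : ContDiff ℝ (⊤ : ℕ∞) w) (H : ExpBound h C w) (y : Eucl d) :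
    ∫ ξ, fourierAt w (-ξ) * Complex.exp (-(Complex.I * (inner ℝ y ξ : ℝ))) =
      ((2 * Real.pi) ^ d : ℝ) * w y := by
  have hwi := H.integrable hh hw.continuous
  have hc : ∀ ξ, 𝓕 w ξ = fourierAt w ((2 * Real.pi) • ξ) := fun ξ => by
    rw [fourierAt_eq, smul_smul, inv_mul_cancel₀ (by positivity), one_smul]
  obtain ⟨K, hK0, hK⟩ := ExpBound.norm_fourierAt_le (d := d) hh
  have hFi : Integrable (𝓕 w) := by
    have h1 := (integrable_exp_neg_mul_norm (E := Eucl d) volume (r := Real.pi / h)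
      (by positivity)).const_mul (K * C)
    refine h1.mono' (VectorFourier.fourierIntegral_continuous Real.continuous_fourierChar
        (innerSL ℝ).continuous₂ hwi).aestronglyMeasurable
      (.of_forall fun ξ => ?_)
    rw [hc]
    refine (hK C w hw H _).trans_eq ?_
    congr 2
    rw [norm_smul, Real.norm_of_nonneg (by positivity)]
    field_simp
  have hinv := congrFun (hw.continuous.fourier_fourierInv_eq hwi hFi) y
  rw [Real.fourier_eq'] at hinv
  rw [← hinv]
  have h2 := Measure.integral_comp_inv_smul (volume : Measure (Eucl d))
    (fun v : Eucl d => Complex.exp (↑(-2 * Real.pi * inner ℝ v y) * Complex.I) • 𝓕⁻ w v)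
    (2 * Real.pi)
  rw [finrank_euclideanSpace_fin, abs_of_pos (by positivity)] at h2
  rw [← Complex.real_smul, ← h2]
  refine integral_congr_ae (.of_forall fun ξ => ?_)
  dsimp only
  rw [Real.fourierInv_eq_fourier_neg, fourierAt_eq, smul_neg, smul_eq_mul, mul_comm]
  congr 2
  rw [real_inner_smul_left, real_inner_comm]
  have : (Real.pi : ℂ) ≠ 0 := by exact_mod_cast Real.pi_ne_zero
  push_cast
  field_simp

end Decay

/-! ### The reproducing formula -/

section Reproducing

variable {d : ℕ}

instance : (volume : Measure (Eucl d × Eucl d)).IsAddHaarMeasure :=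
  inferInstanceAs ((volume : Measure (Eucl d)).prod volume).IsAddHaarMeasure

/-- The complex conjugate of a function of `Σ_1`. -/
def GelfandShilov.conj (f : GelfandShilov d) : GelfandShilov d :=
  .ofExpBound (fun y => starRingEnd ℂ (f y)) (Complex.conjCLE.contDiff.comp f.contDiff)
    fun _ hh => (f.exists_expBound hh).imp fun _ hC => hC.conj

theorem GelfandShilov.conj_apply (f : GelfandShilov d) (y : Eucl d) :
    f.conj y = starRingEnd ℂ (f y) := rfl

/-- The coefficient `∫ χ(t) φ(t - x) e^{i⟨t, ξ⟩} dt`. -/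
def timeFreqCoeff (φ χ : GelfandShilov d) (X : Eucl d × Eucl d) : ℂ :=
  ∫ t, χ t * starRingEnd ℂ (conjTimeFreqShift φ X.1 X.2 t)

theorem conj_conjTimeFreqShift (φ : GelfandShilov d) (x ξ t : Eucl d) :
    starRingEnd ℂ (conjTimeFreqShift φ x ξ t) =
      φ (t - x) * Complex.exp (-(Complex.I * (inner ℝ t (-ξ) : ℝ))) := by
  rw [conjTimeFreqShift_apply, map_mul, Complex.conj_conj, ← Complex.exp_conj]
  simp

theorem timeFreqCoeff_eq_fourierAt (φ χ : GelfandShilov d) (X : Eucl d × Eucl d) :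
    timeFreqCoeff φ χ X = fourierAt (fun t => χ t * φ (t - X.1)) (-X.2) := by
  simp only [timeFreqCoeff, fourierAt, conj_conjTimeFreqShift, mul_assoc]

/-- The coefficient is the conjugate of the distribution given by the conjugate of `χ`, tested on
time-frequency shifts. -/
theorem continuous_timeFreqCoeff (φ χ : GelfandShilov d) : Continuous (timeFreqCoeff φ χ) := by
  have h := (GelfandShilovDual.ofIntegrable χ.conj χ.conj.integrable).continuous_conjTimeFreqShift φ
  refine (Complex.continuous_conj.comp h).congr fun X => ?_
  change starRingEnd ℂ (∫ t, χ.conj t * conjTimeFreqShift φ X.1 X.2 t) = _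
  rw [← integral_conj]
  simp only [map_mul, GelfandShilov.conj_apply, Complex.conj_conj]
  rfl

theorem norm_le_fst_add_snd (X : Eucl d × Eucl d) : ‖X‖ ≤ ‖X.1‖ + ‖X.2‖ :=
  max_le (le_add_of_nonneg_right (norm_nonneg _)) (le_add_of_nonneg_left (norm_nonneg _))

theorem norm_timeFreqCoeff_le (φ χ : GelfandShilov d) {r : ℝ} (hr : 0 < r) :
    ∃ C, 0 ≤ C ∧ ∀ X, ‖timeFreqCoeff φ χ X‖ ≤ C * Real.exp (-(r * ‖X‖)) := by
  obtain ⟨C, hC0, hC⟩ := χ.norm_fourierAt_mul_le φ hr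
  refine ⟨C, hC0, fun X => ?_⟩
  rw [timeFreqCoeff_eq_fourierAt]
  refine (hC X.1 (-X.2)).trans ?_
  rw [norm_neg]
  gcongr
  exact norm_le_fst_add_snd X

/-- Covariance: translating the integration variable by `Y.1` shows that, up to a phase, the
coefficient depends only on `X - Y`. -/
theorem norm_timeFreqCoeff_conjTimeFreqShift_le (φ : GelfandShilov d) {r : ℝ} (hr : 0 < r) :
    ∃ C, 0 ≤ C ∧ ∀ X Y : Eucl d × Eucl d,
      ‖timeFreqCoeff φ (conjTimeFreqShift φ Y.1 Y.2) X‖ ≤ C * Real.exp (-(r * ‖X - Y‖)) := by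
  obtain ⟨C, hC0, hC⟩ := norm_timeFreqCoeff_le φ φ.conj hr
  refine ⟨C, hC0, fun X Y => ?_⟩
  refine le_trans (le_of_eq ?_) (hC (X - Y))
  have h1 : timeFreqCoeff φ (conjTimeFreqShift φ Y.1 Y.2) X =
      Complex.exp (Complex.I * (inner ℝ Y.1 (X.2 - Y.2) : ℝ)) *
        timeFreqCoeff φ φ.conj (X - Y) := by
    simp only [timeFreqCoeff]
    rw [← integral_const_mul, ← integral_add_right_eq_self _ Y.1]
    refine integral_congr_ae (.of_forall fun t => ?_)
    simp only [conj_conjTimeFreqShift]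
    simp only [conjTimeFreqShift_apply, GelfandShilov.conj_apply, Prod.fst_sub, Prod.snd_sub]
    rw [add_sub_cancel_right, show t + Y.1 - X.1 = t - (X.1 - Y.1) by abel]
    have : Complex.exp (-(Complex.I * (inner ℝ (t + Y.1) Y.2 : ℝ))) *
        Complex.exp (-(Complex.I * (inner ℝ (t + Y.1) (-X.2) : ℝ))) =
        Complex.exp (Complex.I * (inner ℝ Y.1 (X.2 - Y.2) : ℝ)) *
          Complex.exp (-(Complex.I * (inner ℝ t (-(X.2 - Y.2)) : ℝ))) := by
      rw [← Complex.exp_add, ← Complex.exp_add]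
      congr 1
      simp only [inner_add_left, inner_neg_right, inner_sub_right]
      push_cast
      ring
    linear_combination (starRingEnd ℂ (φ t)) * φ (t - (X.1 - Y.1)) * this
  rw [h1, norm_mul]
  have : ‖Complex.exp (Complex.I * (inner ℝ Y.1 (X.2 - Y.2) : ℝ))‖ = 1 := by
    rw [mul_comm, Complex.norm_exp_ofReal_mul_I]
  rw [this, one_mul]

theorem integrable_exp_mul_norm_timeFreqCoeff (φ χ : GelfandShilov d) (r : ℝ) :
    Integrable fun X => Real.exp (r * ‖X‖) * ‖timeFreqCoeff φ χ X‖ := by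
  obtain ⟨C, hC0, hC⟩ := norm_timeFreqCoeff_le φ χ (r := |r| + 1) (by positivity)
  have h1 := (integrable_exp_neg_mul_norm (E := Eucl d × Eucl d) volume one_pos).const_mul C
  have hc := continuous_timeFreqCoeff φ χ
  refine h1.mono' (by fun_prop) (.of_forall fun X => ?_)
  rw [Real.norm_of_nonneg (by positivity)]
  calc _ ≤ Real.exp (|r| * ‖X‖) * (C * Real.exp (-((|r| + 1) * ‖X‖))) := by
        gcongr
        · exact le_abs_self r
        · exact hC X
    _ = C * (Real.exp (|r| * ‖X‖) * Real.exp (-((|r| + 1) * ‖X‖))) := by ring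
    _ = _ := by rw [← Real.exp_add]; ring_nf

/-- The constant `(2π)^d ‖φ‖²` of the reproducing formula. -/
def reproducingConst (φ : GelfandShilov d) : ℂ :=
  ((2 * Real.pi) ^ d : ℝ) * ((∫ x, ‖φ x‖ ^ 2 : ℝ) : ℂ)

theorem reproducingConst_ne_zero {φ : GelfandShilov d} (hφ : φ ≠ 0) : reproducingConst φ ≠ 0 := by
  have hc : Continuous fun x => ‖φ x‖ ^ 2 := (φ.contDiff.continuous.norm).pow 2
  have hi : Integrable fun x => ‖φ x‖ ^ 2 := by
    obtain ⟨C, hC⟩ := φ.exists_expBound one_pos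
    refine (φ.integrable.norm.const_mul C).mono' hc.aestronglyMeasurable (.of_forall fun x => ?_)
    rw [Real.norm_of_nonneg (by positivity), sq]
    gcongr
    refine (hC.norm_le x).trans (mul_le_of_le_one_right hC.nonneg (Real.exp_le_one_iff.2 ?_))
    simp
  have h0 : (∫ x, ‖φ x‖ ^ 2) ≠ 0 := by
    intro h
    rw [integral_eq_zero_iff_of_nonneg (fun _ => by positivity) hi] at h
    have := (hc.ae_eq_iff_eq volume continuous_const).1 h
    refine hφ (DFunLike.ext _ _ fun x => ?_)
    have h2 : ‖φ x‖ ^ 2 = 0 := congrFun this x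
    exact norm_eq_zero.1 (pow_eq_zero_iff two_ne_zero |>.1 h2)
  refine mul_ne_zero ?_ ?_
  · exact_mod_cast (by positivity : ((2 * Real.pi) ^ d : ℝ) ≠ 0)
  · exact_mod_cast h0

/-- For fixed `x`, the `ξ`-integral is Fourier inversion for `t ↦ χ(t) φ(t - x)` and gives `(2π)^d
χ(y) ‖φ(y - x)‖²`; the `x`-integral then produces `‖φ‖²`. -/
theorem integral_timeFreqCoeff_mul (φ χ : GelfandShilov d) (y : Eucl d) :
    ∫ X, timeFreqCoeff φ χ X * conjTimeFreqShift φ X.1 X.2 y = reproducingConst φ * χ y := by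
  obtain ⟨C, hC⟩ := φ.exists_expBound one_pos
  obtain ⟨C', hC'⟩ := χ.exists_expBound one_pos
  have hint : Integrable fun X : Eucl d × Eucl d =>
      timeFreqCoeff φ χ X * conjTimeFreqShift φ X.1 X.2 y := by
    have h1 := (integrable_exp_mul_norm_timeFreqCoeff φ χ 0).const_mul C
    have hc := continuous_timeFreqCoeff φ χ
    have hc' := continuous_conjTimeFreqShift_apply φ y
    refine h1.mono' (by fun_prop) (.of_forall fun X => ?_)
    rw [norm_mul, zero_mul, Real.exp_zero, one_mul, mul_comm]
    gcongr
    rw [conjTimeFreqShift_apply, norm_mul, norm_character, mul_one, RCLike.norm_conj]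
    refine (hC.norm_le _).trans (mul_le_of_le_one_right hC.nonneg (Real.exp_le_one_iff.2 ?_))
    simp
  rw [Measure.volume_eq_prod] at hint ⊢
  rw [integral_prod _ hint]
  have hinner : ∀ x : Eucl d, ∫ ξ, timeFreqCoeff φ χ (x, ξ) * conjTimeFreqShift φ x ξ y =
      ((2 * Real.pi) ^ d : ℝ) * χ y * ((‖φ (y - x)‖ ^ 2 : ℝ) : ℂ) := by
    intro x
    have h1 := fourierAt_inversion (w := fun t => χ t * φ (t - x)) (by norm_num : (0 : ℝ) < 2 * 1)
      (χ.contDiff.mul (φ.contDiff.comp (contDiff_id.sub contDiff_const)))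
      (hC'.mul_comp_sub one_pos χ.contDiff φ.contDiff hC x) y
    have h2 : ∀ ξ, timeFreqCoeff φ χ (x, ξ) * conjTimeFreqShift φ x ξ y =
        starRingEnd ℂ (φ (y - x)) * (fourierAt (fun t => χ t * φ (t - x)) (-ξ) *
          Complex.exp (-(Complex.I * (inner ℝ y ξ : ℝ)))) := fun ξ => by
      rw [timeFreqCoeff_eq_fourierAt, conjTimeFreqShift_apply]
      ring
    simp only [h2]
    rw [integral_const_mul, h1]
    have h3 : ((‖φ (y - x)‖ ^ 2 : ℝ) : ℂ) = starRingEnd ℂ (φ (y - x)) * φ (y - x) := by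
      rw [mul_comm, Complex.mul_conj, Complex.normSq_eq_norm_sq]
    rw [h3]
    ring
  simp only [hinner]
  rw [integral_const_mul, integral_complex_ofReal, reproducingConst,
    integral_sub_left_eq_self (fun x => ‖φ x‖ ^ 2) volume y]
  ring

/-- The reproducing formula for elements of `Σ_1'`. -/
theorem GelfandShilovDual.reproducing (f : GelfandShilovDual d) (φ χ : GelfandShilov d) :
    ∫ X, timeFreqCoeff φ χ X * f (conjTimeFreqShift φ X.1 X.2) = reproducingConst φ * f χ := by
  obtain ⟨g, hg, hfg⟩ := exists_synthesis φ (continuous_timeFreqCoeff φ χ).aestronglyMeasurable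
    (integrable_exp_mul_norm_timeFreqCoeff φ χ)
  have : g = reproducingConst φ • χ := DFunLike.ext _ _ fun y => by
    rw [hg, integral_timeFreqCoeff_mul, GelfandShilov.smul_apply]
  rw [← hfg, this, map_smul, smul_eq_mul]

theorem GelfandShilovDual.integrable_timeFreqCoeff_mul (f : GelfandShilovDual d)
    (φ χ : GelfandShilov d) :
    Integrable fun X => timeFreqCoeff φ χ X * f (conjTimeFreqShift φ X.1 X.2) := by
  obtain ⟨C, r, hC0, hr, hC⟩ := f.exists_growth φ
  have hc := continuous_timeFreqCoeff φ χ
  have hf := f.continuous_conjTimeFreqShift φ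
  refine ((integrable_exp_mul_norm_timeFreqCoeff φ χ r).const_mul C).mono'
    (hc.mul hf).aestronglyMeasurable (.of_forall fun X => ?_)
  rw [norm_mul]
  calc _ ≤ ‖timeFreqCoeff φ χ X‖ * (C * Real.exp (r * ‖X‖)) := by gcongr; exact hC X
    _ = _ := by ring

/-- The localization of `f ∈ Σ_1'` to a ball of phase space is in `Σ_1`. -/
theorem GelfandShilovDual.exists_localization (f : GelfandShilovDual d) (φ : GelfandShilov d)
    (R : ℝ) : ∃ g : GelfandShilov d, ∀ χ : GelfandShilov d,
      ofIntegrable g g.integrable χ =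
        ∫ X in Metric.closedBall 0 R, timeFreqCoeff φ χ X * f (conjTimeFreqShift φ X.1 X.2) := by
  have hf := f.continuous_conjTimeFreqShift φ
  -- The synthesis superposes conjugated shifts. Conjugating the coefficients here and the resulting
  -- function afterwards gives a superposition of the shifts themselves.
  set b : Eucl d × Eucl d → ℂ := (Metric.closedBall 0 R).indicator
    fun X => starRingEnd ℂ (f (conjTimeFreqShift φ X.1 X.2)) with hb
  have hcf : Continuous fun X : Eucl d × Eucl d =>
      starRingEnd ℂ (f (conjTimeFreqShift φ X.1 X.2)) := Complex.continuous_conj.comp hf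
  have hbm : AEStronglyMeasurable b volume :=
    hcf.aestronglyMeasurable.indicator Metric.isClosed_closedBall.measurableSet
  obtain ⟨g, hg, hL⟩ := exists_synthesis φ hbm fun r => by
    have h1 : IntegrableOn (fun X : Eucl d × Eucl d => Real.exp (r * ‖X‖) *
        ‖starRingEnd ℂ (f (conjTimeFreqShift φ X.1 X.2))‖) (Metric.closedBall 0 R) := by
      refine ContinuousOn.integrableOn_compact (isCompact_closedBall _ _)
        (Continuous.continuousOn ?_)
      have := hcf.norm
      fun_prop
    refine (h1.integrable_indicator Metric.isClosed_closedBall.measurableSet).congr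
      (.of_forall fun X => ?_)
    by_cases hX : X ∈ Metric.closedBall (0 : Eucl d × Eucl d) R
    · simp [hb, hX]
    · simp [hb, hX]
  refine ⟨g.conj, fun χ => ?_⟩
  -- This instance of the synthesis lemma replaces Fubini's theorem.
  have h1 := hL (ofIntegrable χ.conj χ.conj.integrable)
  have h2 : ofIntegrable g.conj g.conj.integrable χ =
      starRingEnd ℂ (ofIntegrable χ.conj χ.conj.integrable g) := by
    change ∫ y, g.conj y * χ y = starRingEnd ℂ (∫ y, χ.conj y * g y)
    rw [← integral_conj]
    refine integral_congr_ae (.of_forall fun y => ?_)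
    simp only [GelfandShilov.conj_apply, map_mul, Complex.conj_conj]
    ring
  rw [h2, h1, ← integral_conj, ← integral_indicator Metric.isClosed_closedBall.measurableSet]
  refine integral_congr_ae (.of_forall fun X => ?_)
  have h3 : starRingEnd ℂ (ofIntegrable χ.conj χ.conj.integrable
      (conjTimeFreqShift φ X.1 X.2)) = timeFreqCoeff φ χ X := by
    change starRingEnd ℂ (∫ t, χ.conj t * conjTimeFreqShift φ X.1 X.2 t) = _
    rw [← integral_conj]
    simp only [map_mul, GelfandShilov.conj_apply, Complex.conj_conj]
    rfl
  by_cases hX : X ∈ Metric.closedBall (0 : Eucl d × Eucl d) R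
  · simp only [hb, hX, Set.indicator_of_mem, map_mul, h3, Complex.conj_conj]
    ring
  · simp [hb, hX]

/-- The reproducing formula is applied to the shift at `Y`, whose coefficients are concentrated near
`Y`. Subtracting its part over the ball leaves the part over the complement. The constant serves all
`f` and `R`. -/
theorem GelfandShilovDual.exists_approx {φ : GelfandShilov d} (hφ : φ ≠ 0) {r : ℝ} (hr : 0 < r) :
    ∃ A : ℝ, 0 ≤ A ∧ ∀ f : GelfandShilovDual d,
      (∀ Y, ‖stft φ f Y‖ₑ ≤ ∫⁻ X, ENNReal.ofReal (A * Real.exp (-(r * ‖X - Y‖))) * ‖stft φ f X‖ₑ) ∧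
      ∀ R : ℝ, ∃ g : GelfandShilov d, ∀ Y,
        ‖stft φ (f - ofIntegrable g g.integrable) Y‖ₑ ≤
          ∫⁻ X in (Metric.closedBall 0 R)ᶜ,
            ENNReal.ofReal (A * Real.exp (-(r * ‖X - Y‖))) * ‖stft φ f X‖ₑ := by
  obtain ⟨C, hC0, hC⟩ := norm_timeFreqCoeff_conjTimeFreqShift_le φ hr
  have hκ := reproducingConst_ne_zero hφ
  set κ := reproducingConst φ with hκdef
  set c : ℂ := (((2 * Real.pi) ^ (-(d : ℝ) / 2) : ℝ) : ℂ) with hc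
  have hst : ∀ (f : GelfandShilovDual d) X, stft φ f X = c * f (conjTimeFreqShift φ X.1 X.2) :=
    fun _ _ => rfl
  have hbound : ∀ (f : GelfandShilovDual d) (S : Set (Eucl d × Eucl d)) (Y : Eucl d × Eucl d),
      ‖c * (κ⁻¹ * ∫ X in S, timeFreqCoeff φ (conjTimeFreqShift φ Y.1 Y.2) X *
        f (conjTimeFreqShift φ X.1 X.2))‖ₑ ≤
      ∫⁻ X in S, ENNReal.ofReal (‖κ⁻¹‖ * C * Real.exp (-(r * ‖X - Y‖))) * ‖stft φ f X‖ₑ := by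
    intro f S Y
    rw [← integral_const_mul, ← integral_const_mul]
    refine (enorm_integral_le_lintegral_enorm _).trans (lintegral_mono fun X => ?_)
    rw [show ∀ a b : ℂ, c * (κ⁻¹ * (a * b)) = (κ⁻¹ * a) * (c * b) by intros; ring, ← hst, enorm_mul]
    gcongr
    rw [← ofReal_norm, norm_mul, mul_assoc]
    gcongr
    exact hC X Y
  refine ⟨‖κ⁻¹‖ * C, by positivity, fun f => ⟨fun Y => ?_, fun R => ?_⟩⟩
  · have h1 := f.reproducing φ (conjTimeFreqShift φ Y.1 Y.2)
    have h2 := hbound f Set.univ Y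
    rw [setIntegral_univ, h1, inv_mul_cancel_left₀ hκ, ← hst, Measure.restrict_univ] at h2
    exact h2
  · obtain ⟨g, hg⟩ := f.exists_localization φ R
    refine ⟨κ⁻¹ • g, fun Y => ?_⟩
    have h1 := f.reproducing φ (conjTimeFreqShift φ Y.1 Y.2)
    have h2 := integral_add_compl (μ := volume)
      (Metric.isClosed_closedBall (x := (0 : Eucl d × Eucl d)) (ε := R)).measurableSet
      (f.integrable_timeFreqCoeff_mul φ (conjTimeFreqShift φ Y.1 Y.2))
    have h3 : ofIntegrable (κ⁻¹ • g : GelfandShilov d) (κ⁻¹ • g).integrable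
        (conjTimeFreqShift φ Y.1 Y.2) =
        κ⁻¹ * ofIntegrable g g.integrable (conjTimeFreqShift φ Y.1 Y.2) := by
      change ∫ y, (κ⁻¹ • g) y * _ = κ⁻¹ * ∫ y, g y * _
      rw [← integral_const_mul]
      simp only [GelfandShilov.smul_apply, mul_assoc]
    refine le_trans (le_of_eq ?_) (hbound f (Metric.closedBall 0 R)ᶜ Y)
    congr 1
    rw [hst, _root_.sub_apply, h3, hg]
    congr 1
    rw [h1, ← hκdef] at h2
    rw [eq_inv_mul_iff_mul_eq₀ hκ, mul_sub, ← h2, mul_inv_cancel_left₀ hκ]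
    ring

end Reproducing

/-! ### Inequalities for functions reproduced by exponential kernels -/

section ExpKernel

variable {E : Type*} [NormedAddCommGroup E]

/-- The kernel `e^{-r|X - Y|}` with values in `[0, ∞]`. -/
def expKer (r : ℝ) (X Y : E) : ℝ≥0∞ := ENNReal.ofReal (Real.exp (-(r * ‖X - Y‖)))

theorem expKer_ne_top (r : ℝ) (X Y : E) : expKer r X Y ≠ ⊤ := ENNReal.ofReal_ne_top

theorem expKer_pos (r : ℝ) (X Y : E) : 0 < expKer r X Y :=
  ENNReal.ofReal_pos.2 (Real.exp_pos _)

theorem expKer_comm (r : ℝ) (X Y : E) : expKer r X Y = expKer r Y X := by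
  rw [expKer, expKer, norm_sub_rev]

theorem expKer_rpow (r : ℝ) (X Y : E) (s : ℝ) : expKer r X Y ^ s = expKer (s * r) X Y := by
  rw [expKer, expKer, ENNReal.ofReal_rpow_of_pos (Real.exp_pos _), ← Real.exp_mul]
  congr 2
  ring

theorem expKer_mul (r s : ℝ) (X Y : E) : expKer r X Y * expKer s X Y = expKer (r + s) X Y := by
  rw [expKer, expKer, expKer, ← ENNReal.ofReal_mul (Real.exp_pos _).le, ← Real.exp_add]
  congr 2
  ring

theorem expKer_anti {r s : ℝ} (h : r ≤ s) (X Y : E) : expKer s X Y ≤ expKer r X Y := by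
  refine ENNReal.ofReal_le_ofReal (Real.exp_le_exp.2 ?_)
  gcongr

theorem expKer_mul_le {r : ℝ} (hr : 0 ≤ r) (X Y Z : E) :
    expKer r X Y * expKer r Y Z ≤ expKer r X Z := by
  rw [expKer, expKer, expKer, ← ENNReal.ofReal_mul (Real.exp_pos _).le, ← Real.exp_add]
  refine ENNReal.ofReal_le_ofReal (Real.exp_le_exp.2 ?_)
  have : r * ‖X - Z‖ ≤ r * (‖X - Y‖ + ‖Y - Z‖) := by
    gcongr
    exact norm_sub_le_norm_sub_add_norm_sub X Y Z
  linarith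

theorem continuous_expKer (r : ℝ) : Continuous fun p : E × E => expKer r p.1 p.2 := by
  refine ENNReal.continuous_ofReal.comp ?_
  fun_prop

/-- The maximal function argument: a function of at most exponential growth that is reproduced by
exponential kernels satisfies a sub-mean value property for small powers. -/
theorem rpow_le_lintegral_of_le_one [MeasurableSpace E] {μ : Measure E} {W : E → ℝ≥0∞}
    (hrep : ∀ r : ℝ, 0 < r → ∃ A : ℝ≥0∞, A ≠ ⊤ ∧ ∀ Y, W Y ≤ A * ∫⁻ X, expKer r X Y * W X ∂μ)
    {s₀ : ℝ} (hs₀ : 0 ≤ s₀) {C : ℝ≥0∞} (hC : C ≠ ⊤)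
    (hgrow : ∀ X, W X * expKer s₀ X 0 ≤ C) {q : ℝ} (hq0 : 0 < q) (hq1 : q ≤ 1) :
    ∃ a : ℝ, 0 < a ∧ ∃ B : ℝ≥0∞, B ≠ ⊤ ∧
      ∀ Y, W Y ^ q ≤ B * ∫⁻ X, expKer a X Y * W X ^ q ∂μ := by
  set s : ℝ := s₀ + 1
  have hs : 0 < s := by positivity
  obtain ⟨A, hA, hrep⟩ := hrep (2 * s) (by positivity)
  -- The maximal function dominates `W`, is finite by the growth hypothesis, and varies at most like
  -- `e^{s‖X-Y‖}`. Taking `s = s₀ + 1` keeps the final rate `q s` positive even when `s₀ = 0`.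
  set M : E → ℝ≥0∞ := fun X => ⨆ Y, W Y * expKer s Y X with hM
  have hWM : ∀ X, W X ≤ M X := fun X => by
    refine le_trans (le_of_eq ?_) (le_iSup (fun Y => W Y * expKer s Y X) X)
    simp [expKer]
  have hMM : ∀ X Y, M Y * expKer s Y X ≤ M X := fun X Y => by
    rw [hM, ENNReal.iSup_mul]
    refine iSup_le fun Z => ?_
    rw [mul_assoc]
    refine le_trans ?_ (le_iSup (fun Y => W Y * expKer s Y X) Z)
    gcongr
    exact expKer_mul_le hs.le Z Y X
  have hM0 : ∀ X, M X ≠ ⊤ := fun X => by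
    have h1 : M X * expKer s X 0 ≤ C := by
      rw [hM, ENNReal.iSup_mul]
      refine iSup_le fun Z => ?_
      rw [mul_assoc]
      refine le_trans ?_ (hgrow Z)
      gcongr
      exact (expKer_mul_le hs.le Z X 0).trans (expKer_anti (by simp [s]) _ _)
    intro h
    rw [h, ENNReal.top_mul (expKer_pos _ _ _).ne', top_le_iff] at h1
    exact hC h1
  have hpow : ∀ X Y, M Y ^ (1 - q) * expKer ((1 - q) * s) Y X ≤ M X ^ (1 - q) := fun X Y => by
    rw [← expKer_rpow, ← ENNReal.mul_rpow_of_nonneg _ _ (by linarith)]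
    exact ENNReal.rpow_le_rpow (hMM X Y) (by linarith)
  have hsplit : ∀ w : ℝ≥0∞, w ≠ ⊤ → w = w ^ (1 - q) * w ^ q := fun w hw => by
    rcases eq_or_ne w 0 with rfl | h0
    · rw [ENNReal.zero_rpow_of_pos hq0, mul_zero]
    · rw [← ENNReal.rpow_add _ _ h0 hw]
      simp
  refine ⟨q * s, by positivity, A, hA, fun X => ?_⟩
  set T := ∫⁻ Z, expKer (q * s) Z X * W Z ^ q ∂μ with hT
  -- Write `W = W^{1-q} W^q`. The kernels combine to `e^{-s‖Z-X‖}`, of which the share `(1 - q)s`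
  -- turns `W(Z)^{1-q}` into `M(X)^{1-q}`, and the share `qs` remains in `T`.
  have hWY : ∀ Y, W Y * expKer s Y X ≤ A * (M X ^ (1 - q) * T) := fun Y => by
    have h1 : ∀ Z, expKer (2 * s) Z Y * W Z * expKer s Y X ≤
        M X ^ (1 - q) * (expKer (q * s) Z X * W Z ^ q) := fun Z => by
      have hWZ : W Z ^ (1 - q) * expKer ((1 - q) * s) Z X ≤ M X ^ (1 - q) := by
        refine le_trans ?_ (hpow X Z)
        gcongr
        exact hWM Z
      have hk : expKer (2 * s) Z Y * expKer s Y X ≤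
          expKer ((1 - q) * s) Z X * expKer (q * s) Z X := by
        rw [expKer_mul]
        calc _ ≤ expKer s Z Y * expKer s Y X := by
              gcongr
              exact expKer_anti (by linarith) _ _
          _ ≤ expKer s Z X := expKer_mul_le hs.le _ _ _
          _ = _ := by congr 1; ring
      calc expKer (2 * s) Z Y * W Z * expKer s Y X
          = (expKer (2 * s) Z Y * expKer s Y X) * W Z := by ring
        _ ≤ (expKer ((1 - q) * s) Z X * expKer (q * s) Z X) * W Z := by gcongr
        _ = (expKer ((1 - q) * s) Z X * expKer (q * s) Z X) * (W Z ^ (1 - q) * W Z ^ q) := by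
            rw [← hsplit _ (ne_top_of_le_ne_top (hM0 Z) (hWM Z))]
        _ = (W Z ^ (1 - q) * expKer ((1 - q) * s) Z X) * (expKer (q * s) Z X * W Z ^ q) := by ring
        _ ≤ _ := by gcongr
    calc W Y * expKer s Y X ≤ (A * ∫⁻ Z, expKer (2 * s) Z Y * W Z ∂μ) * expKer s Y X := by
          gcongr
          exact hrep Y
      _ = A * ∫⁻ Z, expKer (2 * s) Z Y * W Z * expKer s Y X ∂μ := by
          rw [mul_assoc, lintegral_mul_const' _ _ (expKer_ne_top _ _ _)]
      _ ≤ A * ∫⁻ Z, M X ^ (1 - q) * (expKer (q * s) Z X * W Z ^ q) ∂μ := by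
          exact mul_le_mul_right (lintegral_mono h1) A
      _ = _ := by
          rw [lintegral_const_mul' _ _ (ENNReal.rpow_ne_top_of_nonneg (by linarith) (hM0 X))]
  -- Take the supremum over `Y`. As `M X` is finite, `M(X)^{1-q}` can be cancelled when it is
  -- nonzero, which leaves `W^q ≤ M^q ≤ A T`.
  have hMX : M X ≤ M X ^ (1 - q) * (A * T) := by
    refine (iSup_le hWY).trans_eq ?_
    ring
  rcases eq_or_ne (M X) 0 with h0 | h0
  · have : W X = 0 := le_antisymm ((hWM X).trans_eq h0) bot_le
    rw [this, ENNReal.zero_rpow_of_pos hq0]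
    exact bot_le
  refine (ENNReal.rpow_le_rpow (hWM X) hq0.le).trans ?_
  have h2 : M X ^ (1 - q) * M X ^ q ≤ M X ^ (1 - q) * (A * T) := by
    rwa [← hsplit _ (hM0 X)]
  refine (ENNReal.mul_le_mul_iff_right ?_ ?_).1 h2
  · exact (ENNReal.rpow_pos (pos_iff_ne_zero.2 h0) (hM0 X)).ne'
  · exact ENNReal.rpow_ne_top_of_nonneg (by linarith) (hM0 X)

/-- If `‖X‖ > R`, then either `‖Z‖ > R/2` or `‖Z - X‖ ≥ R/2`. -/
theorem expKer_le_of_norm {a R : ℝ} (ha : 0 ≤ a) {X Z : E} (hX : R < ‖X‖) :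
    expKer a Z X ≤ {Z | R / 2 < ‖Z‖}.indicator 1 Z + ENNReal.ofReal (Real.exp (-(a * (R / 2)))) := by
  by_cases hZ : R / 2 < ‖Z‖
  · rw [Set.indicator_of_mem (by exact hZ), Pi.one_apply]
    refine le_add_of_le_left ?_
    rw [expKer, ENNReal.ofReal_le_one, Real.exp_le_one_iff, neg_nonpos]
    positivity
  · refine le_add_of_le_right (ENNReal.ofReal_le_ofReal (Real.exp_le_exp.2 ?_))
    have := norm_sub_norm_le X Z
    rw [norm_sub_rev] at this
    rw [neg_le_neg_iff]
    gcongr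
    linarith

variable [MeasurableSpace E]

/-- The integral `∫ e^{-r|X|} dX`. -/
def expMass (μ : Measure E) (r : ℝ) : ℝ≥0∞ := ∫⁻ X, expKer r X 0 ∂μ

variable [BorelSpace E]

theorem lintegral_expKer (μ : Measure E) [μ.IsAddHaarMeasure] (r : ℝ) (Y : E) :
    ∫⁻ X, expKer r X Y ∂μ = expMass μ r := by
  have := lintegral_sub_right_eq_self (μ := μ) (fun X => expKer r X 0) Y
  rw [expMass, ← this]
  simp [expKer]

theorem measurable_expKer_left (r : ℝ) (Y : E) : Measurable fun X => expKer r X Y :=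
  ((continuous_expKer r).comp (continuous_id.prodMk continuous_const)).measurable

theorem lintegral_expKer_mul_const (μ : Measure E) [μ.IsAddHaarMeasure] (r : ℝ) (Y : E)
    (c : ℝ≥0∞) : ∫⁻ X, expKer r X Y * c ∂μ = expMass μ r * c := by
  rw [lintegral_mul_const c (measurable_expKer_left r Y), lintegral_expKer]

theorem lintegral_expKer_mul_const' (μ : Measure E) [μ.IsAddHaarMeasure] (r : ℝ) (Y : E)
    (c : ℝ≥0∞) : ∫⁻ X, expKer r Y X * c ∂μ = expMass μ r * c := by
  simp only [expKer_comm r Y]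
  exact lintegral_expKer_mul_const μ r Y c

/-- The tail integral against an exponential kernel is controlled by the `q`-th powers. -/
theorem rpow_lintegral_compl_ball_le {μ : Measure E} [μ.IsAddHaarMeasure] {W : E → ℝ≥0∞}
    {q a : ℝ} (hq : 0 < q) (ha : 0 < a) {B : ℝ≥0∞}
    (hsub : ∀ Y, W Y ^ q ≤ B * ∫⁻ X, expKer a X Y * W X ^ q ∂μ) (R : ℝ) (Y : E) :
    (∫⁻ X in (Metric.closedBall 0 R)ᶜ, expKer (2 * (a / q)) X Y * W X ∂μ) ^ q ≤
      B * expMass μ (a / q) ^ q * ∫⁻ Z, expKer (a / 2) Z Y *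
        ({Z | R / 2 < ‖Z‖}.indicator 1 Z + ENNReal.ofReal (Real.exp (-(a / 2 * (R / 2))))) *
          W Z ^ q ∂μ := by
  set S := ∫⁻ Z, expKer (a / 2) Z Y * ({Z | R / 2 < ‖Z‖}.indicator 1 Z +
    ENNReal.ofReal (Real.exp (-(a / 2 * (R / 2))))) * W Z ^ q ∂μ with hS
  -- One half of `e^{-a‖Z-X‖}` combines with the kernel in `X, Y` into a kernel in `Z, Y`; the other
  -- half forces `Z` to be far out or pays `e^{-aR/4}`. The bound is uniform in `X`.
  have h1 : ∀ X ∈ (Metric.closedBall (0 : E) R)ᶜ,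
      W X * expKer (a / q) X Y ≤ (B * S) ^ (1 / q) := fun X hX => by
    have hX' : R < ‖X‖ := by simpa using hX
    rw [one_div, ENNReal.le_rpow_inv_iff hq, ENNReal.mul_rpow_of_nonneg _ _ hq.le, expKer_rpow,
      mul_div_cancel₀ a hq.ne']
    calc W X ^ q * expKer a X Y ≤ (B * ∫⁻ Z, expKer a Z X * W Z ^ q ∂μ) * expKer a X Y := by
          gcongr
          exact hsub X
      _ = B * ∫⁻ Z, expKer a Z X * W Z ^ q * expKer a X Y ∂μ := by
          rw [mul_assoc, lintegral_mul_const' _ _ (expKer_ne_top _ _ _)]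
      _ ≤ B * S := by
          refine mul_le_mul_right (lintegral_mono fun Z => ?_) B
          have e : expKer a Z X = expKer (a / 2) Z X * expKer (a / 2) Z X := by
            rw [expKer_mul]; congr 1; ring
          calc expKer a Z X * W Z ^ q * expKer a X Y
              ≤ expKer (a / 2) Z X * expKer (a / 2) Z X * W Z ^ q * expKer (a / 2) X Y := by
                rw [e]
                gcongr
                exact expKer_anti (by linarith) _ _
            _ = (expKer (a / 2) Z X * expKer (a / 2) X Y) * expKer (a / 2) Z X * W Z ^ q := by ring
            _ ≤ _ := by
                gcongr
                · exact expKer_mul_le (by positivity) _ _ _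
                · exact expKer_le_of_norm (by positivity) hX'
  -- Of the rate `2a/q`, one share `a/q` was used in `h1`; the other makes the integral over `X`
  -- converge.
  have h2 : ∫⁻ X in (Metric.closedBall 0 R)ᶜ, expKer (2 * (a / q)) X Y * W X ∂μ ≤
      expMass μ (a / q) * (B * S) ^ (1 / q) := by
    calc _ ≤ ∫⁻ X in (Metric.closedBall 0 R)ᶜ, expKer (a / q) X Y * (B * S) ^ (1 / q) ∂μ := by
          refine setLIntegral_mono' Metric.isClosed_closedBall.measurableSet.compl fun X hX => ?_
          rw [two_mul, ← expKer_mul, mul_assoc, mul_comm _ (W X)]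
          gcongr
          exact h1 X hX
      _ ≤ ∫⁻ X, expKer (a / q) X Y * (B * S) ^ (1 / q) ∂μ := setLIntegral_le_lintegral _ _
      _ = _ := lintegral_expKer_mul_const μ _ Y _
  calc _ ≤ (expMass μ (a / q) * (B * S) ^ (1 / q)) ^ q := ENNReal.rpow_le_rpow h2 hq.le
    _ = _ := by
      rw [ENNReal.mul_rpow_of_nonneg _ _ hq.le, ← ENNReal.rpow_mul, one_div,
        inv_mul_cancel₀ hq.ne', ENNReal.rpow_one]
      ring

variable [NormedSpace ℝ E] [FiniteDimensional ℝ E]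

theorem expMass_ne_top (μ : Measure E) [μ.IsAddHaarMeasure] {r : ℝ} (hr : 0 < r) :
    expMass μ r ≠ ⊤ := by
  have := (integrable_exp_neg_mul_norm μ hr).lintegral_lt_top
  simpa [expMass, expKer] using this.ne

/-- Hölder's inequality, with the kernel split into its powers `1/q'` and `1/q`. -/
theorem rpow_le_lintegral_of_one_lt {μ : Measure E} [μ.IsAddHaarMeasure] {W : E → ℝ≥0∞}
    (hW : Measurable W)
    (hrep : ∀ r : ℝ, 0 < r → ∃ A : ℝ≥0∞, A ≠ ⊤ ∧ ∀ Y, W Y ≤ A * ∫⁻ X, expKer r X Y * W X ∂μ)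
    {q : ℝ} (hq : 1 < q) :
    ∃ a : ℝ, 0 < a ∧ ∃ B : ℝ≥0∞, B ≠ ⊤ ∧
      ∀ Y, W Y ^ q ≤ B * ∫⁻ X, expKer a X Y * W X ^ q ∂μ := by
  obtain ⟨A, hA, hrep⟩ := hrep 1 one_pos
  have hq0 : 0 < q := by linarith
  have hpq : q.conjExponent.HolderConjugate q := (Real.HolderConjugate.conjExponent hq).symm
  refine ⟨1, one_pos, (A * expMass μ 1 ^ (1 / q.conjExponent)) ^ q,
    ENNReal.rpow_ne_top_of_nonneg hq0.le (ENNReal.mul_ne_top hA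
      (ENNReal.rpow_ne_top_of_nonneg hpq.one_div_nonneg (expMass_ne_top μ one_pos))), fun Y => ?_⟩
  have hk := measurable_expKer_left 1 Y
  have h1 := ENNReal.lintegral_mul_le_Lp_mul_Lq μ hpq
    (f := fun X => expKer 1 X Y ^ (1 / q.conjExponent))
    (g := fun X => expKer 1 X Y ^ (1 / q) * W X)
    (hk.pow_const _).aemeasurable ((hk.pow_const _).mul hW).aemeasurable
  have e1 : ∀ X, (expKer 1 X Y ^ (1 / q.conjExponent)) ^ q.conjExponent = expKer 1 X Y := fun X => by
    rw [← ENNReal.rpow_mul, one_div, inv_mul_cancel₀ hpq.ne_zero, ENNReal.rpow_one]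
  have e2 : ∀ X, (expKer 1 X Y ^ (1 / q) * W X) ^ q = expKer 1 X Y * W X ^ q := fun X => by
    rw [ENNReal.mul_rpow_of_nonneg _ _ hq0.le, ← ENNReal.rpow_mul, one_div,
      inv_mul_cancel₀ hq0.ne', ENNReal.rpow_one]
  have e3 : ∀ X, ((fun X => expKer 1 X Y ^ (1 / q.conjExponent)) *
      (fun X => expKer 1 X Y ^ (1 / q) * W X)) X = expKer 1 X Y * W X := fun X => by
    rw [Pi.mul_apply, ← mul_assoc,
      ← ENNReal.rpow_add _ _ (expKer_pos _ _ _).ne' (expKer_ne_top _ _ _)]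
    have := hpq.inv_add_inv_eq_one
    rw [one_div, one_div, this, ENNReal.rpow_one]
  simp only [e1, e2, e3, lintegral_expKer] at h1
  calc W Y ^ q ≤ (A * (expMass μ 1 ^ (1 / q.conjExponent) *
        (∫⁻ X, expKer 1 X Y * W X ^ q ∂μ) ^ (1 / q))) ^ q := by
        refine ENNReal.rpow_le_rpow ((hrep Y).trans ?_) hq0.le
        gcongr
    _ = _ := by
        rw [← mul_assoc, ENNReal.mul_rpow_of_nonneg _ _ hq0.le, ← ENNReal.rpow_mul, one_div q,
          inv_mul_cancel₀ hq0.ne', ENNReal.rpow_one]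

theorem rpow_le_lintegral {μ : Measure E} [μ.IsAddHaarMeasure] {W : E → ℝ≥0∞}
    (hW : Measurable W)
    (hrep : ∀ r : ℝ, 0 < r → ∃ A : ℝ≥0∞, A ≠ ⊤ ∧ ∀ Y, W Y ≤ A * ∫⁻ X, expKer r X Y * W X ∂μ)
    {s₀ : ℝ} (hs₀ : 0 ≤ s₀) {C : ℝ≥0∞} (hC : C ≠ ⊤)
    (hgrow : ∀ X, W X * expKer s₀ X 0 ≤ C) {q : ℝ} (hq0 : 0 < q) :
    ∃ a : ℝ, 0 < a ∧ ∃ B : ℝ≥0∞, B ≠ ⊤ ∧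
      ∀ Y, W Y ^ q ≤ B * ∫⁻ X, expKer a X Y * W X ^ q ∂μ := by
  rcases le_or_gt q 1 with h | h
  · exact rpow_le_lintegral_of_le_one hrep hs₀ hC hgrow hq0 h
  · exact rpow_le_lintegral_of_one_lt hW hrep h

end ExpKernel

theorem tendsto_setLIntegral_norm_gt {α : Type*} [MeasurableSpace α] {μ : Measure α}
    {G : α → ℝ≥0∞} (hG : Measurable G) (hfin : ∫⁻ x, G x ∂μ ≠ ⊤) {N : α → ℝ} (hN : Measurable N) :
    Tendsto (fun R : ℝ => ∫⁻ x in {x | R < N x}, G x ∂μ) atTop (𝓝 0) := by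
  have hms : ∀ R : ℝ, MeasurableSet {x | R < N x} := fun R => measurableSet_lt measurable_const hN
  simp only [← lintegral_indicator (hms _)]
  have := tendsto_lintegral_filter_of_dominated_convergence (μ := μ) (l := (atTop : Filter ℝ))
    (F := fun R x => {x | R < N x}.indicator G x) (f := fun _ => 0) G
    (.of_forall fun R => hG.indicator (hms R))
    (.of_forall fun R => .of_forall fun x => Set.indicator_le_self _ _ x) hfin
    (.of_forall fun x => by
      refine tendsto_const_nhds.congr' ?_
      filter_upwards [eventually_ge_atTop (N x)] with R hR
      rw [Set.indicator_of_notMem]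
      simpa using hR)
  simpa using this


/-! ### Mixed norm estimates -/

section MixedNorm

variable {d : ℕ}

/-- The product norm is a maximum, hence at least the mean of the two component norms. -/
theorem expKer_prod_le {c : ℝ} (hc : 0 ≤ c) (Z X : Eucl d × Eucl d) :
    expKer c Z X ≤ expKer (c / 2) Z.1 X.1 * expKer (c / 2) Z.2 X.2 := by
  rw [expKer, expKer, expKer, ← ENNReal.ofReal_mul (Real.exp_pos _).le, ← Real.exp_add]
  refine ENNReal.ofReal_le_ofReal (Real.exp_le_exp.2 ?_)
  have h1 : ‖Z.1 - X.1‖ ≤ ‖Z - X‖ := norm_fst_le (Z - X)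
  have h2 : ‖Z.2 - X.2‖ ≤ ‖Z - X‖ := norm_snd_le (Z - X)
  nlinarith [mul_le_mul_of_nonneg_left h1 hc, mul_le_mul_of_nonneg_left h2 hc]

/-- The supremum may be uncountable, but a supremum of continuous functions is lower semicontinuous.
-/
theorem measurable_biSup_slice {G : Eucl d × Eucl d → ℝ≥0∞} (hG : Continuous G) (S : Set (Eucl d)) :
    Measurable fun η => ⨆ z ∈ S, G (z, η) :=
  (lowerSemicontinuous_biSup fun z _ =>
    (hG.comp (Continuous.prodMk_right z)).lowerSemicontinuous).measurable

/-- The convolution in `ξ` of an exponential kernel and the supremum over `S` in `x`. -/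
def sliceConv (c : ℝ) (S T : Set (Eucl d)) (G : Eucl d × Eucl d → ℝ≥0∞) (ξ : Eucl d) : ℝ≥0∞ :=
  ∫⁻ η in T, expMass (volume : Measure (Eucl d)) c * (expKer c η ξ * ⨆ z ∈ S, G (z, η))

theorem lintegral_expKer_mul_le_sliceConv {G : Eucl d × Eucl d → ℝ≥0∞} (hG : Continuous G) {c : ℝ}
    (hc : 0 < c) {S T : Set (Eucl d)} (hS : MeasurableSet S) (x ξ : Eucl d) :
    ∫⁻ Z in S ×ˢ T, expKer c Z (x, ξ) * G Z ≤ sliceConv (c / 2) S T G ξ := by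
  rw [Measure.volume_eq_prod, ← Measure.prod_restrict, lintegral_prod_symm]
  · refine lintegral_mono fun η => ?_
    calc ∫⁻ z in S, expKer c (z, η) (x, ξ) * G (z, η)
        ≤ ∫⁻ z in S, expKer (c / 2) z x * (expKer (c / 2) η ξ * ⨆ z ∈ S, G (z, η)) := by
          refine setLIntegral_mono' hS fun z hz => ?_
          rw [← mul_assoc]
          gcongr
          · exact expKer_prod_le hc.le (z, η) (x, ξ)
          · exact le_biSup (fun z => G (z, η)) hz
      _ ≤ ∫⁻ z, expKer (c / 2) z x * (expKer (c / 2) η ξ * ⨆ z ∈ S, G (z, η)) :=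
          setLIntegral_le_lintegral _ _
      _ = _ := lintegral_expKer_mul_const _ _ _ _
  · exact ((measurable_expKer_left c (x, ξ)).mul hG.measurable).aemeasurable

theorem measurable_sliceConv_integrand {G : Eucl d × Eucl d → ℝ≥0∞} (hG : Continuous G) (c : ℝ)
    (S : Set (Eucl d)) : Measurable fun p : Eucl d × Eucl d =>
      expMass (volume : Measure (Eucl d)) c * (expKer c p.2 p.1 * ⨆ z ∈ S, G (z, p.2)) := by
  have h1 : Measurable fun p : Eucl d × Eucl d => expKer c p.2 p.1 :=
    ((continuous_expKer c).comp (continuous_snd.prodMk continuous_fst)).measurable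
  have h2 : Measurable fun p : Eucl d × Eucl d => ⨆ z ∈ S, G (z, p.2) :=
    (measurable_biSup_slice hG S).comp measurable_snd
  exact measurable_const.mul (h1.mul h2)

theorem measurable_sliceConv {G : Eucl d × Eucl d → ℝ≥0∞} (hG : Continuous G) (c : ℝ)
    (S T : Set (Eucl d)) : Measurable (sliceConv c S T G) :=
  (measurable_sliceConv_integrand hG c S).lintegral_prod_right'

theorem lintegral_sliceConv {G : Eucl d × Eucl d → ℝ≥0∞} (hG : Continuous G) {c : ℝ} (hc : 0 < c)
    (S T : Set (Eucl d)) :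
    ∫⁻ ξ, sliceConv c S T G ξ =
      expMass (volume : Measure (Eucl d)) c * expMass (volume : Measure (Eucl d)) c *
        ∫⁻ η in T, ⨆ z ∈ S, G (z, η) := by
  have hK : expMass (volume : Measure (Eucl d)) c ≠ ⊤ := expMass_ne_top _ hc
  unfold sliceConv
  rw [lintegral_lintegral_swap (measurable_sliceConv_integrand hG c S).aemeasurable,
    ← lintegral_const_mul' _ _ (ENNReal.mul_ne_top hK hK)]
  refine lintegral_congr fun η => ?_
  rw [lintegral_const_mul' _ _ hK, lintegral_expKer_mul_const', mul_assoc]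

/-- For `‖x‖ > R` the kernel is bounded independently of `x`, using only the first component of `Z`.
This removes the supremum, and Tonelli's theorem evaluates the remaining integral in `ξ`. -/
theorem lintegral_iSup_tail_expKer_le {G : Eucl d × Eucl d → ℝ≥0∞} (hG : Measurable G) {c : ℝ}
    (hc : 0 < c) (R : ℝ) :
    ∫⁻ ξ, ⨆ x ∈ {x : Eucl d | R < ‖x‖}, ∫⁻ Z, expKer c Z (x, ξ) * G Z ≤
      expMass (volume : Measure (Eucl d)) (c / 2) *
        ((∫⁻ Z in {Z : Eucl d × Eucl d | R / 2 < ‖Z.1‖}, G Z) +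
          ENNReal.ofReal (Real.exp (-(c / 2 * (R / 2)))) * ∫⁻ Z, G Z) := by
  set K := expMass (volume : Measure (Eucl d)) (c / 2) with hK
  set e := ENNReal.ofReal (Real.exp (-(c / 2 * (R / 2)))) with he
  set S : Set (Eucl d × Eucl d) := {Z | R / 2 < ‖Z.1‖} with hSdef
  have hS : MeasurableSet S := measurableSet_lt measurable_const measurable_fst.norm
  have hk : Measurable fun p : Eucl d × Eucl d => expKer (c / 2) p.1 p.2 :=
    (continuous_expKer (c / 2)).measurable
  set G' : Eucl d × Eucl d → ℝ≥0∞ := fun Z => S.indicator G Z + e * G Z with hG'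
  have hG'm : Measurable G' := (hG.indicator hS).add (measurable_const.mul hG)
  have h1 : ∀ ξ, ∀ x ∈ {x : Eucl d | R < ‖x‖}, ∫⁻ Z, expKer c Z (x, ξ) * G Z ≤
      ∫⁻ Z, expKer (c / 2) Z.2 ξ * G' Z := fun ξ x hx => by
    refine lintegral_mono fun Z => ?_
    have h2 := expKer_le_of_norm (a := c / 2) (by positivity) (X := x) (Z := Z.1) hx
    have h3 : ({z : Eucl d | R / 2 < ‖z‖}.indicator 1 Z.1 + e) * G Z = G' Z := by
      rw [hG', add_mul]
      congr 1
      by_cases hZ : R / 2 < ‖Z.1‖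
      · rw [Set.indicator_of_mem (by exact hZ), Set.indicator_of_mem (by exact hZ)]
        simp
      · rw [Set.indicator_of_notMem (by exact hZ), Set.indicator_of_notMem (by exact hZ), zero_mul]
    rw [← h3, ← mul_assoc]
    gcongr
    refine (expKer_prod_le hc.le Z (x, ξ)).trans ?_
    rw [mul_comm]
    gcongr
  calc _ ≤ ∫⁻ ξ, ∫⁻ Z, expKer (c / 2) Z.2 ξ * G' Z :=
        lintegral_mono fun ξ => iSup₂_le (h1 ξ)
    _ = ∫⁻ Z, ∫⁻ ξ, expKer (c / 2) Z.2 ξ * G' Z := by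
        refine lintegral_lintegral_swap (Measurable.aemeasurable ?_)
        exact (hk.comp ((measurable_snd.comp measurable_snd).prodMk measurable_fst)).mul
          (hG'm.comp measurable_snd)
    _ = ∫⁻ Z, K * G' Z := by
        refine lintegral_congr fun Z => ?_
        exact lintegral_expKer_mul_const' volume (c / 2) Z.2 (G' Z)
    _ = _ := by
        rw [lintegral_const_mul _ hG'm, hG', lintegral_add_left (hG.indicator hS),
          lintegral_indicator hS, lintegral_const_mul _ hG]

/-! ### Mixed norms as integrals of pointwise suprema -/

theorem eLpNorm_top_restrict_le {g : Eucl d → ℂ} {S : Set (Eucl d)} (hS : MeasurableSet S) :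
    eLpNorm g ⊤ (volume.restrict S) ≤ ⨆ x ∈ S, ‖g x‖ₑ := by
  rw [eLpNorm_exponent_top]
  refine eLpNormEssSup_le_of_ae_enorm_bound ?_
  filter_upwards [ae_restrict_mem hS] with x hx
  exact le_biSup (fun x => ‖g x‖ₑ) hx

/-- For a continuous function a value exceeding the essential supremum would be exceeded on a
nonempty open set, which has positive measure. -/
theorem le_eLpNorm_top_restrict {g : Eucl d → ℂ} (hg : Continuous g) {S U : Set (Eucl d)}
    (hU : IsOpen U) (hUS : U ⊆ S) :
    ⨆ x ∈ U, ‖g x‖ₑ ≤ eLpNorm g ⊤ (volume.restrict S) := by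
  refine iSup₂_le fun x hx => ?_
  by_contra! hlt
  rw [eLpNorm_exponent_top] at hlt
  set e := eLpNormEssSup g (volume.restrict S) with he
  have hV : IsOpen (U ∩ {y | e < ‖g y‖ₑ}) :=
    hU.inter (isOpen_lt continuous_const hg.enorm)
  have hpos := hV.measure_pos volume ⟨x, hx, hlt⟩
  have hae : ∀ᵐ y ∂(volume.restrict S), ‖g y‖ₑ ≤ e := enorm_ae_le_eLpNormEssSup g _
  rw [ae_iff] at hae
  have h0 : volume.restrict S (U ∩ {y | e < ‖g y‖ₑ}) = 0 := by
    refine measure_mono_null (fun y hy => ?_) hae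
    simpa using hy.2
  rw [Measure.restrict_apply hV.measurableSet,
    Set.inter_eq_self_of_subset_left (Set.inter_subset_left.trans hUS)] at h0
  exact hpos.ne' h0

theorem mixedNormOn_eq (S : Set (Eucl d)) (p : ℝ≥0∞) {q : ℝ≥0∞} (hq0 : 0 < q) (hq : q < ⊤)
    (ω : Eucl d × Eucl d → ℝ) (F : Eucl d × Eucl d → ℂ) :
    mixedNormOn S p q ω F = (∫⁻ ξ, eLpNorm (fun x => F (x, ξ) * (ω (x, ξ) : ℂ)) p
      (volume.restrict S) ^ q.toReal) ^ (1 / q.toReal) := by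
  rw [mixedNormOn, eLpNorm_eq_lintegral_rpow_enorm_toReal hq0.ne' hq.ne]
  simp

theorem mixedNormOn_top_rpow_le {S : Set (Eucl d)} (hS : MeasurableSet S) {q : ℝ≥0∞} (hq0 : 0 < q)
    (hq : q < ⊤) (ω : Eucl d × Eucl d → ℝ) (F : Eucl d × Eucl d → ℂ) :
    mixedNormOn S ⊤ q ω F ^ q.toReal ≤
      ∫⁻ ξ, ⨆ x ∈ S, ‖F (x, ξ) * (ω (x, ξ) : ℂ)‖ₑ ^ q.toReal := by
  have hqr : 0 < q.toReal := ENNReal.toReal_pos hq0.ne' hq.ne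
  rw [mixedNormOn_eq S ⊤ hq0 hq, ← ENNReal.rpow_mul, one_div, inv_mul_cancel₀ hqr.ne',
    ENNReal.rpow_one]
  refine lintegral_mono fun ξ => ?_
  rw [← ENNReal.le_rpow_inv_iff hqr]
  refine (eLpNorm_top_restrict_le hS).trans (iSup₂_le fun x hx => ?_)
  rw [ENNReal.le_rpow_inv_iff hqr]
  exact le_biSup (fun x => ‖F (x, ξ) * (ω (x, ξ) : ℂ)‖ₑ ^ q.toReal) hx

theorem le_mixedNormOn_top_rpow {S U : Set (Eucl d)} (hU : IsOpen U) (hUS : U ⊆ S) {q : ℝ≥0∞}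
    (hq0 : 0 < q) (hq : q < ⊤) {ω : Eucl d × Eucl d → ℝ} (hω : Continuous ω)
    {F : Eucl d × Eucl d → ℂ} (hF : Continuous F) :
    ∫⁻ ξ, ⨆ x ∈ U, ‖F (x, ξ) * (ω (x, ξ) : ℂ)‖ₑ ^ q.toReal ≤
      mixedNormOn S ⊤ q ω F ^ q.toReal := by
  have hqr : 0 < q.toReal := ENNReal.toReal_pos hq0.ne' hq.ne
  rw [mixedNormOn_eq S ⊤ hq0 hq, ← ENNReal.rpow_mul, one_div, inv_mul_cancel₀ hqr.ne',
    ENNReal.rpow_one]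
  refine lintegral_mono fun ξ => iSup₂_le fun x hx => ?_
  gcongr
  refine le_trans ?_ (le_eLpNorm_top_restrict ?_ hU hUS)
  · exact le_biSup (fun x => ‖F (x, ξ) * (ω (x, ξ) : ℂ)‖ₑ) hx
  · fun_prop

theorem mixedNormOn_univ_rpow {q : ℝ≥0∞} (hq0 : 0 < q) (hq : q < ⊤) {ω : Eucl d × Eucl d → ℝ}
    (hω : Continuous ω) {F : Eucl d × Eucl d → ℂ} (hF : Continuous F) :
    mixedNormOn Set.univ q q ω F ^ q.toReal = ∫⁻ Z, ‖F Z * (ω Z : ℂ)‖ₑ ^ q.toReal := by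
  have hqr : 0 < q.toReal := ENNReal.toReal_pos hq0.ne' hq.ne
  rw [mixedNormOn_eq _ q hq0 hq, ← ENNReal.rpow_mul, one_div, inv_mul_cancel₀ hqr.ne',
    ENNReal.rpow_one, Measure.volume_eq_prod, lintegral_prod_symm]
  · refine lintegral_congr fun ξ => ?_
    rw [eLpNorm_eq_lintegral_rpow_enorm_toReal hq0.ne' hq.ne, ← ENNReal.rpow_mul, one_div,
      inv_mul_cancel₀ hqr.ne', ENNReal.rpow_one, Measure.restrict_univ]
  · have : Continuous fun Z => F Z * (ω Z : ℂ) := by fun_prop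
    exact (this.enorm.measurable.pow_const _).aemeasurable

/-- The far region `‖Z‖ > R/2` is covered by the points far out in `x` and those far out in `ξ`.
With the exponentially small full integral this gives three terms, each a convolution in `ξ` alone
once `W^q` is replaced by its supremum in `x`. -/
theorem lintegral_iSup_rpow_compl_ball_le {W : Eucl d × Eucl d → ℝ≥0∞} (hW : Continuous W)
    {q a : ℝ} (hq : 0 < q) (ha : 0 < a) {B : ℝ≥0∞} (hB : B ≠ ⊤)
    (hsub : ∀ Y, W Y ^ q ≤ B * ∫⁻ X, expKer a X Y * W X ^ q) (R : ℝ) :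
    ∫⁻ ξ, ⨆ x, (∫⁻ X in (Metric.closedBall 0 R)ᶜ, expKer (2 * (a / q)) X (x, ξ) * W X) ^ q ≤
      B * expMass (volume : Measure (Eucl d × Eucl d)) (a / q) ^ q *
        (expMass (volume : Measure (Eucl d)) (a / 2 / 2) *
          expMass (volume : Measure (Eucl d)) (a / 2 / 2) *
          ((∫⁻ η, ⨆ z ∈ {z | R / 2 < ‖z‖}, W (z, η) ^ q) +
            (∫⁻ η in {η | R / 2 < ‖η‖}, ⨆ z ∈ Set.univ, W (z, η) ^ q) +
            ENNReal.ofReal (Real.exp (-(a / 2 * (R / 2)))) *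
              ∫⁻ η, ⨆ z ∈ Set.univ, W (z, η) ^ q)) := by
  set c := B * expMass (volume : Measure (Eucl d × Eucl d)) (a / q) ^ q with hc
  have hct : c ≠ ⊤ := ENNReal.mul_ne_top hB
    (ENNReal.rpow_ne_top_of_nonneg hq.le (expMass_ne_top _ (by positivity)))
  set e := ENNReal.ofReal (Real.exp (-(a / 2 * (R / 2)))) with he
  have het : e ≠ ⊤ := ENNReal.ofReal_ne_top
  have hG : Continuous fun Z => W Z ^ q := ENNReal.continuous_rpow_const.comp hW
  set G : Eucl d × Eucl d → ℝ≥0∞ := fun Z => W Z ^ q with hGdef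
  set S : Set (Eucl d) := {z | R / 2 < ‖z‖} with hS
  have hSm : MeasurableSet S := measurableSet_lt measurable_const measurable_norm
  have hpt : ∀ ξ x,
      (∫⁻ X in (Metric.closedBall 0 R)ᶜ, expKer (2 * (a / q)) X (x, ξ) * W X) ^ q ≤
      c * (sliceConv (a / 2 / 2) S Set.univ G ξ + sliceConv (a / 2 / 2) Set.univ S G ξ +
        e * sliceConv (a / 2 / 2) Set.univ Set.univ G ξ) := by
    intro ξ x
    have hk : Measurable fun Z => expKer (a / 2) Z (x, ξ) * G Z :=
      (measurable_expKer_left _ _).mul hG.measurable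
    have hm1 : MeasurableSet (S ×ˢ (Set.univ : Set (Eucl d))) := hSm.prod MeasurableSet.univ
    have hm2 : MeasurableSet ((Set.univ : Set (Eucl d)) ×ˢ S) := MeasurableSet.univ.prod hSm
    have hm12 : Measurable fun Z =>
        (S ×ˢ (Set.univ : Set (Eucl d))).indicator (fun Z => expKer (a / 2) Z (x, ξ) * G Z) Z +
        ((Set.univ : Set (Eucl d)) ×ˢ S).indicator (fun Z => expKer (a / 2) Z (x, ξ) * G Z) Z :=
      (hk.indicator hm1).add (hk.indicator hm2)
    refine (rpow_lintegral_compl_ball_le hq ha hsub R (x, ξ)).trans ?_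
    refine mul_le_mul_right ?_ c
    calc _ ≤ ∫⁻ Z, ((S ×ˢ Set.univ).indicator (fun Z => expKer (a / 2) Z (x, ξ) * G Z) Z +
          (Set.univ ×ˢ S).indicator (fun Z => expKer (a / 2) Z (x, ξ) * G Z) Z) +
          e * (expKer (a / 2) Z (x, ξ) * G Z) := by
          refine lintegral_mono fun Z => ?_
          rw [show ∀ α β γ δ : ℝ≥0∞, α * (β + γ) * δ = β * (α * δ) + γ * (α * δ) by
            intros; ring]
          refine add_le_add ?_ le_rfl
          by_cases hZ : R / 2 < ‖Z‖
          · rw [Set.indicator_of_mem (by exact hZ), Pi.one_apply, one_mul]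
            rw [Prod.norm_def, lt_max_iff] at hZ
            rcases hZ with hZ | hZ
            · refine le_add_of_le_left (le_of_eq ?_)
              rw [Set.indicator_of_mem]
              exact ⟨hZ, Set.mem_univ _⟩
            · refine le_add_of_le_right (le_of_eq ?_)
              rw [Set.indicator_of_mem]
              exact ⟨Set.mem_univ _, hZ⟩
          · rw [Set.indicator_of_notMem (by exact hZ), zero_mul]
            exact bot_le
      _ = (∫⁻ Z in S ×ˢ Set.univ, expKer (a / 2) Z (x, ξ) * G Z) +
          (∫⁻ Z in Set.univ ×ˢ S, expKer (a / 2) Z (x, ξ) * G Z) +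
          e * ∫⁻ Z in Set.univ ×ˢ Set.univ, expKer (a / 2) Z (x, ξ) * G Z := by
          rw [lintegral_add_left hm12,
            lintegral_add_left (hk.indicator hm1), lintegral_indicator hm1,
            lintegral_indicator hm2, lintegral_const_mul' _ _ het, Set.univ_prod_univ,
            setLIntegral_univ]
      _ ≤ _ :=
          add_le_add (add_le_add
            (lintegral_expKer_mul_le_sliceConv hG (half_pos ha) hSm x ξ)
            (lintegral_expKer_mul_le_sliceConv hG (half_pos ha) MeasurableSet.univ x ξ))
            (mul_le_mul_right
              (lintegral_expKer_mul_le_sliceConv hG (half_pos ha) MeasurableSet.univ x ξ) e)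
  refine (lintegral_mono fun ξ => iSup_le (hpt ξ)).trans (le_of_eq ?_)
  have hc2 : 0 < a / 2 / 2 := by positivity
  have hm12 : Measurable fun ξ => sliceConv (a / 2 / 2) S Set.univ G ξ +
      sliceConv (a / 2 / 2) Set.univ S G ξ :=
    (measurable_sliceConv hG _ _ _).add (measurable_sliceConv hG _ _ _)
  rw [lintegral_const_mul' _ _ hct, lintegral_add_left hm12,
    lintegral_add_left (measurable_sliceConv hG _ _ _), lintegral_const_mul' _ _ het,
    lintegral_sliceConv hG hc2, lintegral_sliceConv hG hc2, lintegral_sliceConv hG hc2,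
    setLIntegral_univ, setLIntegral_univ]
  ring

end MixedNorm

/-! ### Density of `Σ_1` for continuous moderate weights -/

section ContinuousWeight

variable {d : ℕ}

theorem continuous_stft (φ : GelfandShilov d) (f : GelfandShilovDual d) : Continuous (stft φ f) :=
  continuous_const.mul (f.continuous_conjTimeFreqShift φ)

/-- A continuous positive weight with exponential moderation. -/
structure IsExpModerate (ω : Eucl d × Eucl d → ℝ) (C s : ℝ) : Prop where
  continuous : Continuous ω
  pos : ∀ X, 0 < ω X
  const_nonneg : 0 ≤ C
  rate_nonneg : 0 ≤ s
  le : ∀ X Y, ω Y ≤ C * ω X * Real.exp (s * ‖X - Y‖)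

variable {ω : Eucl d × Eucl d → ℝ} {C s : ℝ}

theorem IsExpModerate.continuous_enorm (hω : IsExpModerate ω C s) (φ : GelfandShilov d)
    (f : GelfandShilovDual d) : Continuous fun X => ‖stft φ f X * (ω X : ℂ)‖ₑ := by
  have h1 := hω.continuous
  have h2 := continuous_stft φ f
  fun_prop

theorem enorm_mul_ofReal_eq {w : ℝ} (hw : 0 ≤ w) (z : ℂ) :
    ‖z * (w : ℂ)‖ₑ = ‖z‖ₑ * ENNReal.ofReal w := by
  rw [enorm_mul, ← ofReal_norm (w : ℂ), Complex.norm_real, Real.norm_of_nonneg hw]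

/-- The unweighted kernel bound is used at rate `r + s`, and the surplus `s` pays for replacing `ω
Y` by `ω X`. -/
theorem IsExpModerate.exists_approx (hω : IsExpModerate ω C s) {φ : GelfandShilov d} (hφ : φ ≠ 0)
    {r : ℝ} (hr : 0 < r) :
    ∃ A : ℝ≥0∞, A ≠ ⊤ ∧ ∀ f : GelfandShilovDual d,
      (∀ Y, ‖stft φ f Y * (ω Y : ℂ)‖ₑ ≤ A * ∫⁻ X, expKer r X Y * ‖stft φ f X * (ω X : ℂ)‖ₑ) ∧
      ∀ R : ℝ, ∃ g : GelfandShilov d, ∀ Y,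
        ‖stft φ (f - GelfandShilovDual.ofIntegrable g g.integrable) Y * (ω Y : ℂ)‖ₑ ≤
          A * ∫⁻ X in (Metric.closedBall 0 R)ᶜ, expKer r X Y * ‖stft φ f X * (ω X : ℂ)‖ₑ := by
  have hs := hω.rate_nonneg
  have hC := hω.const_nonneg
  obtain ⟨A, hA, hAf⟩ := GelfandShilovDual.exists_approx hφ (r := r + s) (by positivity)
  have key : ∀ (f : GelfandShilovDual d) (μ : Measure (Eucl d × Eucl d)) (Y : Eucl d × Eucl d),
      (∫⁻ X, ENNReal.ofReal (A * Real.exp (-((r + s) * ‖X - Y‖))) * ‖stft φ f X‖ₑ ∂μ) *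
        ENNReal.ofReal (ω Y) ≤
      ENNReal.ofReal (A * C) * ∫⁻ X, expKer r X Y * ‖stft φ f X * (ω X : ℂ)‖ₑ ∂μ := by
    intro f μ Y
    rw [← lintegral_mul_const' _ _ ENNReal.ofReal_ne_top,
      ← lintegral_const_mul' _ _ ENNReal.ofReal_ne_top]
    refine lintegral_mono fun X => ?_
    rw [enorm_mul_ofReal_eq (hω.pos X).le, expKer]
    have h1 : A * Real.exp (-((r + s) * ‖X - Y‖)) * ω Y ≤
        A * C * Real.exp (-(r * ‖X - Y‖)) * ω X := by
      have h2 : Real.exp (-((r + s) * ‖X - Y‖)) * Real.exp (s * ‖X - Y‖) =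
          Real.exp (-(r * ‖X - Y‖)) := by
        rw [← Real.exp_add]; ring_nf
      calc _ ≤ A * Real.exp (-((r + s) * ‖X - Y‖)) * (C * ω X * Real.exp (s * ‖X - Y‖)) := by
            gcongr
            exact hω.le X Y
        _ = A * C * (Real.exp (-((r + s) * ‖X - Y‖)) * Real.exp (s * ‖X - Y‖)) * ω X := by ring
        _ = _ := by rw [h2]
    have h3 := ENNReal.ofReal_le_ofReal h1
    rw [ENNReal.ofReal_mul (by positivity), ENNReal.ofReal_mul (p := A * C * _) (by positivity),
      ENNReal.ofReal_mul (p := A * C) (by positivity)] at h3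
    calc _ = ENNReal.ofReal (A * Real.exp (-((r + s) * ‖X - Y‖))) * ENNReal.ofReal (ω Y) *
          ‖stft φ f X‖ₑ := by ring
      _ ≤ ENNReal.ofReal (A * C) * ENNReal.ofReal (Real.exp (-(r * ‖X - Y‖))) *
          ENNReal.ofReal (ω X) * ‖stft φ f X‖ₑ := by
          gcongr
      _ = _ := by ring
  refine ⟨ENNReal.ofReal (A * C), ENNReal.ofReal_ne_top, fun f => ⟨fun Y => ?_, fun R => ?_⟩⟩
  · rw [enorm_mul_ofReal_eq (hω.pos Y).le]
    exact (mul_le_mul_left ((hAf f).1 Y) _).trans (key f volume Y)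
  · obtain ⟨g, hg⟩ := (hAf f).2 R
    refine ⟨g, fun Y => ?_⟩
    rw [enorm_mul_ofReal_eq (hω.pos Y).le]
    exact (mul_le_mul_left (hg Y) _).trans (key f _ Y)

theorem IsExpModerate.exists_growth (hω : IsExpModerate ω C s) (φ : GelfandShilov d)
    (f : GelfandShilovDual d) :
    ∃ s₀ : ℝ, 0 ≤ s₀ ∧ ∃ K : ℝ≥0∞, K ≠ ⊤ ∧
      ∀ X, ‖stft φ f X * (ω X : ℂ)‖ₑ * expKer s₀ X 0 ≤ K := by
  obtain ⟨D, r, hD, hr, hf⟩ := f.exists_growth φ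
  have hC := hω.const_nonneg
  have hs := hω.rate_nonneg
  set c : ℝ := (2 * Real.pi) ^ (-(d : ℝ) / 2) with hc
  have hc0 : 0 ≤ c := by positivity
  refine ⟨r + s, by positivity, ENNReal.ofReal (c * D * (C * ω 0)), ENNReal.ofReal_ne_top,
    fun X => ?_⟩
  rw [← ofReal_norm, expKer, ← ENNReal.ofReal_mul (norm_nonneg _)]
  refine ENNReal.ofReal_le_ofReal ?_
  have h1 : ‖stft φ f X‖ ≤ c * (D * Real.exp (r * ‖X‖)) := by
    rw [stft, norm_mul, Complex.norm_real, Real.norm_of_nonneg hc0]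
    gcongr
    exact hf X
  have h2 := hω.le 0 X
  rw [zero_sub, norm_neg] at h2
  have h0 := hω.pos X
  have h00 := hω.pos 0
  rw [norm_mul, Complex.norm_real, Real.norm_of_nonneg h0.le, sub_zero]
  calc _ ≤ c * (D * Real.exp (r * ‖X‖)) * (C * ω 0 * Real.exp (s * ‖X‖)) *
        Real.exp (-((r + s) * ‖X‖)) := by gcongr
    _ = c * D * (C * ω 0) * (Real.exp (r * ‖X‖) * Real.exp (s * ‖X‖) *
        Real.exp (-((r + s) * ‖X‖))) := by ring
    _ = _ := by
        rw [← Real.exp_add, ← Real.exp_add]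
        ring_nf
        simp

/-- The sub-mean value property of the weighted short-time Fourier transform. -/
theorem IsExpModerate.exists_subMean (hω : IsExpModerate ω C s) {φ : GelfandShilov d} (hφ : φ ≠ 0)
    (f : GelfandShilovDual d) {q : ℝ} (hq : 0 < q) :
    ∃ a : ℝ, 0 < a ∧ ∃ B : ℝ≥0∞, B ≠ ⊤ ∧ ∀ Y, ‖stft φ f Y * (ω Y : ℂ)‖ₑ ^ q ≤
      B * ∫⁻ X, expKer a X Y * ‖stft φ f X * (ω X : ℂ)‖ₑ ^ q := by
  obtain ⟨s₀, hs₀, K, hK, hgrow⟩ := hω.exists_growth φ f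
  refine rpow_le_lintegral (hω.continuous_enorm φ f).measurable (fun r hr => ?_) hs₀ hK hgrow hq
  obtain ⟨A, hA, hAf⟩ := hω.exists_approx hφ hr
  exact ⟨A, hA, (hAf f).1⟩

theorem tendsto_ofReal_exp_neg_mul {c : ℝ} (hc : 0 < c) {K : ℝ≥0∞} (hK : K ≠ ⊤) :
    Tendsto (fun R : ℝ => ENNReal.ofReal (Real.exp (-(c * (R / 2)))) * K) atTop (𝓝 0) := by
  have h1 : Tendsto (fun R : ℝ => Real.exp (-(c * (R / 2)))) atTop (𝓝 0) := by
    refine Real.tendsto_exp_neg_atTop_nhds_zero.comp ?_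
    exact Tendsto.const_mul_atTop hc (tendsto_id.atTop_div_const two_pos)
  have h2 := ENNReal.Tendsto.mul_const (ENNReal.tendsto_ofReal h1) (Or.inr hK)
  simpa using h2

/-- Besides `p = ∞`, only the exponent `p = q` is used: it makes `W^q` integrable over phase space,
and the sub-mean value property dominates the supremum over `‖x‖ > R` by an integral that tends to
zero. -/
theorem IsExpModerate.modFlat_subset (hω : IsExpModerate ω C s) {φ : GelfandShilov d} (hφ : φ ≠ 0)
    {q : ℝ≥0∞} (hq0 : 0 < q) (hq : q < ⊤) : modFlat φ q ω ⊆ modSharp φ q ω := by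
  intro f hf
  have hqr : 0 < q.toReal := ENNReal.toReal_pos hq0.ne' hq.ne
  simp only [modFlat, Set.mem_iInter] at hf
  refine ⟨hf ⊤ ENNReal.zero_lt_top, ?_⟩
  have hfq : modNorm φ q q ω f < ⊤ := hf q hq0
  set W : Eucl d × Eucl d → ℝ≥0∞ := fun X => ‖stft φ f X * (ω X : ℂ)‖ₑ with hW
  have hWc : Continuous W := hω.continuous_enorm φ f
  have hWm : Measurable fun Z => W Z ^ q.toReal := hWc.measurable.pow_const _
  have hfin : ∫⁻ Z, W Z ^ q.toReal ≠ ⊤ := by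
    rw [← mixedNormOn_univ_rpow hq0 hq hω.continuous (continuous_stft φ f)]
    exact ENNReal.rpow_ne_top_of_nonneg hqr.le hfq.ne
  obtain ⟨a, ha, B, hB, hsub⟩ := hω.exists_subMean hφ f hqr
  set K := expMass (volume : Measure (Eucl d)) (a / 2) with hK
  have hKt : K ≠ ⊤ := expMass_ne_top _ (by positivity)
  set D : ℝ → ℝ≥0∞ := fun R => B * (K *
    ((∫⁻ Z in {Z : Eucl d × Eucl d | R / 2 < ‖Z.1‖}, W Z ^ q.toReal) +
      ENNReal.ofReal (Real.exp (-(a / 2 * (R / 2)))) * ∫⁻ Z, W Z ^ q.toReal)) with hD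
  have hDlim : Tendsto D atTop (𝓝 0) := by
    have h1 : Tendsto (fun R : ℝ => ∫⁻ Z in {Z : Eucl d × Eucl d | R / 2 < ‖Z.1‖}, W Z ^ q.toReal)
        atTop (𝓝 0) :=
      (tendsto_setLIntegral_norm_gt hWm hfin measurable_fst.norm).comp
        (tendsto_id.atTop_div_const two_pos)
    have h2 := h1.add (tendsto_ofReal_exp_neg_mul (c := a / 2) (by positivity) hfin)
    rw [add_zero] at h2
    have h3 := ENNReal.Tendsto.const_mul (a := B)
      (ENNReal.Tendsto.const_mul (a := K) h2 (Or.inr hKt)) (Or.inr hB)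
    simpa using h3
  -- The shift to `R + 1` places the closed region inside the open region `R < ‖x‖`; it is undone at
  -- the end.
  have hle : ∀ R : ℝ, mixedNormOn {x | R + 1 ≤ ‖x‖} ⊤ q ω (stft φ f) ^ q.toReal ≤ D R := by
    intro R
    refine (mixedNormOn_top_rpow_le (measurableSet_le measurable_const measurable_norm)
      hq0 hq ω _).trans ?_
    calc _ ≤ ∫⁻ ξ, B * ⨆ x ∈ {x : Eucl d | R < ‖x‖}, ∫⁻ Z, expKer a Z (x, ξ) * W Z ^ q.toReal := by
          refine lintegral_mono fun ξ => iSup₂_le fun x hx => (hsub (x, ξ)).trans ?_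
          gcongr
          have hx' : R + 1 ≤ ‖x‖ := hx
          exact le_biSup (fun x => ∫⁻ Z, expKer a Z (x, ξ) * W Z ^ q.toReal)
            (show x ∈ {x : Eucl d | R < ‖x‖} by simp only [Set.mem_ofPred_eq]; linarith)
      _ = B * ∫⁻ ξ, ⨆ x ∈ {x : Eucl d | R < ‖x‖}, ∫⁻ Z, expKer a Z (x, ξ) * W Z ^ q.toReal :=
          lintegral_const_mul' _ _ hB
      _ ≤ _ := by
          exact mul_le_mul_right (lintegral_iSup_tail_expKer_le hWm ha R) B
  have h4 : Tendsto (fun R : ℝ => mixedNormOn {x | R + 1 ≤ ‖x‖} ⊤ q ω (stft φ f)) atTop (𝓝 0) := by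
    have h5 : Tendsto (fun R => D R ^ (q.toReal)⁻¹) atTop (𝓝 0) := by
      have := hDlim.ennrpow_const (q.toReal)⁻¹
      rwa [ENNReal.zero_rpow_of_pos (by positivity)] at this
    refine tendsto_of_tendsto_of_tendsto_of_le_of_le tendsto_const_nhds h5 (fun _ => bot_le) ?_
    intro R
    exact (ENNReal.le_rpow_inv_iff hqr).2 (hle R)
  have h6 := h4.comp (tendsto_atTop_add_const_right atTop (-1) tendsto_id)
  refine h6.congr fun R => ?_
  simp

/-- The first term vanishes by the definition of `M^{♯,q}`, the second by dominated convergence in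
`η`, and the third through its exponential factor. This is where the decay condition of `M^{♯,q}`
enters. -/
theorem IsExpModerate.tendsto_tail (hω : IsExpModerate ω C s) {φ : GelfandShilov d}
    {q : ℝ≥0∞} (hq0 : 0 < q) (hq : q < ⊤) {f : GelfandShilovDual d}
    (hf : f ∈ modSharp φ q ω) {c : ℝ} (hc : 0 < c) :
    Tendsto (fun R : ℝ =>
      (∫⁻ η, ⨆ z ∈ {z | R / 2 < ‖z‖}, ‖stft φ f (z, η) * (ω (z, η) : ℂ)‖ₑ ^ q.toReal) +
      (∫⁻ η in {η | R / 2 < ‖η‖}, ⨆ z ∈ Set.univ,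
        ‖stft φ f (z, η) * (ω (z, η) : ℂ)‖ₑ ^ q.toReal) +
      ENNReal.ofReal (Real.exp (-(c * (R / 2)))) *
        ∫⁻ η, ⨆ z ∈ Set.univ, ‖stft φ f (z, η) * (ω (z, η) : ℂ)‖ₑ ^ q.toReal) atTop (𝓝 0) := by
  have hqr : 0 < q.toReal := ENNReal.toReal_pos hq0.ne' hq.ne
  obtain ⟨hf1, hf2⟩ := hf
  have hWqc : Continuous fun Z => ‖stft φ f Z * (ω Z : ℂ)‖ₑ ^ q.toReal :=
    ENNReal.continuous_rpow_const.comp (hω.continuous_enorm φ f)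
  have hNfin : ∫⁻ η, ⨆ z ∈ Set.univ, ‖stft φ f (z, η) * (ω (z, η) : ℂ)‖ₑ ^ q.toReal ≠ ⊤ := by
    refine ne_top_of_le_ne_top ?_ (le_mixedNormOn_top_rpow (S := Set.univ) isOpen_univ
      (Set.subset_univ _) hq0 hq hω.continuous (continuous_stft φ f))
    exact ENNReal.rpow_ne_top_of_nonneg hqr.le (ne_of_lt hf1)
  have hhalf : Tendsto (fun R : ℝ => R / 2) atTop atTop := tendsto_id.atTop_div_const two_pos
  have h1 : Tendsto (fun R : ℝ =>
      ∫⁻ η, ⨆ z ∈ {z | R / 2 < ‖z‖}, ‖stft φ f (z, η) * (ω (z, η) : ℂ)‖ₑ ^ q.toReal)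
      atTop (𝓝 0) := by
    have h2 := (hf2.comp hhalf).ennrpow_const q.toReal
    rw [ENNReal.zero_rpow_of_pos hqr] at h2
    have hle : ∀ R : ℝ,
        ∫⁻ η, ⨆ z ∈ {z | R / 2 < ‖z‖}, ‖stft φ f (z, η) * (ω (z, η) : ℂ)‖ₑ ^ q.toReal ≤
        mixedNormOn {x | R / 2 ≤ ‖x‖} ⊤ q ω (stft φ f) ^ q.toReal := fun R =>
      le_mixedNormOn_top_rpow (U := {z | R / 2 < ‖z‖}) (S := {z | R / 2 ≤ ‖z‖})
        (isOpen_lt continuous_const continuous_norm) (Set.ofPred_subset_ofPred.2 fun _ => le_of_lt)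
        hq0 hq hω.continuous (continuous_stft φ f)
    exact tendsto_of_tendsto_of_tendsto_of_le_of_le tendsto_const_nhds h2 (fun _ => bot_le) hle
  have h3 := (tendsto_setLIntegral_norm_gt (measurable_biSup_slice hWqc Set.univ) hNfin
    (N := fun η : Eucl d => ‖η‖) measurable_norm).comp hhalf
  have h4 := (h1.add h3).add (tendsto_ofReal_exp_neg_mul hc hNfin)
  rwa [add_zero, add_zero] at h4

/-- The approximant is the localization of `f` to a phase space ball, with `R` so large that the
tail bound falls below `ε^q`. -/
theorem IsExpModerate.exists_modNorm_sub_lt (hω : IsExpModerate ω C s) {φ : GelfandShilov d}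
    (hφ : φ ≠ 0) {q : ℝ≥0∞} (hq0 : 0 < q) (hq : q < ⊤) {f : GelfandShilovDual d}
    (hf : f ∈ modSharp φ q ω) {ε : ℝ≥0∞} (hε : 0 < ε) :
    ∃ g : GelfandShilov d,
      modNorm φ ⊤ q ω (f - GelfandShilovDual.ofIntegrable g g.integrable) < ε := by
  have hqr : 0 < q.toReal := ENNReal.toReal_pos hq0.ne' hq.ne
  obtain ⟨a, ha, B, hB, hsub⟩ := hω.exists_subMean hφ f hqr
  obtain ⟨A, hA, hAf⟩ := hω.exists_approx hφ (r := 2 * (a / q.toReal)) (by positivity)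
  have hAq : A ^ q.toReal ≠ ⊤ := ENNReal.rpow_ne_top_of_nonneg hqr.le hA
  have hct : B * expMass (volume : Measure (Eucl d × Eucl d)) (a / q.toReal) ^ q.toReal ≠ ⊤ :=
    ENNReal.mul_ne_top hB
      (ENNReal.rpow_ne_top_of_nonneg hqr.le (expMass_ne_top _ (by positivity)))
  have hKt : expMass (volume : Measure (Eucl d)) (a / 2 / 2) ≠ ⊤ :=
    expMass_ne_top _ (by positivity)
  have hlim := ENNReal.Tendsto.const_mul (a := A ^ q.toReal) (ENNReal.Tendsto.const_mul
    (ENNReal.Tendsto.const_mul (hω.tendsto_tail hq0 hq hf (half_pos ha))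
      (Or.inr (ENNReal.mul_ne_top hKt hKt))) (Or.inr hct)) (Or.inr hAq)
  simp only [mul_zero] at hlim
  obtain ⟨R, hR⟩ := (hlim.eventually (gt_mem_nhds (ENNReal.rpow_pos_of_nonneg hε hqr.le))).exists
  obtain ⟨g, hg⟩ := (hAf f).2 R
  refine ⟨g, ?_⟩
  rw [← ENNReal.rpow_lt_rpow_iff hqr]
  refine lt_of_le_of_lt ?_ hR
  refine (mixedNormOn_top_rpow_le MeasurableSet.univ hq0 hq ω _).trans ?_
  refine le_trans ?_ (mul_le_mul_right
    (lintegral_iSup_rpow_compl_ball_le (hω.continuous_enorm φ f) hqr ha hB hsub R) _)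
  rw [← lintegral_const_mul' _ _ hAq]
  refine lintegral_mono fun ξ => iSup₂_le fun x _ => ?_
  refine (ENNReal.rpow_le_rpow (hg (x, ξ)) hqr.le).trans ?_
  rw [ENNReal.mul_rpow_of_nonneg _ _ hqr.le]
  refine mul_le_mul_right ?_ _
  exact le_iSup (fun x => (∫⁻ X in (Metric.closedBall 0 R)ᶜ,
    expKer (2 * (a / q.toReal)) X (x, ξ) * ‖stft φ f X * (ω X : ℂ)‖ₑ) ^ q.toReal) x

end ContinuousWeight

/-! ### Moderate weights -/

section ModerateWeights

variable {d : ℕ} {ω : Eucl d × Eucl d → ℝ}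

/-- The function `v` is bounded on compact sets only almost everywhere, but the conclusion concerns
every `Y`. Write `Y = Z + (Y - Z)` with `Z` in the unit ball and both summands outside the
exceptional null set; since `‖Y - Z‖ ≤ 2`, a bound on the ball of radius `2` suffices. -/
theorem IsModerateWeight.exists_le_on_unitBall (hω : IsModerateWeight ω) :
    ∃ N : ℝ, 1 ≤ N ∧ ∀ X Y, ‖Y‖ ≤ 1 → ω (X + Y) ≤ N * ω X := by
  obtain ⟨⟨hpos, -⟩, v, hv, C, hC, hωv⟩ := hω
  have hmem := (hv.2 (Metric.closedBall 0 2) (isCompact_closedBall _ _)).1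
  set m := (eLpNormEssSup v (volume.restrict (Metric.closedBall 0 2))).toReal with hm
  have hfin : eLpNormEssSup v (volume.restrict (Metric.closedBall 0 2)) ≠ ⊤ := by
    rw [← eLpNorm_exponent_top]; exact hmem.2.ne
  have hvm : ∀ᵐ Z : Eucl d × Eucl d, ‖Z‖ ≤ 2 → v Z ≤ m := by
    have h := enorm_ae_le_eLpNormEssSup v (volume.restrict (Metric.closedBall 0 2))
    rw [ae_restrict_iff' Metric.isClosed_closedBall.measurableSet] at h
    filter_upwards [h] with Z hZ hZ2
    have h1 := ENNReal.toReal_mono hfin (hZ (by simpa using hZ2))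
    rw [toReal_enorm] at h1
    exact (le_abs_self _).trans h1
  set M := max 1 (C * m) with hM
  have hM1 : 1 ≤ M := le_max_left _ _
  have hgood : ∀ᵐ Z : Eucl d × Eucl d, ‖Z‖ ≤ 2 → ∀ X, ω (X + Z) ≤ M * ω X := by
    filter_upwards [hvm] with Z hZ hZ2 X
    have h2 := hpos X
    calc ω (X + Z) ≤ C * ω X * v Z := hωv X Z
      _ ≤ C * ω X * m := by gcongr; exact hZ hZ2
      _ = C * m * ω X := by ring
      _ ≤ M * ω X := by gcongr; exact le_max_right _ _
  refine ⟨M * M, by nlinarith, fun X Y hY => ?_⟩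
  have : (volume : Measure (Eucl d × Eucl d)).IsNegInvariant :=
    Measure.IsAddHaarMeasure.isNegInvariant_of_regular _
  have hgood' := (Measure.measurePreserving_sub_left (volume : Measure (Eucl d × Eucl d)) Y
    ).quasiMeasurePreserving.ae hgood
  have hfreq : ∃ᵐ Z ∂(volume : Measure (Eucl d × Eucl d)), Z ∈ Metric.ball 0 1 :=
    frequently_ae_mem_iff.2 (Metric.measure_ball_pos _ _ one_pos).ne'
  obtain ⟨Z, hZ, h1, h2⟩ := (hfreq.and_eventually (hgood.and hgood')).exists
  rw [mem_ball_zero_iff] at hZ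
  have h3 := h1 (by linarith) X
  have h4 := h2 (by linarith [norm_sub_le Y Z]) (X + Z)
  rw [show X + Z + (Y - Z) = X + Y by abel] at h4
  calc _ ≤ M * ω (X + Z) := h4
    _ ≤ M * (M * ω X) := by gcongr
    _ = _ := by ring

/-- A displacement is divided into `⌈‖Y - X‖⌉` steps of length at most one, each costing a factor
`N`. -/
theorem IsModerateWeight.exists_le_exp (hω : IsModerateWeight ω) :
    ∃ C s : ℝ, 1 ≤ C ∧ 0 ≤ s ∧ ∀ X Y, ω Y ≤ C * ω X * Real.exp (s * ‖X - Y‖) := by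
  obtain ⟨N, hN1, hN⟩ := hω.exists_le_on_unitBall
  have hpos := hω.1.1
  have hN0 : 0 < N := by linarith
  have hiter : ∀ (n : ℕ) (X Y : Eucl d × Eucl d), ‖Y‖ ≤ n → ω (X + Y) ≤ N ^ n * ω X := by
    intro n
    induction n with
    | zero =>
      intro X Y hY
      have : Y = 0 := norm_le_zero_iff.1 (by simpa using hY)
      simp [this]
    | succ n ih =>
      intro X Y hY
      have hn : (0 : ℝ) < n + 1 := by positivity
      push_cast at hY
      have h1 : ‖((n : ℝ) / (n + 1)) • Y‖ ≤ n := by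
        rw [norm_smul, Real.norm_of_nonneg (by positivity), div_mul_eq_mul_div, div_le_iff₀ hn]
        gcongr
      have h2 : ‖((1 : ℝ) / (n + 1)) • Y‖ ≤ 1 := by
        rw [norm_smul, Real.norm_of_nonneg (by positivity), div_mul_eq_mul_div, div_le_iff₀ hn]
        simpa using hY
      have h3 : X + Y = X + ((n : ℝ) / (n + 1)) • Y + ((1 : ℝ) / (n + 1)) • Y := by
        rw [add_assoc, ← add_smul, ← add_div, div_self hn.ne', one_smul]
      rw [h3]
      calc _ ≤ N * ω (X + ((n : ℝ) / (n + 1)) • Y) := hN _ _ h2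
        _ ≤ N * (N ^ n * ω X) := by gcongr; exact ih _ _ h1
        _ = _ := by ring
  refine ⟨N, Real.log N, hN1, Real.log_nonneg hN1, fun X Y => ?_⟩
  have h1 := hiter ⌈‖Y - X‖⌉₊ X (Y - X) (Nat.le_ceil _)
  rw [add_sub_cancel] at h1
  refine h1.trans ?_
  have h2 : (N : ℝ) ^ ⌈‖Y - X‖⌉₊ ≤ N * Real.exp (Real.log N * ‖X - Y‖) := by
    rw [← Real.rpow_natCast, ← Real.rpow_def_of_pos hN0, norm_sub_rev X Y]
    calc N ^ (⌈‖Y - X‖⌉₊ : ℝ) ≤ N ^ (1 + ‖Y - X‖) := by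
          gcongr
          linarith [Nat.ceil_lt_add_one (norm_nonneg (Y - X))]
      _ = _ := by rw [Real.rpow_add hN0, Real.rpow_one]
  have := hpos X
  calc _ ≤ N * Real.exp (Real.log N * ‖X - Y‖) * ω X := by gcongr
    _ = _ := by ring

/-- Every moderate weight is equivalent to a continuous one. -/
theorem IsModerateWeight.exists_isExpModerate (hω : IsModerateWeight ω) :
    ∃ (ω' : Eucl d × Eucl d → ℝ) (s K : ℝ), IsExpModerate ω' 1 s ∧ 1 ≤ K ∧
      ∀ X, ω X ≤ ω' X ∧ ω' X ≤ K * ω X := by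
  obtain ⟨C, s, hC, hs, h⟩ := hω.exists_le_exp
  have hpos := hω.1.1
  have hle : ∀ X Y, ω Y * Real.exp (-(s * ‖X - Y‖)) ≤ C * ω X := fun X Y => by
    rw [Real.exp_neg, ← div_eq_mul_inv, div_le_iff₀ (Real.exp_pos _)]
    exact h X Y
  have hbdd : ∀ X, BddAbove (Set.range fun Y => ω Y * Real.exp (-(s * ‖X - Y‖))) := fun X =>
    ⟨C * ω X, by rintro _ ⟨Y, rfl⟩; exact hle X Y⟩
  -- This is a multiplicative sup-convolution. By the triangle inequality it is moderate with
  -- constant exactly `1`, so `ω' Y / ω' X` lies between `e^{∓s‖X-Y‖}`, which gives continuity.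
  set ω' : Eucl d × Eucl d → ℝ := fun X => ⨆ Y, ω Y * Real.exp (-(s * ‖X - Y‖)) with hω'
  have h1 : ∀ X, ω X ≤ ω' X := fun X => by
    have := le_ciSup (hbdd X) X
    simpa using this
  have hmod : ∀ X Y, ω' Y ≤ 1 * ω' X * Real.exp (s * ‖X - Y‖) := fun X Y => by
    refine ciSup_le fun Z => ?_
    calc ω Z * Real.exp (-(s * ‖Y - Z‖))
        ≤ ω Z * Real.exp (-(s * ‖X - Z‖)) * Real.exp (s * ‖X - Y‖) := by
          rw [mul_assoc, ← Real.exp_add]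
          have h2 := mul_le_mul_of_nonneg_left (norm_sub_le_norm_sub_add_norm_sub X Y Z) hs
          have := (hpos Z).le
          gcongr
          linarith
      _ ≤ _ := by rw [one_mul]; gcongr; exact le_ciSup (hbdd X) Z
  refine ⟨ω', s, C, ⟨?_, fun X => (hpos X).trans_le (h1 X), zero_le_one, hs, hmod⟩, hC,
    fun X => ⟨h1 X, ciSup_le (hle X)⟩⟩
  refine continuous_iff_continuousAt.2 fun X => ?_
  have hn : Tendsto (fun Y => ‖X - Y‖) (𝓝 X) (𝓝 0) := by
    have : Continuous fun Y => ‖X - Y‖ := by fun_prop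
    simpa using this.tendsto X
  have hu : Tendsto (fun Y => 1 * ω' X * Real.exp (s * ‖X - Y‖)) (𝓝 X) (𝓝 (ω' X)) := by
    have := ((hn.const_mul s).rexp).const_mul (1 * ω' X)
    simpa using this
  have hl : Tendsto (fun Y => ω' X * Real.exp (-(s * ‖X - Y‖))) (𝓝 X) (𝓝 (ω' X)) := by
    have := ((hn.const_mul s).neg.rexp).const_mul (ω' X)
    simpa using this
  refine tendsto_of_tendsto_of_tendsto_of_le_of_le hl hu (fun Y => ?_) (hmod X)
  have := hmod Y X
  rw [norm_sub_rev, one_mul] at this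
  change ω' X * Real.exp (-(s * ‖X - Y‖)) ≤ ω' Y
  rw [Real.exp_neg, ← div_eq_mul_inv, div_le_iff₀ (Real.exp_pos _)]
  exact this

/-! ### Comparison of the spaces for equivalent weights -/

variable {ω' : Eucl d × Eucl d → ℝ} {K : NNReal}

theorem mixedNormOn_le_mul (hpos : ∀ X, 0 < ω X) (h : ∀ X, ω X ≤ K * ω' X) (S : Set (Eucl d))
    (p q : ℝ≥0∞) (F : Eucl d × Eucl d → ℂ) :
    mixedNormOn S p q ω F ≤ K * mixedNormOn S p q ω' F := by
  refine eLpNorm_le_nnreal_smul_eLpNorm_of_ae_le_mul' (.of_forall fun ξ => ?_) q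
  simp only [enorm_eq_self]
  refine eLpNorm_le_nnreal_smul_eLpNorm_of_ae_le_mul' (.of_forall fun x => ?_) p
  have h2 : ‖ω (x, ξ)‖ₑ ≤ K * ‖ω' (x, ξ)‖ₑ := by
    rw [← ofReal_norm, ← ofReal_norm, ← ENNReal.ofReal_coe_nnreal,
      ← ENNReal.ofReal_mul K.coe_nonneg]
    refine ENNReal.ofReal_le_ofReal ?_
    rw [Real.norm_of_nonneg (hpos _).le]
    exact (h _).trans (by gcongr; exact Real.le_norm_self _)
  rw [enorm_mul, enorm_mul, mul_left_comm, ← ofReal_norm, ← ofReal_norm,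
    ← ofReal_norm, Complex.norm_real, Complex.norm_real, ofReal_norm, ofReal_norm, ofReal_norm]
  gcongr

theorem modSpace_subset_of_le (hpos : ∀ X, 0 < ω X) (h : ∀ X, ω X ≤ K * ω' X)
    (φ : GelfandShilov d) (p q : ℝ≥0∞) : modSpace φ p q ω' ⊆ modSpace φ p q ω := fun f hf =>
  (mixedNormOn_le_mul hpos h _ p q (stft φ f)).trans_lt (ENNReal.mul_lt_top ENNReal.coe_lt_top hf)

theorem modFlat_subset_of_le (hpos : ∀ X, 0 < ω X) (h : ∀ X, ω X ≤ K * ω' X)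
    (φ : GelfandShilov d) (q : ℝ≥0∞) : modFlat φ q ω' ⊆ modFlat φ q ω :=
  Set.iInter₂_mono fun p _ => modSpace_subset_of_le hpos h φ p q

theorem modSharp_subset_of_le (hpos : ∀ X, 0 < ω X) (h : ∀ X, ω X ≤ K * ω' X)
    (φ : GelfandShilov d) (q : ℝ≥0∞) : modSharp φ q ω' ⊆ modSharp φ q ω := fun f hf => by
  refine ⟨modSpace_subset_of_le hpos h φ _ q hf.1, ?_⟩
  have h2 := ENNReal.Tendsto.const_mul hf.2 (.inr (ENNReal.coe_ne_top (r := K)))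
  rw [mul_zero] at h2
  exact tendsto_of_tendsto_of_tendsto_of_le_of_le tendsto_const_nhds h2 (fun _ => zero_le)
    fun R => mixedNormOn_le_mul hpos h _ _ q _

theorem IsDenseInModSharp.of_le (hpos : ∀ X, 0 < ω X) (hpos' : ∀ X, 0 < ω' X)
    {K' : NNReal} (h : ∀ X, ω X ≤ K * ω' X)
    (h' : ∀ X, ω' X ≤ K' * ω X) {φ : GelfandShilov d} {q : ℝ≥0∞} {A : Set (GelfandShilovDual d)}
    (hA : IsDenseInModSharp φ q ω' A) : IsDenseInModSharp φ q ω A := by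
  refine ⟨hA.1.trans (modSharp_subset_of_le hpos h φ q), fun f hf ε hε => ?_⟩
  -- Dividing by `K + 1` rather than `K` allows `K = 0`.
  obtain ⟨g, hg, hfg⟩ := hA.2 f (modSharp_subset_of_le hpos' h' φ q hf) (ε / (K + 1))
    (ENNReal.div_pos hε.ne' (by simp))
  refine ⟨g, hg, (mixedNormOn_le_mul hpos h _ _ q _).trans_lt ?_⟩
  have h1 := (ENNReal.lt_div_iff_mul_lt (.inl (by simp)) (.inl (by simp))).1 hfg
  refine lt_of_le_of_lt ?_ h1
  rw [mul_comm]
  exact mul_le_mul_right le_self_add _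

end ModerateWeights

/-! ### Mixed norms of rapidly decreasing functions -/

section Decay

variable {d : ℕ}

/-- The function `(1 + |x|)^{-N}`. -/
def decay (N : ℕ) (x : Eucl d) : ℝ := ((1 + ‖x‖) ^ N)⁻¹

theorem decay_pos (N : ℕ) (x : Eucl d) : 0 < decay N x := by unfold decay; positivity

theorem decay_add (N M : ℕ) (x : Eucl d) : decay (N + M) x = decay N x * decay M x := by
  rw [decay, decay, decay, pow_add, mul_inv]

theorem decay_anti {N M : ℕ} (h : N ≤ M) (x : Eucl d) : decay M x ≤ decay N x := by
  unfold decay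
  gcongr
  simp

theorem decay_le_one (N : ℕ) (x : Eucl d) : decay N x ≤ 1 :=
  (decay_anti (Nat.zero_le N) x).trans (by simp [decay])

theorem one_add_norm_pow_mul_decay (N : ℕ) (x : Eucl d) : (1 + ‖x‖) ^ N * decay N x = 1 :=
  mul_inv_cancel₀ (by positivity)

theorem decay_mul_decay_sub_le (N : ℕ) (x y : Eucl d) :
    decay N y * decay N (y - x) ≤ decay N x := by
  rw [decay, decay, decay, ← mul_inv, ← mul_pow]
  gcongr
  have : ‖x‖ ≤ ‖y‖ + ‖y - x‖ := by
    have := norm_sub_le y (y - x)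
    rwa [sub_sub_cancel] at this
  nlinarith [norm_nonneg y, norm_nonneg (y - x)]

theorem exp_neg_norm_le_decay (N : ℕ) (x : Eucl d) :
    Real.exp (-‖x‖) ≤ N.factorial * Real.exp 1 * decay N x := by
  have h := pow_le_mul_exp (t := 1 + ‖x‖) (by positivity) one_pos N
  rw [one_pow, one_mul, div_one, Real.exp_add] at h
  rw [decay, ← div_eq_mul_inv, le_div_iff₀ (by positivity), Real.exp_neg,
    inv_mul_le_iff₀ (Real.exp_pos _)]
  linarith

theorem exists_eLpNorm_decay_lt_top (d : ℕ) {p : ℝ≥0∞} (hp : 0 < p) :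
    ∃ N : ℕ, ∀ n, N ≤ n → eLpNorm (decay (d := d) n) p volume < ⊤ := by
  rcases eq_or_ne p ⊤ with rfl | hp'
  · refine ⟨0, fun n _ => ?_⟩
    rw [eLpNorm_exponent_top]
    refine (eLpNormEssSup_le_of_ae_bound (C := 1) (.of_forall fun x => ?_)).trans_lt
      ENNReal.ofReal_lt_top
    rw [Real.norm_of_nonneg (decay_pos n x).le]
    exact decay_le_one n x
  · have hpr : 0 < p.toReal := ENNReal.toReal_pos hp.ne' hp'
    obtain ⟨N, hN⟩ := exists_nat_gt ((Module.finrank ℝ (Eucl d) : ℝ) / p.toReal)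
    rw [div_lt_iff₀ hpr] at hN
    refine ⟨N, fun n hn => ?_⟩
    have hlt : (Module.finrank ℝ (Eucl d) : ℝ) < n * p.toReal := hN.trans_le (by gcongr)
    have hfin := finite_integral_one_add_norm (μ := (volume : Measure (Eucl d))) hlt
    rw [eLpNorm_eq_lintegral_rpow_enorm_toReal hp.ne' hp']
    refine ENNReal.rpow_lt_top_of_nonneg (by positivity) (ne_of_lt ?_)
    refine lt_of_le_of_lt (lintegral_mono fun x => le_of_eq ?_) hfin
    rw [← ofReal_norm, Real.norm_of_nonneg (decay_pos n x).le,
      ENNReal.ofReal_rpow_of_nonneg (decay_pos n x).le hpr.le, decay, ← Real.rpow_natCast,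
      ← Real.rpow_neg (by positivity), ← Real.rpow_mul (by positivity), neg_mul]

/-- `N` is large enough for `(1 + |·|)^{-N}` to lie in both `L^p` and `L^q`; the norm then
factorizes over the variables. -/
theorem exists_mixedNormOn_le (d : ℕ) {p q : ℝ≥0∞} (hp : 0 < p) (hq : 0 < q) :
    ∃ (N : ℕ) (K : ℝ≥0∞), K ≠ ⊤ ∧ ∀ (ω : Eucl d × Eucl d → ℝ) (F : Eucl d × Eucl d → ℂ) (a : ℝ),
      0 ≤ a → (∀ x ξ, ‖F (x, ξ) * (ω (x, ξ) : ℂ)‖ ≤ a * (decay N x * decay N ξ)) →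
      mixedNormOn Set.univ p q ω F ≤ K * ENNReal.ofReal a := by
  obtain ⟨N₁, h₁⟩ := exists_eLpNorm_decay_lt_top d hp
  obtain ⟨N₂, h₂⟩ := exists_eLpNorm_decay_lt_top d hq
  set N := max N₁ N₂ with hN
  have hA := h₁ N (le_max_left _ _)
  have hB := h₂ N (le_max_right _ _)
  set A := eLpNorm (decay (d := d) N) p volume
  set B := eLpNorm (decay (d := d) N) q volume
  refine ⟨N, A * B, (ENNReal.mul_lt_top hA hB).ne, fun ω F a ha h => ?_⟩
  have hin : ∀ ξ, eLpNorm (fun x => F (x, ξ) * (ω (x, ξ) : ℂ)) p (volume.restrict Set.univ) ≤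
      ENNReal.ofReal (a * decay N ξ) * A := fun ξ => by
    rw [Measure.restrict_univ]
    refine eLpNorm_le_nnreal_smul_eLpNorm_of_ae_le_mul' (.of_forall fun x => ?_) p
    rw [← ofReal_norm, ← ofReal_norm]
    change _ ≤ ENNReal.ofReal _ * _
    rw [← ENNReal.ofReal_mul (mul_nonneg ha (decay_pos N ξ).le)]
    refine ENNReal.ofReal_le_ofReal ((h x ξ).trans (le_of_eq ?_))
    rw [Real.norm_of_nonneg (decay_pos N x).le]
    ring
  have hout : mixedNormOn Set.univ p q ω F ≤ (Real.toNNReal a * A.toNNReal : NNReal) • B := by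
    refine eLpNorm_le_nnreal_smul_eLpNorm_of_ae_le_mul' (.of_forall fun ξ => ?_) q
    rw [enorm_eq_self]
    refine (hin ξ).trans (le_of_eq ?_)
    rw [← ofReal_norm (decay N ξ), Real.norm_of_nonneg (decay_pos N ξ).le, ENNReal.coe_mul,
      ENNReal.coe_toNNReal hA.ne, ENNReal.ofReal_mul ha]
    change ENNReal.ofReal a * _ * _ = ENNReal.ofReal a * _ * _
    ring
  refine hout.trans (le_of_eq ?_)
  rw [ENNReal.smul_def, ENNReal.coe_mul, ENNReal.coe_toNNReal hA.ne, smul_eq_mul]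
  change ENNReal.ofReal a * _ * _ = _
  ring

theorem stft_ofIntegrable (φ : GelfandShilov d) {u : Eucl d → ℂ} (hu : Integrable u)
    (x ξ : Eucl d) : stft φ (GelfandShilovDual.ofIntegrable u hu) (x, ξ) =
      (((2 * Real.pi) ^ (-(d : ℝ) / 2) : ℝ) : ℂ) *
        fourierAt (fun y => u y * φ.conj (y - x)) ξ := by
  rw [stft]
  congr 1
  change ∫ y, u y * conjTimeFreqShift φ x ξ y = _
  refine integral_congr_ae (.of_forall fun y => ?_)
  simp only [conjTimeFreqShift_apply, GelfandShilov.conj_apply, mul_assoc]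

/-- The transform decays at rate `s + 1` and the weight grows at rate at most `s`; the remaining
exponential dominates any required polynomial decay. -/
theorem IsExpModerate.gelfandShilovFunctions_subset {ω : Eucl d × Eucl d → ℝ} {C s : ℝ}
    (hω : IsExpModerate ω C s) (φ : GelfandShilov d) {q : ℝ≥0∞} (hq : 0 < q) :
    gelfandShilovFunctions d ⊆ modFlat φ q ω := by
  rintro _ ⟨g, rfl⟩
  refine Set.mem_iInter₂.2 fun p hp => ?_
  obtain ⟨N, K, hK, h⟩ := exists_mixedNormOn_le d hp hq
  obtain ⟨A, hA0, hA⟩ := g.norm_fourierAt_mul_le φ.conj (r := s + 1) (by linarith [hω.rate_nonneg])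
  set c : ℝ := (2 * Real.pi) ^ (-(d : ℝ) / 2) with hc
  have hc0 : 0 ≤ c := by positivity
  have hω0 := (hω.pos 0).le
  have hC := hω.const_nonneg
  set e : ℝ := N.factorial * Real.exp 1 with he
  have he0 : 0 ≤ e := by positivity
  refine (h ω (stft φ (.ofIntegrable g g.integrable)) (c * A * (C * ω 0) * (e * e)) (by positivity)
    fun x ξ => ?_).trans_lt (ENNReal.mul_lt_top hK.lt_top ENNReal.ofReal_lt_top)
  have h1 : ω (x, ξ) ≤ C * ω 0 * Real.exp (s * (‖x‖ + ‖ξ‖)) := by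
    refine (hω.le 0 (x, ξ)).trans ?_
    rw [zero_sub, norm_neg]
    have := mul_le_mul_of_nonneg_left (norm_le_fst_add_snd (x, ξ)) hω.rate_nonneg
    gcongr
  rw [stft_ofIntegrable, norm_mul, norm_mul, Complex.norm_real, Complex.norm_real,
    Real.norm_of_nonneg hc0, Real.norm_of_nonneg (hω.pos _).le]
  calc c * ‖fourierAt (fun y => g y * φ.conj (y - x)) ξ‖ * ω (x, ξ)
      ≤ c * (A * Real.exp (-((s + 1) * (‖x‖ + ‖ξ‖)))) *
          (C * ω 0 * Real.exp (s * (‖x‖ + ‖ξ‖))) := by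
        have := (hω.pos (x, ξ)).le
        gcongr
        exact hA x ξ
    _ = c * A * (C * ω 0) * (Real.exp (-((s + 1) * (‖x‖ + ‖ξ‖))) *
          Real.exp (s * (‖x‖ + ‖ξ‖))) := by ring
    _ = c * A * (C * ω 0) * (Real.exp (-‖x‖) * Real.exp (-‖ξ‖)) := by
        rw [← Real.exp_add, ← Real.exp_add]
        congr 2
        ring
    _ ≤ c * A * (C * ω 0) * ((e * decay N x) * (e * decay N ξ)) := by
        have := decay_pos N x
        have := exp_neg_norm_le_decay N x
        have := exp_neg_norm_le_decay N ξ
        gcongr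
    _ = _ := by ring

/-! ### Schwartz functions and polynomially bounded weights -/

theorem integrable_decay (d : ℕ) : Integrable (decay (d := d) (d + 1)) := by
  have h := integrable_one_add_norm (μ := (volume : Measure (Eucl d))) (r := (d + 1 : ℕ))
    (by simp)
  refine h.congr (.of_forall fun x => ?_)
  simp only [decay]
  rw [Real.rpow_neg (by positivity), Real.rpow_natCast]

theorem GelfandShilov.exists_decay_bound (v : GelfandShilov d) (n M : ℕ) :
    ∃ b, 0 ≤ b ∧ ∀ i ≤ n, ∀ y, ‖iteratedFDeriv ℝ i v y‖ ≤ b * decay M y := by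
  obtain ⟨C, hC⟩ := v.exists_expBound one_pos
  have hC0 := hC.nonneg
  refine ⟨C * n.factorial * (M.factorial * Real.exp 1), by positivity, fun i hi y => ?_⟩
  have h1 := hC i y
  rw [one_pow, one_mul, div_one] at h1
  refine h1.trans ?_
  have h2 := exp_neg_norm_le_decay M y
  have h3 : (i.factorial : ℝ) ≤ n.factorial := by exact_mod_cast Nat.factorial_le hi
  calc C * i.factorial * Real.exp (-‖y‖)
      ≤ C * n.factorial * (M.factorial * Real.exp 1 * decay M y) := by gcongr
    _ = _ := by ring

/-- Of the decay of order `m + M` of `v`, the part `m` combines with the decay of `u` into decay in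
`x`; the part `M` remains for integration in `y`. -/
theorem norm_iteratedFDeriv_mul_comp_sub_le {u v : Eucl d → ℂ} (hu : ContDiff ℝ (⊤ : ℕ∞) u)
    (hv : ContDiff ℝ (⊤ : ℕ∞) v) {n m M : ℕ} {a b : ℝ} (ha : 0 ≤ a)
    (hua : ∀ i ≤ n, ∀ y, ‖iteratedFDeriv ℝ i u y‖ ≤ a * decay m y)
    (hvb : ∀ i ≤ n, ∀ y, ‖iteratedFDeriv ℝ i v y‖ ≤ b * decay (m + M) y) {k : ℕ} (hk : k ≤ n)
    (x y : Eucl d) : ‖iteratedFDeriv ℝ k (fun y => u y * v (y - x)) y‖ ≤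
      2 ^ n * a * b * decay m x * decay M (y - x) := by
  have hv' : ContDiff ℝ (⊤ : ℕ∞) fun y => v (y - x) := hv.comp (contDiff_id.sub contDiff_const)
  have hk' : (k : WithTop ℕ∞) ≤ ((⊤ : ℕ∞) : WithTop ℕ∞) := by exact_mod_cast le_top
  have hb : 0 ≤ b := by
    have := (norm_nonneg _).trans (hvb 0 (Nat.zero_le _) 0)
    exact nonneg_of_mul_nonneg_left this (decay_pos _ _)
  refine (norm_iteratedFDeriv_mul_le hu hv' y hk').trans ?_
  have hD : decay m y * decay (m + M) (y - x) ≤ decay m x * decay M (y - x) := by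
    rw [decay_add, ← mul_assoc]
    exact mul_le_mul_of_nonneg_right (decay_mul_decay_sub_le m x y) (decay_pos _ _).le
  calc _ ≤ ∑ i ∈ Finset.range (k + 1),
          (k.choose i : ℝ) * (a * b * (decay m x * decay M (y - x))) := by
        refine Finset.sum_le_sum fun i hi => ?_
        have hi' : i ≤ k := Nat.lt_succ_iff.1 (Finset.mem_range.1 hi)
        rw [mul_assoc]
        refine mul_le_mul_of_nonneg_left ?_ (by positivity)
        rw [iteratedFDeriv_comp_sub]
        calc _ ≤ (a * decay m y) * (b * decay (m + M) (y - x)) := by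
              gcongr
              · exact mul_nonneg ha (decay_pos _ _).le
              · exact hua i (hi'.trans hk) y
              · exact hvb (k - i) ((Nat.sub_le _ _).trans hk) (y - x)
          _ = a * b * (decay m y * decay (m + M) (y - x)) := by ring
          _ ≤ _ := by gcongr
    _ = 2 ^ k * (a * b * (decay m x * decay M (y - x))) := by
        rw [← Finset.sum_mul]
        congr 1
        exact_mod_cast Nat.sum_range_choose k
    _ ≤ 2 ^ n * (a * b * (decay m x * decay M (y - x))) := by
        have := decay_pos m x
        have := decay_pos M (y - x)
        gcongr
        norm_num
    _ = _ := by ring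

theorem exists_decay_bound_schwartz (u : 𝓢(Eucl d, ℂ)) (n m : ℕ) :
    ∃ a, 0 ≤ a ∧ ∀ i ≤ n, ∀ y, ‖iteratedFDeriv ℝ i u y‖ ≤ a * decay m y := by
  refine ⟨2 ^ m * ((Finset.Iic (m, n)).sup fun j => SchwartzMap.seminorm ℝ j.1 j.2) u,
    mul_nonneg (by positivity) (apply_nonneg _ _), fun i hi y => ?_⟩
  rw [decay, ← div_eq_mul_inv, le_div_iff₀ (by positivity), mul_comm]
  exact SchwartzMap.one_add_le_sup_seminorm_apply (𝕜 := ℝ) (m := (m, n)) (k := m) le_rfl hi u y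

/-- Decay in `x` comes from the product and decay in `ξ` from `N` derivatives. Since `K` does not
depend on `u`, the transform is small whenever `u` is small in the relevant Schwartz seminorms. -/
theorem exists_norm_fourierAt_mul_le (v : GelfandShilov d) (N : ℕ) :
    ∃ K, 0 ≤ K ∧ ∀ (u : 𝓢(Eucl d, ℂ)) (a : ℝ), 0 ≤ a →
      (∀ i ≤ N, ∀ y, ‖iteratedFDeriv ℝ i u y‖ ≤ a * decay N y) → ∀ x ξ,
      ‖fourierAt (fun y => u y * v (y - x)) ξ‖ ≤ K * a * (decay N x * decay N ξ) := by
  obtain ⟨b, hb0, hb⟩ := v.exists_decay_bound N (N + (d + 1))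
  have hI0 : 0 ≤ ∫ y, decay (d + 1) (y : Eucl d) := integral_nonneg fun y => (decay_pos _ y).le
  set I := ∫ y, decay (d + 1) (y : Eucl d) with hI
  refine ⟨2 ^ N * (2 * (2 ^ N * b * I)), by positivity, fun u a ha hu x ξ => ?_⟩
  set w : Eucl d → ℂ := fun y => u y * v (y - x) with hw
  have husm : ContDiff ℝ (⊤ : ℕ∞) u := u.smooth ⊤
  have hwsm : ContDiff ℝ (⊤ : ℕ∞) w :=
    husm.mul (v.contDiff.comp (contDiff_id.sub contDiff_const))
  have hn : ∀ n : ℕ, (n : WithTop ℕ∞) ≤ ((⊤ : ℕ∞) : WithTop ℕ∞) := fun n => by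
    exact_mod_cast le_top
  have hint : ∀ n, Integrable (iteratedFDeriv ℝ n w) := fun n => by
    obtain ⟨a', ha', hu'⟩ := exists_decay_bound_schwartz u n 0
    obtain ⟨b', hb0', hb'⟩ := v.exists_decay_bound n (0 + (d + 1))
    refine (((integrable_decay d).comp_sub_right x).const_mul (2 ^ n * a' * b' * decay 0 x)).mono'
      (hwsm.continuous_iteratedFDeriv (hn n)).aestronglyMeasurable (.of_forall fun y => ?_)
    exact norm_iteratedFDeriv_mul_comp_sub_le husm v.contDiff ha' hu' hb' le_rfl x y
  have hbound : ∀ k ≤ N, ‖ξ‖ ^ k * ‖fourierAt w ξ‖ ≤ 2 ^ N * a * b * decay N x * I := fun k hk => by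
    refine (pow_mul_norm_fourierAt_le hwsm hint k ξ).trans ?_
    calc ∫ y, ‖iteratedFDeriv ℝ k w y‖
        ≤ ∫ y, 2 ^ N * a * b * decay N x * decay (d + 1) (y - x) := by
          refine integral_mono (hint k).norm
            (((integrable_decay d).comp_sub_right x).const_mul _) fun y => ?_
          exact norm_iteratedFDeriv_mul_comp_sub_le husm v.contDiff ha hu hb hk x y
      _ = _ := by
          rw [integral_const_mul, integral_sub_right_eq_self fun y => decay (d + 1) y]
  have h0 := hbound 0 (Nat.zero_le _)
  have hN := hbound N le_rfl
  rw [pow_zero, one_mul] at h0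
  have hpow : (1 + ‖ξ‖) ^ N ≤ 2 ^ N * (1 + ‖ξ‖ ^ N) := by
    calc (1 + ‖ξ‖) ^ N ≤ 2 ^ (N - 1) * (1 ^ N + ‖ξ‖ ^ N) := add_pow_le zero_le_one (norm_nonneg _) N
      _ ≤ _ := by rw [one_pow]; gcongr <;> simp
  have hfin : (1 + ‖ξ‖) ^ N * ‖fourierAt w ξ‖ ≤
      2 ^ N * (2 * (2 ^ N * a * b * decay N x * I)) := by
    calc _ ≤ 2 ^ N * (1 + ‖ξ‖ ^ N) * ‖fourierAt w ξ‖ := by gcongr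
      _ = 2 ^ N * (‖fourierAt w ξ‖ + ‖ξ‖ ^ N * ‖fourierAt w ξ‖) := by ring
      _ ≤ _ := by
        refine mul_le_mul_of_nonneg_left ?_ (by positivity)
        linarith
  calc ‖fourierAt w ξ‖ = ((1 + ‖ξ‖) ^ N * ‖fourierAt w ξ‖) * decay N ξ := by
        rw [mul_right_comm, one_add_norm_pow_mul_decay, one_mul]
    _ ≤ 2 ^ N * (2 * (2 ^ N * a * b * decay N x * I)) * decay N ξ :=
        mul_le_mul_of_nonneg_right hfin (decay_pos _ _).le
    _ = _ := by ring

/-- The distribution given by a Schwartz function. -/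
def GelfandShilovDual.ofSchwartz (u : 𝓢(Eucl d, ℂ)) : GelfandShilovDual d :=
  .ofIntegrable u u.integrable

/-- A weight of order `m` costs `m` orders of decay in each variable. Finitely many Schwartz
seminorms therefore control the norm. -/
theorem exists_modNorm_ofSchwartz_le {ω : Eucl d × Eucl d → ℝ} {C : ℝ} {m : ℕ}
    (hpos : ∀ X, 0 < ω X) (hω : ∀ X, ω X ≤ C * (1 + ‖X‖) ^ m) (φ : GelfandShilov d) {p q : ℝ≥0∞}
    (hp : 0 < p) (hq : 0 < q) :
    ∃ (N : ℕ) (K : ℝ≥0∞), K ≠ ⊤ ∧ ∀ (u : 𝓢(Eucl d, ℂ)) (a : ℝ), 0 ≤ a →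
      (∀ i ≤ N, ∀ y, ‖iteratedFDeriv ℝ i u y‖ ≤ a * decay N y) →
      modNorm φ p q ω (.ofSchwartz u) ≤ K * ENNReal.ofReal a := by
  obtain ⟨N, K, hK, h⟩ := exists_mixedNormOn_le d hp hq
  obtain ⟨A, hA0, hA⟩ := exists_norm_fourierAt_mul_le φ.conj (N + m)
  have hC : 0 ≤ C := by
    have := (hpos 0).le.trans (hω 0)
    simpa using this
  set c : ℝ := (2 * Real.pi) ^ (-(d : ℝ) / 2) with hc
  have hc0 : 0 ≤ c := by positivity
  refine ⟨N + m, K * ENNReal.ofReal (c * A * C), ENNReal.mul_ne_top hK ENNReal.ofReal_ne_top,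
    fun u a ha hu => ?_⟩
  rw [mul_assoc, ← ENNReal.ofReal_mul (by positivity)]
  refine h ω _ _ (by positivity) fun x ξ => ?_
  have h1 : ω (x, ξ) ≤ C * ((1 + ‖x‖) ^ m * (1 + ‖ξ‖) ^ m) := by
    refine (hω _).trans ?_
    rw [← mul_pow]
    gcongr
    have := norm_le_fst_add_snd (x, ξ)
    simp only at this
    nlinarith [norm_nonneg x, norm_nonneg ξ]
  rw [GelfandShilovDual.ofSchwartz, stft_ofIntegrable, norm_mul, norm_mul, Complex.norm_real,
    Complex.norm_real, Real.norm_of_nonneg hc0, Real.norm_of_nonneg (hpos _).le]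
  calc c * ‖fourierAt (fun y => u y * φ.conj (y - x)) ξ‖ * ω (x, ξ)
      ≤ c * (A * a * (decay (N + m) x * decay (N + m) ξ)) *
          (C * ((1 + ‖x‖) ^ m * (1 + ‖ξ‖) ^ m)) := by
        have := (hpos (x, ξ)).le
        have := decay_pos (N + m) x
        have := decay_pos (N + m) ξ
        gcongr
        exact hA u a ha hu x ξ
    _ = c * A * C * a * (decay N x * decay N ξ) * (((1 + ‖x‖) ^ m * decay m x) *
          ((1 + ‖ξ‖) ^ m * decay m ξ)) := by rw [decay_add, decay_add]; ring
    _ = _ := by rw [one_add_norm_pow_mul_decay, one_add_norm_pow_mul_decay]; ring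

end Decay

/-! ### Density -/

section Density

variable {d : ℕ} {ω : Eucl d × Eucl d → ℝ} {C s : ℝ}

theorem stft_add (φ : GelfandShilov d) (f g : GelfandShilovDual d) (X : Eucl d × Eucl d) :
    stft φ (f + g) X = stft φ f X + stft φ g X := by
  simp only [stft, ← mul_add]
  rfl

theorem IsExpModerate.measurable_slice (hω : IsExpModerate ω C s) (φ : GelfandShilov d)
    (f : GelfandShilovDual d) : Measurable fun ξ =>
      eLpNorm (fun x => stft φ f (x, ξ) * (ω (x, ξ) : ℂ)) ⊤ (volume.restrict Set.univ) := by
  have hc : Continuous fun X => stft φ f X * (ω X : ℂ) := by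
    have h1 := hω.continuous
    have h2 := continuous_stft φ f
    fun_prop
  convert measurable_biSup_slice (hω.continuous_enorm φ f) Set.univ using 2 with ξ
  exact le_antisymm (eLpNorm_top_restrict_le .univ)
    (le_eLpNorm_top_restrict (hc.comp (Continuous.prodMk_left ξ)) isOpen_univ subset_rfl)

/-- For `q < 1` the norm is only a quasi-norm; this continuity of addition at zero replaces the
triangle inequality. -/
theorem IsExpModerate.exists_modNorm_add_lt (hω : IsExpModerate ω C s) (φ : GelfandShilov d)
    (q : ℝ≥0∞) {ε : ℝ≥0∞} (hε : ε ≠ 0) : ∃ η, 0 < η ∧ ∀ f g : GelfandShilovDual d,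
      modNorm φ ⊤ q ω f ≤ η → modNorm φ ⊤ q ω g ≤ η → modNorm φ ⊤ q ω (f + g) < ε := by
  obtain ⟨η, hη, h⟩ := exists_Lp_half ℝ≥0∞ (volume : Measure (Eucl d)) q hε
  refine ⟨η, hη, fun f g hf hg => lt_of_le_of_lt ?_ (h _ _
    (hω.measurable_slice φ f).aestronglyMeasurable (hω.measurable_slice φ g).aestronglyMeasurable
    hf hg)⟩
  refine eLpNorm_mono_enorm fun ξ => ?_
  simp only [enorm_eq_self, Pi.add_apply]
  have hm : ∀ f : GelfandShilovDual d, AEStronglyMeasurable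
      (fun x => stft φ f (x, ξ) * (ω (x, ξ) : ℂ)) (volume.restrict Set.univ) := fun f => by
    have h1 := hω.continuous
    have h2 := continuous_stft φ f
    exact Continuous.aestronglyMeasurable (by fun_prop)
  refine le_of_eq_of_le ?_ (eLpNorm_add_le (hm f) (hm g) le_top)
  congr 1
  funext x
  simp only [Pi.add_apply, stft_add, add_mul]

/-- Multiply by a dilated bump equal to one on the ball of radius `R ≥ 1`, whose derivatives are
bounded uniformly in `R`. The error lives where `‖y‖ ≥ R`, and there one extra order of decay of `u`
gains a factor `1 / R`. -/
theorem exists_compactSupport_approx (u : 𝓢(Eucl d, ℂ)) (N : ℕ) {ε : ℝ} (hε : 0 < ε) :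
    ∃ g : 𝓢(Eucl d, ℂ), HasCompactSupport g ∧
      ∀ i ≤ N, ∀ y, ‖iteratedFDeriv ℝ i (u - g) y‖ ≤ ε * decay N y := by
  let χ : ContDiffBump (0 : Eucl d) := ⟨1, 2, one_pos, one_lt_two⟩
  let c : Eucl d → ℂ := fun y => (χ y : ℂ)
  have hc : ContDiff ℝ (⊤ : ℕ∞) c := Complex.ofRealCLM.contDiff.comp χ.contDiff
  have hcs : HasCompactSupport c := χ.hasCompactSupport.comp_left Complex.ofReal_zero
  obtain ⟨b, hb0, hb⟩ := exists_decay_bound_schwartz (hcs.toSchwartzMap hc) N 0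
  obtain ⟨A, hA0, hA⟩ := exists_decay_bound_schwartz u N (N + 1)
  set R : ℝ := max 1 ((A + 2 ^ N * b * A) / ε) with hR
  have hR1 : 1 ≤ R := le_max_left _ _
  have hR0 : 0 < R := by linarith
  have hRε : A + 2 ^ N * b * A ≤ ε * R := by
    have := le_max_right 1 ((A + 2 ^ N * b * A) / ε)
    rwa [← hR, div_le_iff₀' hε] at this
  let cR : Eucl d → ℂ := fun y => c (R⁻¹ • y)
  have hcR : ContDiff ℝ (⊤ : ℕ∞) cR := hc.comp (contDiff_const_smul R⁻¹)
  have hcRs : HasCompactSupport cR := hcs.comp_smul (inv_ne_zero hR0.ne')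
  have hcRb : ∀ i ≤ N, ∀ y, ‖iteratedFDeriv ℝ i cR y‖ ≤ b * decay 0 y := fun i hi y => by
    have hi' : (i : WithTop ℕ∞) ≤ ((⊤ : ℕ∞) : WithTop ℕ∞) := by exact_mod_cast le_top
    rw [iteratedFDeriv_comp_const_smul R⁻¹ (hc.of_le hi')]
    simp only
    rw [norm_smul, norm_pow, Real.norm_of_nonneg (by positivity)]
    have h1 := hb i hi (R⁻¹ • y)
    simp only [decay, pow_zero, inv_one, mul_one] at h1 ⊢
    refine (mul_le_of_le_one_left (norm_nonneg _) ?_).trans h1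
    exact pow_le_one₀ (by positivity) (inv_le_one_of_one_le₀ hR1)
  have husm : ContDiff ℝ (⊤ : ℕ∞) u := u.smooth ⊤
  have hgs : HasCompactSupport fun y => cR y * u y := hcRs.mul_right
  have hgsm : ContDiff ℝ (⊤ : ℕ∞) fun y => cR y * u y := hcR.mul husm
  refine ⟨hgs.toSchwartzMap hgsm, hgs, fun i hi y => ?_⟩
  have hi' : (i : WithTop ℕ∞) ≤ ((⊤ : ℕ∞) : WithTop ℕ∞) := by exact_mod_cast le_top
  change ‖iteratedFDeriv ℝ i (⇑u - fun y => cR y * u y) y‖ ≤ _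
  rcases lt_or_ge ‖y‖ R with hy | hy
  · have h0 : (⇑u - fun y => cR y * u y) =ᶠ[𝓝 y] fun _ => 0 := by
      have : ∀ᶠ z in 𝓝 y, ‖z‖ < R := (isOpen_lt continuous_norm continuous_const).mem_nhds hy
      filter_upwards [this] with z hz
      have h1 : χ (R⁻¹ • z) = 1 := χ.one_of_mem_closedBall (by
        rw [mem_closedBall_zero_iff, norm_smul, Real.norm_of_nonneg (by positivity),
          inv_mul_le_iff₀ hR0]
        simpa [χ] using hz.le)
      simp [cR, c, h1]
    rw [(h0.iteratedFDeriv ℝ i).eq_of_nhds, iteratedFDeriv_fun_zero]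
    simpa using mul_nonneg hε.le (decay_pos N y).le
  · rw [iteratedFDeriv_sub_apply (husm.of_le hi').contDiffAt (hgsm.of_le hi').contDiffAt]
    have h2 := norm_iteratedFDeriv_mul_comp_sub_le hcR husm (M := N + 1) hb0 hcRb
      (by simpa using hA) hi 0 y
    simp only [sub_zero] at h2
    have h3 : decay (N + 1) y ≤ decay N y * R⁻¹ := by
      rw [decay_add]
      refine mul_le_mul_of_nonneg_left ?_ (decay_pos N y).le
      rw [decay, pow_one]
      gcongr
      linarith
    have h4 : decay 0 (0 : Eucl d) = 1 := by simp [decay]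
    rw [h4, mul_one] at h2
    have := decay_pos N y
    calc _ ≤ A * decay (N + 1) y + 2 ^ N * b * A * decay (N + 1) y :=
          (norm_sub_le _ _).trans (add_le_add (hA i hi y) h2)
      _ = (A + 2 ^ N * b * A) * decay (N + 1) y := by ring
      _ ≤ (ε * R) * (decay N y * R⁻¹) :=
          mul_le_mul hRε h3 (decay_pos _ _).le (by positivity)
      _ = _ := by field_simp

theorem GelfandShilovDual.ofSchwartz_sub (u g : 𝓢(Eucl d, ℂ)) :
    ofSchwartz (u - g) = ofSchwartz u - ofSchwartz g := by
  ext ψ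
  change ∫ y, (u - g) y * ψ y = (∫ y, u y * ψ y) - ∫ y, g y * ψ y
  rw [← integral_sub (integrable_mul u.integrable ψ) (integrable_mul g.integrable ψ)]
  refine integral_congr_ae (.of_forall fun y => ?_)
  simp only [sub_apply, sub_mul]

theorem ofSchwartz_mem_smoothCompactlySupported {u : 𝓢(Eucl d, ℂ)} (hu : HasCompactSupport u) :
    GelfandShilovDual.ofSchwartz u ∈ smoothCompactlySupported d :=
  ⟨u, u.smooth ⊤, hu, rfl⟩

theorem exists_ofSchwartz_of_mem {f : GelfandShilovDual d} (hf : f ∈ smoothCompactlySupported d) :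
    ∃ u : 𝓢(Eucl d, ℂ), HasCompactSupport u ∧ f = .ofSchwartz u := by
  obtain ⟨g, hg, hc, rfl⟩ := hf
  exact ⟨hc.toSchwartzMap hg, hc, rfl⟩

theorem smoothCompactlySupported_subset_compactlySupportedDistributions :
    smoothCompactlySupported d ⊆ compactlySupportedDistributions d := by
  intro f hf
  obtain ⟨u, hu, rfl⟩ := exists_ofSchwartz_of_mem hf
  refine ⟨SchwartzMap.toTemperedDistributionCLM (Eucl d) ℂ volume u, ?_, fun ψ => ?_⟩
  -- The distributional support is an intersection of closed sets, one of which is `tsupport u`.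
  · refine IsCompact.of_isClosed_subset hu (isClosed_sInter fun s hs => hs.2)
      (Set.sInter_subset_of_mem ⟨fun ψ hψ => ?_, isClosed_tsupport u⟩)
    rw [SchwartzMap.toTemperedDistributionCLM_apply_apply volume]
    refine integral_eq_zero_of_ae (.of_forall fun x => ?_)
    by_cases hx : x ∈ tsupport ψ
    · simp [image_eq_zero_of_notMem_tsupport (hψ hx)]
    · simp [image_eq_zero_of_notMem_tsupport hx]
  · rw [SchwartzMap.toTemperedDistributionCLM_apply_apply volume]
    change ∫ y, u y * ψ y = ∫ y, ψ y * u y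
    simp only [mul_comm]

theorem smoothCompactlySupported_subset_modFlat {m : ℕ} (hpos : ∀ X, 0 < ω X)
    (hω : ∀ X, ω X ≤ C * (1 + ‖X‖) ^ m) (φ : GelfandShilov d) {q : ℝ≥0∞} (hq : 0 < q) :
    smoothCompactlySupported d ⊆ modFlat φ q ω := by
  intro f hf
  obtain ⟨u, hu, rfl⟩ := exists_ofSchwartz_of_mem hf
  refine Set.mem_iInter₂.2 fun p hp => ?_
  obtain ⟨N, K, hK, h⟩ := exists_modNorm_ofSchwartz_le hpos hω φ hp hq
  obtain ⟨a, ha, hua⟩ := exists_decay_bound_schwartz u N N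
  exact (h u a ha hua).trans_lt (ENNReal.mul_lt_top hK.lt_top ENNReal.ofReal_lt_top)

theorem IsDenseInModSharp.mono {φ : GelfandShilov d} {q : ℝ≥0∞} {A B : Set (GelfandShilovDual d)}
    (hA : IsDenseInModSharp φ q ω A) (hAB : A ⊆ B) (hB : B ⊆ modSharp φ q ω) :
    IsDenseInModSharp φ q ω B :=
  ⟨hB, fun f hf ε hε => (hA.2 f hf ε hε).imp fun _ hg => ⟨hAB hg.1, hg.2⟩⟩

theorem IsExpModerate.isDense_gelfandShilovFunctions (hω : IsExpModerate ω C s)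
    {φ : GelfandShilov d} (hφ : φ ≠ 0) {q : ℝ≥0∞} (hq0 : 0 < q) (hq : q < ⊤) :
    IsDenseInModSharp φ q ω (gelfandShilovFunctions d) := by
  refine ⟨(hω.gelfandShilovFunctions_subset φ hq0).trans (hω.modFlat_subset hφ hq0 hq),
    fun f hf ε hε => ?_⟩
  obtain ⟨g, hg⟩ := hω.exists_modNorm_sub_lt hφ hq0 hq hf hε
  exact ⟨_, ⟨g, rfl⟩, hg⟩

/-- Approximate first by an element of `Σ_1`, then approximate that element in Schwartz seminorms by
a compactly supported function. -/
theorem IsExpModerate.isDense_smoothCompactlySupported (hω : IsExpModerate ω C s)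
    {A : ℝ} {m : ℕ} (hpoly : ∀ X, ω X ≤ A * (1 + ‖X‖) ^ m)
    {φ : GelfandShilov d} (hφ : φ ≠ 0) {q : ℝ≥0∞} (hq0 : 0 < q) (hq : q < ⊤) :
    IsDenseInModSharp φ q ω (smoothCompactlySupported d) := by
  refine ⟨(smoothCompactlySupported_subset_modFlat hω.pos hpoly φ hq0).trans
    (hω.modFlat_subset hφ hq0 hq), fun f hf ε hε => ?_⟩
  obtain ⟨η, hη, hadd⟩ := hω.exists_modNorm_add_lt φ q hε.ne'
  obtain ⟨g, hg⟩ := hω.exists_modNorm_sub_lt hφ hq0 hq hf hη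
  obtain ⟨N, K, hK, h⟩ := exists_modNorm_ofSchwartz_le hω.pos hpoly φ ENNReal.zero_lt_top hq0
  obtain ⟨δ, hδ, hδη⟩ : ∃ δ : ℝ, 0 < δ ∧ K * ENNReal.ofReal δ ≤ η := by
    have ht : Tendsto (fun δ : ℝ => K * ENNReal.ofReal δ) (𝓝[>] 0) (𝓝 0) := by
      have := ENNReal.Tendsto.const_mul (ENNReal.tendsto_ofReal (tendsto_id (x := 𝓝 (0 : ℝ))))
        (.inr hK)
      simp only [id, ENNReal.ofReal_zero, mul_zero] at this
      exact this.mono_left nhdsWithin_le_nhds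
    obtain ⟨δ, h1, h2⟩ := ((ht.eventually (gt_mem_nhds hη)).and self_mem_nhdsWithin).exists
    exact ⟨δ, h2, h1.le⟩
  obtain ⟨w, hw, hgw⟩ := exists_compactSupport_approx g.toSchwartz N hδ
  refine ⟨_, ofSchwartz_mem_smoothCompactlySupported hw, ?_⟩
  have h1 := hadd _ _ hg.le ((h (g.toSchwartz - w) δ hδ.le hgw).trans hδη)
  have h2 : GelfandShilovDual.ofIntegrable g g.integrable = .ofSchwartz g.toSchwartz := rfl
  rwa [GelfandShilovDual.ofSchwartz_sub, h2, sub_add_sub_cancel] at h1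

theorem IsPolynomiallyModerateWeight.exists_le_pow (hω : IsPolynomiallyModerateWeight ω) :
    ∃ (A : ℝ) (m : ℕ), ∀ X, ω X ≤ A * (1 + ‖X‖) ^ m := by
  obtain ⟨⟨hpos, -⟩, A, r, hA, -, h⟩ := hω
  refine ⟨A * ω 0, ⌈r⌉₊, fun X => ?_⟩
  have h1 := h 0 X
  rw [zero_add] at h1
  refine h1.trans ?_
  have := hpos 0
  gcongr
  rw [← Real.rpow_natCast]
  exact Real.rpow_le_rpow_of_exponent_le (by simp) (Nat.le_ceil r)

end Density

end

/-! ### The theorem -/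

theorem mainTheorem1 (d : ℕ) (q : ℝ≥0∞) (hq0 : 0 < q) (hq : q < ⊤)
    (ω : Eucl d × Eucl d → ℝ) (hω : IsModerateWeight ω)
    (φ : GelfandShilov d) (hφ : φ ≠ 0) :
    (IsDenseInModSharp φ q ω (modFlat φ q ω) ∧
      IsDenseInModSharp φ q ω (gelfandShilovFunctions d)) ∧
    (IsPolynomiallyModerateWeight ω →
      IsDenseInModSharp φ q ω (modFlat φ q ω ∩ compactlySupportedDistributions d) ∧
      IsDenseInModSharp φ q ω (smoothCompactlySupported d)) := by
  -- The spaces and the notion of density depend only on the equivalence class of the weight, so all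
  -- is proved for the continuous weight `ω'`.
  obtain ⟨ω', s, K, hω', hK, hle⟩ := hω.exists_isExpModerate
  have hpos := hω.1.1
  have h1 : ∀ X, ω X ≤ (1 : NNReal) * ω' X := fun X => by simpa using (hle X).1
  have h2 : ∀ X, ω' X ≤ K.toNNReal * ω X := fun X => by
    rw [Real.coe_toNNReal K (by linarith)]
    exact (hle X).2
  have hflat : modFlat φ q ω' = modFlat φ q ω :=
    (modFlat_subset_of_le hpos h1 φ q).antisymm (modFlat_subset_of_le hω'.pos h2 φ q)
  have htransfer {A : Set (GelfandShilovDual d)} (hA : IsDenseInModSharp φ q ω' A) :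
      IsDenseInModSharp φ q ω A := hA.of_le hpos hω'.pos h1 h2
  have hsub := hω'.modFlat_subset hφ hq0 hq
  have hS := hω'.isDense_gelfandShilovFunctions hφ hq0 hq
  rw [← hflat]
  -- A set between a dense subset and the whole space is dense: `M^{♭,q}` contains `Σ_1`, and below
  -- `M^{♭,q} ∩ ℰ'` contains `C_0^∞`.
  refine ⟨⟨htransfer (hS.mono (hω'.gelfandShilovFunctions_subset φ hq0) hsub), htransfer hS⟩,
    fun hpol => ?_⟩
  obtain ⟨A, m, hA⟩ := hpol.exists_le_pow
  have hA' : ∀ X, ω' X ≤ K * A * (1 + ‖X‖) ^ m := fun X =>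
    ((hle X).2.trans (mul_le_mul_of_nonneg_left (hA X) (by linarith))).trans_eq
      (mul_assoc _ _ _).symm
  have hD := hω'.isDense_smoothCompactlySupported hA' hφ hq0 hq
  exact ⟨htransfer (hD.mono (Set.subset_inter
    (smoothCompactlySupported_subset_modFlat hω'.pos hA' φ hq0)
    smoothCompactlySupported_subset_compactlySupportedDistributions)
    (Set.inter_subset_left.trans hsub)), htransfer hD⟩
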